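/- **Model.** Algorithms are deterministic word-RAM programs: memory cells hold integers, indirect addressing is allowed, and addition, subtraction, multiplication, integer division, comparison and memory access have unit cost. On inputs of size parameter $S$ every number that occurs (in particular every address) has absolute value at most $(S+2)^c$ for some constant $c$ of the algorithm, i.e. words have $O(\log S)$ bits. **4SUM.** Given sets $A_1,\dots,A_4$ of $n\ge 1$ integers each, contained in $\{-n^4,\dots,n^4\}$, decide whether there are $a_i\in A_i$ with $a_1+a_2+a_3+a_4=0$; here $S=n$. The *4SUM Hypothesis* says that for no $\varepsilon>0$ there is an $O(n^{2-\varepsilon})$-time algorithm for 4SUM. **Subset Sum.** Given $n$ integers and an integer target, decide whether some of the given integers (at a subset of the positions) sum to the target; here $S=2^n+M$, where $M$ is the largest absolute value of an input number. The *Subset Sum Hypothesis* says that for no $0<\varepsilon<2$ there is an $O((2-\varepsilon)^{n/2})$-time algorithm for Subset Sum. **Largest copy under translations.** Given simple orthogonal polygons $P$ and $Q$ (closed regions, bounded by simple closed polygonal curves with integral vertices whose consecutive edges are alternately horizontal and vertical) with $p$ and $q$ vertices, compute, as a fraction of two integers, the largest $\lambda>0$ such that $\lambda P+\tau\subseteq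 Q$ for some $\tau\in\mathbb{R}^2$; here $S=p+q+M_P+M_Q$, where $M_P$ and $M_Q$ are the largest absolute values of the vertex coordinates of $P$ and $Q$, respectively. **Theorem.** 1. Assume the 4SUM Hypothesis. Then there are constants $p_0$ and $C$ such that for no $\varepsilon>0$ there is an $O(q^{2-\varepsilon})$-time algorithm for computing the largest copy of $P$ that can be translated into $Q$, even restricted to simple orthogonal polygons $P,Q$ with $p\le p_0$ (that is, $p=O(1)$) and all coordinates of absolute value at most $q^C$. 2. Assume the Subset Sum Hypothesis. Then there is a constant $p_0$ such that for no $\varepsilon>0$ there is an $O(q^{2-\varepsilon})$-time algorithm for computing the largest copy of $P$ that can be translated into $Q$, even restricted to simple orthogonal polygons $P,Q$ with $p\le p_0$. -/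

import Mathlib

namespace Placement

/-! ## The machine: a word RAM with finitely many integer arrays -/

/-- Memory: array number `a`, cell `i`, holds the integer `σ a i`. A program names only finitely
many arrays, each of which is indexed by computed integers (indirect addressing). -/
abbrev Store : Type := ℕ → ℤ → ℤ

/-- Arithmetic expressions: constants, array cells with a computed index, the integer operations,
and comparisons with value `1` (true) or `0` (false). -/
inductive Expr : Type
  | const (v : ℤ) : Expr
  | cell (a : ℕ) (i : Expr) : Expr
  | add (e f : Expr) : Expr
  | sub (e f : Expr) : Expr
  | mul (e f : Expr) : Expr
  | div (e f : Expr) : Expr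
  | lt (e f : Expr) : Expr
  | eq (e f : Expr) : Expr

/-- A number fits into a machine word for the word range `W` if its absolute value is at most `W`;
otherwise the computation is aborted. -/
def word (W : ℕ) (v : ℤ) : Option ℤ := if v.natAbs ≤ W then some v else none

/-- Value of an expression on a machine with word range `W` (`none` on overflow). -/
def Expr.eval (W : ℕ) (σ : Store) : Expr → Option ℤ
  | .const v => word W v
  | .cell a i => (i.eval W σ).bind fun k => word W (σ a k)
  | .add e f => (e.eval W σ).bind fun x => (f.eval W σ).bind fun y => word W (x + y)
  | .sub e f => (e.eval W σ).bind fun x => (f.eval W σ).bind fun y => word W (x - y)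
  | .mul e f => (e.eval W σ).bind fun x => (f.eval W σ).bind fun y => word W (x * y)
  | .div e f => (e.eval W σ).bind fun x => (f.eval W σ).bind fun y => word W (x / y)
  | .lt e f => (e.eval W σ).bind fun x => (f.eval W σ).bind fun y => some (if x < y then 1 else 0)
  | .eq e f => (e.eval W σ).bind fun x => (f.eval W σ).bind fun y => some (if x = y then 1 else 0)

/-- Unit cost for every constant, memory access and operation. -/
def Expr.cost : Expr → ℕ
  | .const _ => 1
  | .cell _ i => i.cost + 1
  | .add e f => e.cost + f.cost + 1
  | .sub e f => e.cost + f.cost + 1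
  | .mul e f => e.cost + f.cost + 1
  | .div e f => e.cost + f.cost + 1
  | .lt e f => e.cost + f.cost + 1
  | .eq e f => e.cost + f.cost + 1

/-- Programs. Conditions are expressions, a nonzero value meaning "true". -/
inductive Prog : Type
  | skip : Prog
  | assign (a : ℕ) (i e : Expr) : Prog
  | seq (s t : Prog) : Prog
  | ite (e : Expr) (s t : Prog) : Prog
  | loop (e : Expr) (s : Prog) : Prog

/-- The store after writing `v` into cell `k` of array `a`. -/
def Store.write (σ : Store) (a : ℕ) (k v : ℤ) : Store :=
  fun b j => if b = a ∧ j = k then v else σ b j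

/-- `Exec W s σ t σ'`: on a machine with word range `W`, the program `s` started in the store `σ`
halts after exactly `t` steps in the store `σ'`, without overflow. -/
inductive Exec (W : ℕ) : Prog → Store → ℕ → Store → Prop
  | skip (σ : Store) : Exec W .skip σ 1 σ
  | assign {a : ℕ} {i e : Expr} {σ : Store} {k v : ℤ}
      (hi : i.eval W σ = some k) (he : e.eval W σ = some v) :
      Exec W (.assign a i e) σ (i.cost + e.cost + 1) (σ.write a k v)
  | seq {s t : Prog} {σ σ' σ'' : Store} {m n : ℕ}
      (hs : Exec W s σ m σ') (ht : Exec W t σ' n σ'') : Exec W (.seq s t) σ (m + n) σ''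
  | ite_true {e : Expr} {s t : Prog} {σ σ' : Store} {v : ℤ} {m : ℕ}
      (he : e.eval W σ = some v) (hv : v ≠ 0) (hs : Exec W s σ m σ') :
      Exec W (.ite e s t) σ (e.cost + m + 1) σ'
  | ite_false {e : Expr} {s t : Prog} {σ σ' : Store} {m : ℕ}
      (he : e.eval W σ = some 0) (ht : Exec W t σ m σ') :
      Exec W (.ite e s t) σ (e.cost + m + 1) σ'
  | loop_true {e : Expr} {s : Prog} {σ σ' σ'' : Store} {v : ℤ} {m n : ℕ}
      (he : e.eval W σ = some v) (hv : v ≠ 0) (hs : Exec W s σ m σ')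
      (hl : Exec W (.loop e s) σ' n σ'') :
      Exec W (.loop e s) σ (e.cost + m + n + 1) σ''
  | loop_false {e : Expr} {s : Prog} {σ : Store} (he : e.eval W σ = some 0) :
      Exec W (.loop e s) σ (e.cost + 1) σ

/-- The initial store: the `a`-th input list stands in the cells `0, 1, …` of array `a`, and every
other cell holds `0`. -/
def load (input : List (List ℤ)) : Store :=
  fun a i => if 0 ≤ i then (input.getD a []).getD i.toNat 0 else 0

/-- There is an algorithm that, on all instances `I` with `valid I`, halts with a `correct` final
store within `O (T I)` steps, on words of `O (log (size I))` bits: the program and the constants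
`c`, `K` do not depend on the instance, and all numbers that occur have absolute value at most
`(size I + 2) ^ c`. -/
def SolvableInTime {ι : Type} (valid : ι → Prop) (input : ι → List (List ℤ)) (size : ι → ℕ)
    (correct : ι → Store → Prop) (T : ι → ℝ) : Prop :=
  ∃ (s : Prog) (c K : ℕ), ∀ I : ι, valid I →
    ∃ (t : ℕ) (σ : Store), Exec ((size I + 2) ^ c) s (load (input I)) t σ ∧
      correct I σ ∧ (t : ℝ) ≤ (K : ℝ) * T I

/-- The final store answers the yes/no question `A`: cell `0` of array `0` holds `1` or `0`. -/
def Decides (A : Prop) (σ : Store) : Prop := (A ∧ σ 0 0 = 1) ∨ (¬ A ∧ σ 0 0 = 0)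

/-! ## 4SUM and Subset Sum -/

/-- A 4SUM instance: four sets of integers, each given as a list in arbitrary order. -/
structure FourSum : Type where
  n : ℕ
  A : Fin 4 → List ℤ

/-- Each of the four sets has exactly `n ≥ 1` elements, all in `{-U, …, U}` with `U = n ^ 4`. -/
def FourSum.Valid (I : FourSum) : Prop :=
  1 ≤ I.n ∧ ∀ j, (I.A j).length = I.n ∧ (I.A j).Nodup ∧ ∀ a ∈ I.A j, a.natAbs ≤ I.n ^ 4

def FourSum.Yes (I : FourSum) : Prop := ∃ a : Fin 4 → ℤ, (∀ j, a j ∈ I.A j) ∧ ∑ j, a j = 0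

def FourSum.input (I : FourSum) : List (List ℤ) := [[(I.n : ℤ)], I.A 0, I.A 1, I.A 2, I.A 3]

/-- For no `ε > 0` there is an `O (n ^ (2 - ε))`-time algorithm for 4SUM
(on words of `O (log n)` bits). -/
def FourSumHypothesis : Prop :=
  ∀ ε : ℝ, 0 < ε → ¬ SolvableInTime FourSum.Valid FourSum.input FourSum.n
    (fun I => Decides I.Yes) (fun I => (I.n : ℝ) ^ (2 - ε))

/-- A Subset Sum instance: a list of integers (repetitions allowed) and a target. -/
structure SubsetSum : Type where
  items : List ℤ
  target : ℤ

/-- Some of the items (those at a subset of the positions) sum up to the target. -/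
def SubsetSum.Yes (I : SubsetSum) : Prop := ∃ s : List ℤ, s.Sublist I.items ∧ s.sum = I.target

def SubsetSum.input (I : SubsetSum) : List (List ℤ) :=
  [[(I.items.length : ℤ), I.target], I.items]

/-- Largest absolute value of a number in the list. -/
def maxAbs (l : List ℤ) : ℕ := (l.map Int.natAbs).foldr max 0

/-- Words have `O (n + log M)` bits, where `n` is the number of items and `M` the largest absolute
value of a number of the instance. -/
def SubsetSum.size (I : SubsetSum) : ℕ := 2 ^ I.items.length + maxAbs (I.target :: I.items)

/-- For no `ε > 0` Subset Sum with `n` items has an `O ((2 - ε) ^ (n / 2))`-time algorithm. -/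
def SubsetSumHypothesis : Prop :=
  ∀ ε : ℝ, 0 < ε → ε < 2 → ¬ SolvableInTime (fun _ => True) SubsetSum.input SubsetSum.size
    (fun I => Decides I.Yes) (fun I => (2 - ε) ^ ((I.items.length : ℝ) / 2))

/-! ## Orthogonal polygons -/

/-- A polygon with integral vertices, listed in cyclic order. -/
abbrev Polygon : Type := List (ℤ × ℤ)

namespace Polygon

/-- The `i`-th vertex, indices taken cyclically. -/
def vertex (L : Polygon) (i : ℕ) : ℤ × ℤ := L.getD (i % L.length) (0, 0)

/-- The `i`-th vertex as a point of the plane. -/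
def point (L : Polygon) (i : ℕ) : ℝ × ℝ := (((L.vertex i).1 : ℝ), ((L.vertex i).2 : ℝ))

/-- The `i`-th edge. -/
def edge (L : Polygon) (i : ℕ) : Set (ℝ × ℝ) := segment ℝ (L.point i) (L.point (i + 1))

/-- Simple: the vertices are distinct, consecutive edges share only their common vertex, and other
edges are disjoint. -/
def IsSimple (L : Polygon) : Prop :=
  3 ≤ L.length ∧ L.Nodup ∧
  (∀ i < L.length, L.edge i ∩ L.edge (i + 1) = {L.point (i + 1)}) ∧
  ∀ i < L.length, ∀ j < L.length, i ≠ j → (i + 1) % L.length ≠ j → (j + 1) % L.length ≠ i →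
    Disjoint (L.edge i) (L.edge j)

/-- Orthogonal: of any two consecutive edges, one is vertical and the other is horizontal. -/
def IsOrthogonal (L : Polygon) : Prop :=
  ∀ i < L.length,
    ((L.vertex i).1 = (L.vertex (i + 1)).1 ∧ (L.vertex (i + 1)).2 = (L.vertex (i + 2)).2) ∨
    ((L.vertex i).2 = (L.vertex (i + 1)).2 ∧ (L.vertex (i + 1)).1 = (L.vertex (i + 2)).1)

/-- The closed polygonal curve. -/
def boundary (L : Polygon) : Set (ℝ × ℝ) := ⋃ i < L.length, L.edge i

/-- The closed region bounded by the curve: the curve together with the bounded components of its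
complement. -/
def region (L : Polygon) : Set (ℝ × ℝ) :=
  {z | z ∈ L.boundary ∨ Bornology.IsBounded (connectedComponentIn L.boundaryᶜ z)}

/-- Largest absolute value of a coordinate of a vertex. -/
def maxCoord (L : Polygon) : ℕ := max (maxAbs (L.map Prod.fst)) (maxAbs (L.map Prod.snd))

end Polygon

/-! ## Largest copy under translations -/

/-- `lam` is the largest scaling factor such that a translate of `lam P` is contained in `Q`. -/
def IsLargestScale (P Q : Polygon) (lam : ℝ) : Prop :=
  IsGreatest {m : ℝ | 0 < m ∧ ∃ τ : ℝ × ℝ, ∀ z ∈ P.region, m • z + τ ∈ Q.region} lam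

structure Instance : Type where
  P : Polygon
  Q : Polygon

def Instance.Valid (I : Instance) : Prop :=
  I.P.IsSimple ∧ I.P.IsOrthogonal ∧ I.Q.IsSimple ∧ I.Q.IsOrthogonal

/-- Input: the numbers of vertices, then the coordinates of the vertices of `P` and of `Q`. -/
def Instance.input (I : Instance) : List (List ℤ) :=
  [[(I.P.length : ℤ), (I.Q.length : ℤ)],
    I.P.map Prod.fst, I.P.map Prod.snd, I.Q.map Prod.fst, I.Q.map Prod.snd]

/-- Every coordinate fits into a word. -/
def Instance.size (I : Instance) : ℕ :=
  I.P.length + I.Q.length + I.P.maxCoord + I.Q.maxCoord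

/-- Output: the largest scaling factor as a fraction, the numerator in cell `0` and the denominator
in cell `1` of array `0`. -/
def Instance.Correct (I : Instance) (σ : Store) : Prop :=
  0 < σ 0 1 ∧ IsLargestScale I.P I.Q ((σ 0 0 : ℝ) / (σ 0 1 : ℝ))

/-- On all pairs of simple orthogonal polygons that satisfy `restrict`, the largest scaling factor
of `P` under translations into `Q` can be computed in time `O (q ^ e)`, where `q` is the number of
vertices of `Q`. -/
def LargestCopyInTime (restrict : Instance → Prop) (e : ℝ) : Prop :=
  SolvableInTime (fun I : Instance => I.Valid ∧ restrict I) Instance.input Instance.size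
    Instance.Correct (fun I => (I.Q.length : ℝ) ^ e)

end Placement

/-! Both parts rest on one gadget: two polygons whose largest scale is at least 1 exactly when four
lists of integers in `[-U, U]` contain one element each with sum zero. The pattern is a square with
two teeth of width 1 on its top side and two on its right side, the teeth of a side being `8000 U`
apart. The container is a slightly larger square whose top and right sides both carry a slot of
width 2 for every list element `a`, at the positions `8 (1020 U - a)`, `8 (2022 U + a)`, `8 (3020 U
+ a)`, `8 (4022 U - a)` for the four lists. Suppose that the pattern scaled by `c ≥ 1` fits. There
is so little room that the top teeth enter slots of the first and second list and the right teeth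
slots of the third and fourth. The slot distances `8016 U + 8 (a₁ + a₂)` and `8016 U - 8 (a₃ + a₄)`
both differ from `8000 U c` by at most 2, so the multiple `8 (a₁ + a₂ + a₃ + a₄)` of 8 has absolute
value at most 4 and vanishes (`sum_zero_of_fits`). Conversely, for sum zero the scale `1 + (2 U + a₁
+ a₂) / (1000 U)`, which is at least 1, and a suitable translation put all teeth into slots
(`fits_of_sum_zero`).

The region of a polygon is defined through bounded components of the complement of the curve. Three
facts replace the Jordan curve theorem: a point from which a ray escapes without meeting the curve
is outside (`notMem_region_of_ray`); the explicit union of rectangles is inside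
(`combSolid_subset_region`); a scaled and translated copy of `P` lies in `Q` as soon as that of its
boundary does (`region_subset_of_boundary`).

The reductions are actual programs, verified with a small program logic for halting, cost and
absence of overflow. The slot positions are sorted and freed of repetitions, both polygons are
written out, the assumed algorithm is run on fresh arrays, and its numerator is compared with its
denominator (`reduceProg_runs`). From `m` slot positions this takes `O (m log m)` steps plus the
running time of the algorithm on `q = O (m)` vertices.

For 4SUM, `U = n ^ 4` and `m = 4 n`, so `q ^ (2 - ε)` is `O (n ^ (2 - ε))`, and all coordinates are
below `q ^ 9`. For Subset Sum the items are cut into four parts with at most about `2 ^ (n / 4)`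
subset sums each; then `q ^ (2 - ε)` is `O ((2 ^ ((2 - ε) / 2)) ^ (n / 2))`, whose base is below 2.
There `U` may be exponential in `n`, but it stays polynomial in the size parameter, so words remain
short. -/

namespace Placement

section Geometry

open Set

/-! ## Comb polygons -/

section Comb

/-- The chain of vertices along one toothed side of a comb: `x` alternates between `H` and `E`,
`y` runs through the values of `g`. -/
def combChain (H E : ℤ) (g : ℕ → ℤ) (k : ℕ) : ℤ × ℤ :=
  (H + (E - H) * ((k / 2 % 2 : ℕ) : ℤ), g ((k + 1) / 2))

/-- The boundary is run through counterclockwise: the origin, the right chain upwards, then the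
mirror image of such a chain in the diagonal, backwards. The two chains share the corner `(H, H)`,
which is listed only once, at `i = 4 * m + 2`. -/
def combVertex (m : ℕ) (H E : ℤ) (gR gT : ℕ → ℤ) (i : ℕ) : ℤ × ℤ :=
  if i = 0 then (0, 0) else if i ≤ 4 * m + 2 then combChain H E gR (i - 1)
  else (combChain H E gT (8 * m + 3 - i)).swap

/-- The square `[0, H]²` with slots of depth `E - H` on its right and on its top side. The slots
on the right are at the heights `[gR u, gR (u + 1)]` for odd `u < 2 * m`. -/
def comb (m : ℕ) (H E : ℤ) (gR gT : ℕ → ℤ) : Polygon :=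
  (List.range (8 * m + 4)).map (combVertex m H E gR gT)

/-- The values cut `[0, H]` into `2 * m + 1` intervals: those with odd index are the mouths of the
slots, those with even index are solid wall, so slots never touch each other or a corner. -/
structure IsSlotSeq (m : ℕ) (H : ℤ) (g : ℕ → ℤ) : Prop where
  zero : g 0 = 0
  last : g (2 * m + 1) = H
  lt : ∀ u ≤ 2 * m, g u < g (u + 1)

theorem IsSlotSeq.le {m : ℕ} {H : ℤ} {g : ℕ → ℤ} (h : IsSlotSeq m H g) {u v : ℕ} (huv : u ≤ v)
    (hv : v ≤ 2 * m + 1) : g u ≤ g v := by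
  induction v, huv using Nat.le_induction with
  | base => exact le_rfl
  | succ v huv ih => exact (ih (by omega)).trans (h.lt v (by omega)).le

theorem IsSlotSeq.strict {m : ℕ} {H : ℤ} {g : ℕ → ℤ} (h : IsSlotSeq m H g) {u v : ℕ}
    (huv : u < v) (hv : v ≤ 2 * m + 1) : g u < g v :=
  (h.lt u (by omega)).trans_le (h.le huv hv)

theorem IsSlotSeq.pos {m : ℕ} {H : ℤ} {g : ℕ → ℤ} (h : IsSlotSeq m H g) : 0 < H := by
  have := h.strict (u := 0) (v := 2 * m + 1) (by omega) le_rfl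
  rwa [h.zero, h.last] at this

structure IsComb (m : ℕ) (H E : ℤ) (gR gT : ℕ → ℤ) : Prop where
  right : IsSlotSeq m H gR
  top : IsSlotSeq m H gT
  lt : H < E

variable {m : ℕ} {H E : ℤ} {gR gT g : ℕ → ℤ}

@[simp] theorem comb_length : (comb m H E gR gT).length = 8 * m + 4 := by simp [comb]

theorem comb_vertex {i : ℕ} (hi : i < 8 * m + 4) :
    (comb m H E gR gT).vertex i = combVertex m H E gR gT i := by
  simp [Polygon.vertex, Nat.mod_eq_of_lt hi, comb, hi]

theorem vertex_mod (L : Polygon) (i : ℕ) : L.vertex (i % L.length) = L.vertex i := by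
  simp [Polygon.vertex]

theorem comb_vertex_length : (comb m H E gR gT).vertex (8 * m + 4) = (0, 0) := by
  rw [← vertex_mod]; simp [comb_vertex, combVertex]

theorem comb_vertex_right {k : ℕ} (hk : k ≤ 4 * m + 1) :
    (comb m H E gR gT).vertex (k + 1) = combChain H E gR k := by
  rw [comb_vertex (by omega)]; simp [combVertex]; omega

theorem comb_vertex_top (h : IsComb m H E gR gT) {i k : ℕ} (hi : i + k = 8 * m + 3)
    (hk : k ≤ 4 * m + 1) :
    (comb m H E gR gT).vertex i = (combChain H E gT k).swap := by
  rw [comb_vertex (by omega)]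
  obtain rfl : k = 8 * m + 3 - i := by omega
  unfold combVertex
  rw [if_neg (by omega)]
  split_ifs with h2
  -- The corner `(H, H)` is defined as the end of the right chain, but it is also the end of the top
  -- chain.
  · obtain rfl : i = 4 * m + 2 := by omega
    have h1 : 8 * m + 3 - (4 * m + 2) = 4 * m + 1 := by omega
    have h3 : (4 * m + 1) / 2 % 2 = 0 := by omega
    have h4 : (4 * m + 1 + 1) / 2 = 2 * m + 1 := by omega
    simp [combChain, h1, h3, h4, h.right.last, h.top.last]
  · rfl

theorem combChain_fst_eq {k l : ℕ} (h : k / 2 = l / 2) :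
    (combChain H E g k).1 = (combChain H E g l).1 := by simp [combChain, h]

theorem combChain_snd_eq {k l : ℕ} (h : (k + 1) / 2 = (l + 1) / 2) :
    (combChain H E g k).2 = (combChain H E g l).2 := by simp [combChain, h]

theorem comb_vertex_even (h : IsComb m H E gR gT) {i : ℕ} (hi : i < 8 * m + 4) (he : i % 2 = 0) :
    ((comb m H E gR gT).vertex i).2 = ((comb m H E gR gT).vertex (i + 1)).2 := by
  rcases Nat.eq_zero_or_pos i with rfl | h0
  · rw [comb_vertex_right (by omega), comb_vertex hi]
    simp [combVertex, combChain, h.right.zero]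
  rcases lt_or_ge i (4 * m + 2) with h1 | h1
  · obtain ⟨k, rfl⟩ : ∃ k, i = k + 1 := ⟨i - 1, by omega⟩
    rw [comb_vertex_right (by omega), comb_vertex_right (by omega)]
    exact combChain_snd_eq (by omega)
  · rw [comb_vertex_top h (k := 8 * m + 3 - i) (by omega) (by omega),
      comb_vertex_top h (k := 8 * m + 3 - (i + 1)) (by omega) (by omega)]
    exact combChain_fst_eq (g := gT) (by omega)

theorem comb_vertex_odd (h : IsComb m H E gR gT) {i : ℕ} (hi : i < 8 * m + 4) (ho : i % 2 = 1) :
    ((comb m H E gR gT).vertex i).1 = ((comb m H E gR gT).vertex (i + 1)).1 := by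
  rcases Nat.lt_or_ge i (4 * m + 2) with h1 | h1
  · obtain ⟨k, rfl⟩ : ∃ k, i = k + 1 := ⟨i - 1, by omega⟩
    rw [comb_vertex_right (by omega), comb_vertex_right (by omega)]
    exact combChain_fst_eq (by omega)
  rcases eq_or_ne i (8 * m + 3) with rfl | h2
  · rw [comb_vertex_length, comb_vertex_top h (k := 0) (by omega) (by omega)]
    simp [combChain, h.top.zero]
  · rw [comb_vertex_top h (k := 8 * m + 3 - i) (by omega) (by omega),
      comb_vertex_top h (k := 8 * m + 3 - (i + 1)) (by omega) (by omega)]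
    exact combChain_snd_eq (H := H) (E := E) (by omega)

theorem comb_isOrthogonal (h : IsComb m H E gR gT) : (comb m H E gR gT).IsOrthogonal := by
  intro i hi
  rw [comb_length] at hi
  have key : (comb m H E gR gT).vertex (i + 1) =
      (comb m H E gR gT).vertex ((i + 1) % (8 * m + 4)) := by
    rw [← comb_length (m := m) (H := H) (E := E) (gR := gR) (gT := gT), vertex_mod]
  have key2 : (comb m H E gR gT).vertex (i + 2) =
      (comb m H E gR gT).vertex ((i + 1) % (8 * m + 4) + 1) := by
    rw [← vertex_mod, ← vertex_mod (i := (i + 1) % (8 * m + 4) + 1), comb_length]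
    congr 1; rw [Nat.mod_add_mod]
  have hlt : (i + 1) % (8 * m + 4) < 8 * m + 4 := Nat.mod_lt _ (by omega)
  -- Edges with even index are horizontal and those with odd index vertical; the number of vertices
  -- is even, so this survives the wrap-around.
  have hpar : (i + 1) % (8 * m + 4) % 2 = (i + 1) % 2 :=
    Nat.mod_mod_of_dvd _ ⟨4 * m + 2, by ring⟩
  rcases Nat.mod_two_eq_zero_or_one i with h0 | h0
  · refine Or.inr ⟨comb_vertex_even h hi h0, ?_⟩
    rw [key2, key]; exact comb_vertex_odd h hlt (by omega)
  · refine Or.inl ⟨comb_vertex_odd h hi h0, ?_⟩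
    rw [key2, key]; exact comb_vertex_even h hlt (by omega)

/-! ### Edges of a comb and simplicity -/

theorem mem_segment_horizontal {a b z : ℝ × ℝ} (h : a.2 = b.2) :
    z ∈ segment ℝ a b ↔ z.2 = a.2 ∧ z.1 ∈ uIcc a.1 b.1 := by
  obtain ⟨a1, a2⟩ := a; obtain ⟨b1, b2⟩ := b; obtain ⟨z1, z2⟩ := z
  simp only at h; subst h
  rw [← Prod.image_mk_segment_left, segment_eq_uIcc]
  simp only [mem_image, Prod.mk.injEq]
  constructor
  · rintro ⟨x, hx, rfl, rfl⟩; exact ⟨rfl, hx⟩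
  · rintro ⟨rfl, hx⟩; exact ⟨_, hx, rfl, rfl⟩

theorem mem_segment_vertical {a b z : ℝ × ℝ} (h : a.1 = b.1) :
    z ∈ segment ℝ a b ↔ z.1 = a.1 ∧ z.2 ∈ uIcc a.2 b.2 := by
  obtain ⟨a1, a2⟩ := a; obtain ⟨b1, b2⟩ := b; obtain ⟨z1, z2⟩ := z
  simp only at h; subst h
  rw [← Prod.image_mk_segment_right, segment_eq_uIcc]
  simp only [mem_image, Prod.mk.injEq]
  constructor
  · rintro ⟨x, hx, rfl, rfl⟩; exact ⟨rfl, hx⟩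
  · rintro ⟨rfl, hx⟩; exact ⟨_, hx, rfl, rfl⟩

/-- Consecutive edges lie on perpendicular lines, which meet in one point. Hence this part of
simplicity holds for every orthogonal polygon. -/
theorem edge_inter_edge_succ {L : Polygon} (h : L.IsOrthogonal) {i : ℕ} (hi : i < L.length) :
    L.edge i ∩ L.edge (i + 1) = {L.point (i + 1)} := by
  refine Subset.antisymm ?_ ?_
  · rintro z ⟨h1, h2⟩
    rcases h i hi with ⟨ha, hb⟩ | ⟨ha, hb⟩
    · rw [Polygon.edge, mem_segment_vertical (by simp [Polygon.point, ha])] at h1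
      rw [Polygon.edge, mem_segment_horizontal (by simp [Polygon.point, hb])] at h2
      exact Prod.ext (by simp [h1.1, Polygon.point, ha]) h2.1
    · rw [Polygon.edge, mem_segment_horizontal (by simp [Polygon.point, ha])] at h1
      rw [Polygon.edge, mem_segment_vertical (by simp [Polygon.point, hb])] at h2
      exact Prod.ext h2.1 (by simp [h1.1, Polygon.point, ha])
  · rintro z rfl
    exact ⟨right_mem_segment _ _ _, left_mem_segment _ _ _⟩

/-- The edges of the chain on the right side. -/
def chainEdge (H E : ℤ) (g : ℕ → ℤ) (k : ℕ) : Set (ℝ × ℝ) :=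
  {z | ((if k % 4 = 2 then E else H : ℤ) : ℝ) ≤ z.1 ∧ z.1 ≤ ((if k % 4 = 0 then H else E : ℤ) : ℝ) ∧
    (g ((k + 1) / 2) : ℝ) ≤ z.2 ∧ z.2 ≤ g ((k + 2) / 2)}

/-- The chain has period 4 in `k`: wall at `H`, lower side of a slot, end of the slot at `E`, upper
side. In `chainEdge` the two conditional bounds coincide for the vertical edges and span `[H, E]`
for the horizontal ones. -/
theorem segment_chain (hg : IsSlotSeq m H g) (hHE : H < E) {k : ℕ} (hk : k ≤ 4 * m) {z : ℝ × ℝ}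
    {a b : ℝ × ℝ} (ha : a = (((combChain H E g k).1 : ℝ), ((combChain H E g k).2 : ℝ)))
    (hb : b = (((combChain H E g (k + 1)).1 : ℝ), ((combChain H E g (k + 1)).2 : ℝ))) :
    z ∈ segment ℝ a b ↔ z ∈ chainEdge H E g k := by
  have hHE' : (H : ℝ) < E := by exact_mod_cast hHE
  subst ha hb
  unfold chainEdge
  rcases Nat.mod_two_eq_zero_or_one k with h0 | h0
  · rw [mem_segment_vertical
      (congrArg Int.cast (combChain_fst_eq (H := H) (E := E) (g := g) (k := k) (l := k + 1)
        (by omega)))]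
    have h1 : (g ((k + 1) / 2) : ℝ) ≤ g ((k + 2) / 2) := by
      exact_mod_cast hg.le (by omega) (by omega)
    have h2 : k % 4 = 0 ∧ k / 2 % 2 = 0 ∨ k % 4 = 2 ∧ k / 2 % 2 = 1 := by omega
    simp only [combChain, uIcc_of_le h1, mem_Icc, mem_ofPred_eq]
    rcases h2 with ⟨h2, h3⟩ | ⟨h2, h3⟩ <;> simp [h2, h3] <;>
      exact ⟨fun ⟨a, b, c⟩ => ⟨a.ge, a.le, b, c⟩, fun ⟨a, b, c, d⟩ => ⟨le_antisymm b a, c, d⟩⟩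
  · have h6 : (k + 2) / 2 = (k + 1) / 2 := by omega
    have h4 : (combChain H E g k).2 = (combChain H E g (k + 1)).2 := combChain_snd_eq (by omega)
    rw [mem_segment_horizontal (congrArg Int.cast h4)]
    have h2 : k % 4 = 1 ∧ k / 2 % 2 = 0 ∧ (k + 1) / 2 % 2 = 1 ∨
      k % 4 = 3 ∧ k / 2 % 2 = 1 ∧ (k + 1) / 2 % 2 = 0 := by omega
    simp only [combChain, mem_ofPred_eq]
    rcases h2 with ⟨h2, h3, h7⟩ | ⟨h2, h3, h7⟩ <;>
      simp [h2, h3, h6, h7, uIcc_of_le hHE'.le, uIcc_of_ge hHE'.le] <;>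
      exact ⟨fun ⟨a, b, c⟩ => ⟨b, c, a.ge, a.le⟩, fun ⟨a, b, c, d⟩ => ⟨le_antisymm d c, a, b⟩⟩

theorem mem_segment_swap {a b z : ℝ × ℝ} :
    z ∈ segment ℝ a.swap b.swap ↔ z.swap ∈ segment ℝ a b := by
  constructor
  · rintro ⟨s, t, hs, ht, hst, rfl⟩
    exact ⟨s, t, hs, ht, hst, rfl⟩
  · rintro ⟨s, t, hs, ht, hst, h⟩
    exact ⟨s, t, hs, ht, hst, Prod.swap_injective h⟩

theorem mem_comb_edge_right (h : IsComb m H E gR gT) {k : ℕ} (hk : k ≤ 4 * m) {z : ℝ × ℝ} :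
    z ∈ (comb m H E gR gT).edge (k + 1) ↔ z ∈ chainEdge H E gR k := by
  refine segment_chain h.right h.lt hk ?_ ?_
  · rw [Polygon.point, comb_vertex_right (by omega)]
  · rw [Polygon.point, comb_vertex_right (by omega)]

theorem mem_comb_edge_top (h : IsComb m H E gR gT) {i k : ℕ} (hik : i + k = 8 * m + 2)
    (hk : k ≤ 4 * m) {z : ℝ × ℝ} :
    z ∈ (comb m H E gR gT).edge i ↔ z.swap ∈ chainEdge H E gT k := by
  rw [← segment_chain h.top h.lt hk rfl rfl, segment_symm, ← mem_segment_swap, Polygon.edge,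
    Polygon.point, Polygon.point, comb_vertex_top h (k := k + 1) (by omega) (by omega),
    comb_vertex_top h (k := k) (by omega) (by omega)]
  rfl

theorem mem_comb_edge_bottom (h : IsComb m H E gR gT) {z : ℝ × ℝ} :
    z ∈ (comb m H E gR gT).edge 0 ↔ z.2 = 0 ∧ 0 ≤ z.1 ∧ z.1 ≤ H := by
  have := h.right.pos
  rw [Polygon.edge, mem_segment_horizontal]
  · simp only [Polygon.point, comb_vertex_right (show 0 ≤ 4 * m + 1 by omega)]
    rw [comb_vertex (by omega)]
    simp [combVertex, combChain]
    rw [uIcc_of_le (by exact_mod_cast this.le)]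
    simp
  · simpa [Polygon.point] using comb_vertex_even h (i := 0) (by omega) rfl

theorem mem_comb_edge_left (h : IsComb m H E gR gT) {z : ℝ × ℝ} :
    z ∈ (comb m H E gR gT).edge (8 * m + 3) ↔ z.1 = 0 ∧ 0 ≤ z.2 ∧ z.2 ≤ H := by
  have := h.right.pos
  rw [Polygon.edge, mem_segment_vertical]
  · simp only [Polygon.point, comb_vertex_length]
    rw [comb_vertex_top h (k := 0) (by omega) (by omega)]
    simp [combChain, h.top.zero]
    rw [uIcc_of_ge (by exact_mod_cast this.le)]
    simp
  · simpa [Polygon.point] using comb_vertex_odd h (i := 8 * m + 3) (by omega) (by omega)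

/-- The last two clauses say that only the first edge reaches the bottom and only the last one the
corner `(H, H)`; they separate the chain from the bottom edge and from the other chain. -/
theorem chainEdge_bounds (hg : IsSlotSeq m H g) (hHE : H < E) {k : ℕ} (hk : k ≤ 4 * m)
    {z : ℝ × ℝ} (hz : z ∈ chainEdge H E g k) :
    (H : ℝ) ≤ z.1 ∧ z.1 ≤ E ∧ 0 ≤ z.2 ∧ z.2 ≤ H ∧ (z.2 = 0 → k = 0) ∧
      (z.2 = H → k = 4 * m) := by
  have hHE' : (H : ℝ) < E := by exact_mod_cast hHE
  obtain ⟨h1, h2, h3, h4⟩ := hz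
  have h5 : (0 : ℝ) ≤ g ((k + 1) / 2) := by
    have := hg.le (u := 0) (v := (k + 1) / 2) (by omega) (by omega)
    rw [hg.zero] at this; exact_mod_cast this
  have h6 : (g ((k + 2) / 2) : ℝ) ≤ H := by
    have := hg.le (u := (k + 2) / 2) (v := 2 * m + 1) (by omega) (by omega)
    rw [hg.last] at this; exact_mod_cast this
  refine ⟨le_trans ?_ h1, h2.trans ?_, h5.trans h3, h4.trans h6, ?_, ?_⟩
  · split_ifs
    · exact hHE'.le
    · exact le_rfl
  · split_ifs
    · exact hHE'.le
    · exact le_rfl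
  · intro h0
    by_contra hk0
    have := hg.strict (u := 0) (v := (k + 1) / 2) (by omega) (by omega)
    rw [hg.zero] at this
    have : (0 : ℝ) < g ((k + 1) / 2) := by exact_mod_cast this
    linarith
  · intro h0
    by_contra hk0
    have := hg.strict (u := (k + 2) / 2) (v := 2 * m + 1) (by omega) (by omega)
    rw [hg.last] at this
    have : (g ((k + 2) / 2) : ℝ) < H := by exact_mod_cast this
    linarith

theorem chainEdge_disjoint (hg : IsSlotSeq m H g) (hHE : H < E) {k l : ℕ} (hkl : k + 2 ≤ l)
    (hl : l ≤ 4 * m) {z : ℝ × ℝ} (hz : z ∈ chainEdge H E g k) (hz' : z ∈ chainEdge H E g l) :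
    False := by
  have hHE' : (H : ℝ) < E := by exact_mod_cast hHE
  obtain ⟨h1, h2, h3, h4⟩ := hz
  obtain ⟨h1', h2', h3', h4'⟩ := hz'
  rcases (show (k + 2) / 2 ≤ (l + 1) / 2 by omega).lt_or_eq with h | h
  · have := hg.strict h (by omega)
    have : (g ((k + 2) / 2) : ℝ) < g ((l + 1) / 2) := by exact_mod_cast this
    linarith
  -- The heights fail to separate the edges only if `l = k + 2` with both vertical; then one lies at
  -- `H` and the other at `E`.
  · obtain ⟨h5, h6⟩ | ⟨h5, h6⟩ : (k % 4 = 0 ∧ l % 4 = 2) ∨ (k % 4 = 2 ∧ l % 4 = 0) := by omega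
    · rw [h5] at h2; rw [h6] at h1'; simp at h2 h1'; linarith
    · rw [h5] at h1; rw [h6] at h2'; simp at h2' h1; linarith

theorem comb_edge_cases {i : ℕ} (hi : i < 8 * m + 4) :
    i = 0 ∨ (∃ k ≤ 4 * m, i = k + 1) ∨ (∃ k ≤ 4 * m, i + k = 8 * m + 2) ∨ i = 8 * m + 3 := by
  rcases Nat.eq_zero_or_pos i with h | h
  · exact Or.inl h
  rcases Nat.lt_or_ge i (4 * m + 2) with h1 | h1
  · exact Or.inr (Or.inl ⟨i - 1, by omega, by omega⟩)
  rcases eq_or_ne i (8 * m + 3) with h2 | h2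
  · exact Or.inr (Or.inr (Or.inr h2))
  · exact Or.inr (Or.inr (Or.inl ⟨8 * m + 2 - i, by omega, by omega⟩))

theorem comb_edge_disjoint (h : IsComb m H E gR gT) {i j : ℕ} (hj : j < 8 * m + 4)
    (hij : i + 2 ≤ j) (hne : (j + 1) % (8 * m + 4) ≠ i) {z : ℝ × ℝ}
    (hzi : z ∈ (comb m H E gR gT).edge i) (hzj : z ∈ (comb m H E gR gT).edge j) : False := by
  have hH : (0 : ℝ) < H := by exact_mod_cast h.right.pos
  have hwrap : i = 0 → j ≠ 8 * m + 3 := by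
    rintro rfl rfl; exact hne (Nat.mod_self _)
  rcases comb_edge_cases (m := m) (i := i) (by omega) with hi0 | ⟨k, hk, hik⟩ | ⟨k, hk, hik⟩ | hi0
  · subst hi0
    rw [mem_comb_edge_bottom h] at hzi
    rcases comb_edge_cases hj with hj0 | ⟨l, hl, hjl⟩ | ⟨l, hl, hjl⟩ | hj0
    · omega
    · subst hjl
      rw [mem_comb_edge_right h hl] at hzj
      have := (chainEdge_bounds h.right h.lt hl hzj).2.2.2.2.1 hzi.1
      omega
    · rw [mem_comb_edge_top h hjl hl] at hzj
      have := (chainEdge_bounds h.top h.lt hl hzj).1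
      simp [hzi.1] at this
      have : (H : ℝ) ≤ 0 := by exact_mod_cast this
      linarith
    · exact hwrap rfl hj0
  · subst hik
    rw [mem_comb_edge_right h hk] at hzi
    have hb := chainEdge_bounds h.right h.lt hk hzi
    rcases comb_edge_cases hj with hj0 | ⟨l, hl, hjl⟩ | ⟨l, hl, hjl⟩ | hj0
    · omega
    · subst hjl
      rw [mem_comb_edge_right h hl] at hzj
      exact chainEdge_disjoint h.right h.lt (by omega) hl hzi hzj
    · rw [mem_comb_edge_top h hjl hl] at hzj
      have hb' := chainEdge_bounds h.top h.lt hl hzj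
      simp only [Prod.fst_swap, Prod.snd_swap] at hb'
      -- A common point of the two chains is `(H, H)`, so both edges are the last of their chains.
      -- These are consecutive, which `i + 2 ≤ j` excludes.
      have h1 := hb.2.2.2.2.2 (le_antisymm hb.2.2.2.1 hb'.1)
      have h2 := hb'.2.2.2.2.2 (le_antisymm hb'.2.2.2.1 hb.1)
      omega
    · subst hj0
      rw [mem_comb_edge_left h] at hzj
      linarith [hb.1, hzj.1]
  · rw [mem_comb_edge_top h hik hk] at hzi
    have hb := chainEdge_bounds h.top h.lt hk hzi
    simp only [Prod.fst_swap, Prod.snd_swap] at hb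
    rcases comb_edge_cases hj with hj0 | ⟨l, hl, hjl⟩ | ⟨l, hl, hjl⟩ | hj0
    · omega
    · omega
    · rw [mem_comb_edge_top h hjl hl] at hzj
      exact chainEdge_disjoint h.top h.lt (by omega) hk hzj hzi
    · subst hj0
      rw [mem_comb_edge_left h] at hzj
      have := hb.2.2.2.2.1 hzj.1
      omega
  · omega

theorem combChain_injective (hg : IsSlotSeq m H g) (hHE : H < E) {k l : ℕ} (hk : k ≤ 4 * m + 1)
    (hl : l ≤ 4 * m + 1) (h : combChain H E g k = combChain H E g l) : k = l := by
  simp only [combChain, Prod.mk.injEq] at h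
  have h2 : (k + 1) / 2 = (l + 1) / 2 := by
    rcases lt_trichotomy ((k + 1) / 2) ((l + 1) / 2) with h3 | h3 | h3
    · have := hg.strict h3 (by omega); omega
    · exact h3
    · have := hg.strict h3 (by omega); omega
  have h1 : k / 2 % 2 = l / 2 % 2 := by
    have := h.1
    have h4 : (E - H) * ((k / 2 % 2 : ℕ) : ℤ) = (E - H) * ((l / 2 % 2 : ℕ) : ℤ) := by linarith
    exact_mod_cast mul_left_cancel₀ (by omega) h4
  omega

theorem combChain_bounds (hg : IsSlotSeq m H g) (hHE : H < E) {k : ℕ} (hk : k ≤ 4 * m + 1) :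
    H ≤ (combChain H E g k).1 ∧ (combChain H E g k).1 ≤ E ∧ 0 ≤ (combChain H E g k).2 ∧
      (combChain H E g k).2 ≤ H ∧ ((combChain H E g k).2 = H → k = 4 * m + 1) := by
  simp only [combChain]
  have h5 := hg.le (u := 0) (v := (k + 1) / 2) (by omega) (by omega)
  have h6 := hg.le (u := (k + 1) / 2) (v := 2 * m + 1) (by omega) (by omega)
  rw [hg.zero] at h5
  rw [hg.last] at h6
  refine ⟨?_, ?_, h5, h6, ?_⟩
  · rcases Nat.mod_two_eq_zero_or_one (k / 2) with h | h <;> simp [h]; omega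
  · rcases Nat.mod_two_eq_zero_or_one (k / 2) with h | h <;> simp [h]; omega
  · intro h
    by_contra hne
    have := hg.strict (u := (k + 1) / 2) (v := 2 * m + 1) (by omega) (by omega)
    rw [hg.last] at this
    omega

theorem combVertex_injective (h : IsComb m H E gR gT) {i j : ℕ} (hij : i < j)
    (hj : j < 8 * m + 4) : combVertex m H E gR gT i ≠ combVertex m H E gR gT j := by
  have hH := h.right.pos
  intro he
  unfold combVertex at he
  rw [if_neg (show j ≠ 0 by omega)] at he
  split_ifs at he with h1 h2 h2 h3 h4
  · have := (combChain_bounds h.right h.lt (k := j - 1) (by omega)).1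
    rw [← he] at this; simp at this; omega
  · have := (combChain_bounds h.top h.lt (k := 8 * m + 3 - j) (by omega)).1
    have h5 := congrArg Prod.snd he
    simp at h5; omega
  · have := combChain_injective h.right h.lt (by omega) (by omega) he
    omega
  · have h5 := combChain_bounds h.top h.lt (k := 8 * m + 3 - j) (by omega)
    have h6 := combChain_bounds h.right h.lt (k := i - 1) (by omega)
    have h7 := congrArg Prod.snd he
    have h8 := congrArg Prod.fst he
    simp only [Prod.fst_swap, Prod.snd_swap] at h7 h8
    have := h5.2.2.2.2 (by omega)
    omega
  · omega
  · have := combChain_injective h.top h.lt (by omega) (by omega) (Prod.swap_injective he)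
    omega

theorem comb_isSimple (h : IsComb m H E gR gT) : (comb m H E gR gT).IsSimple := by
  refine ⟨by simp, ?_, ?_, ?_⟩
  · refine List.Nodup.map_on ?_ List.nodup_range
    intro i hi j hj he
    rw [List.mem_range] at hi hj
    rcases lt_trichotomy i j with h1 | h1 | h1
    · exact (combVertex_injective h h1 hj he).elim
    · exact h1
    · exact (combVertex_injective h h1 hi he.symm).elim
  · exact fun i hi => edge_inter_edge_succ (comb_isOrthogonal h) hi
  · intro i hi j hj hij h1 h2
    rw [comb_length] at hi hj h1 h2
    rw [disjoint_left]
    rcases lt_or_gt_of_ne hij with h3 | h3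
    · have : i + 1 ≠ j := by
        rintro rfl; exact h1 (Nat.mod_eq_of_lt hj)
      exact fun z => comb_edge_disjoint h hj (by omega) h2
    · have : j + 1 ≠ i := by
        rintro rfl; exact h2 (Nat.mod_eq_of_lt hi)
      exact fun z h4 h5 => comb_edge_disjoint h hi (by omega) h1 h5 h4

theorem mem_comb_boundary (h : IsComb m H E gR gT) {z : ℝ × ℝ} :
    z ∈ (comb m H E gR gT).boundary ↔ (z.2 = 0 ∧ 0 ≤ z.1 ∧ z.1 ≤ H) ∨
      (z.1 = 0 ∧ 0 ≤ z.2 ∧ z.2 ≤ H) ∨ (∃ k ≤ 4 * m, z ∈ chainEdge H E gR k) ∨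
      ∃ k ≤ 4 * m, z.swap ∈ chainEdge H E gT k := by
  simp only [Polygon.boundary, mem_iUnion, comb_length, exists_prop]
  constructor
  · rintro ⟨i, hi, hz⟩
    rcases comb_edge_cases hi with rfl | ⟨k, hk, rfl⟩ | ⟨k, hk, hik⟩ | rfl
    · exact Or.inl ((mem_comb_edge_bottom h).1 hz)
    · exact Or.inr (Or.inr (Or.inl ⟨k, hk, (mem_comb_edge_right h hk).1 hz⟩))
    · exact Or.inr (Or.inr (Or.inr ⟨k, hk, (mem_comb_edge_top h hik hk).1 hz⟩))
    · exact Or.inr (Or.inl ((mem_comb_edge_left h).1 hz))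
  · rintro (hz | hz | ⟨k, hk, hz⟩ | ⟨k, hk, hz⟩)
    · exact ⟨0, by omega, (mem_comb_edge_bottom h).2 hz⟩
    · exact ⟨8 * m + 3, by omega, (mem_comb_edge_left h).2 hz⟩
    · exact ⟨k + 1, by omega, (mem_comb_edge_right h hk).2 hz⟩
    · exact ⟨8 * m + 2 - k, by omega, (mem_comb_edge_top h (by omega) hk).2 hz⟩

end Comb

/-! ## Regions -/

/-- If an inner point were mapped outside, it would land in an unbounded component `C` of the
complement of the curve of `Q`. The preimage of `C` is connected and avoids the curve of `P`, whose
image lies in the region of `Q`. So it stays in the bounded component of the point, and `C` would be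
bounded. -/
theorem region_subset_of_boundary {P Q : Polygon} {c : ℝ} (hc : 0 < c) {τ : ℝ × ℝ}
    (h : ∀ z ∈ P.boundary, c • z + τ ∈ Q.region) {z : ℝ × ℝ} (hz : z ∈ P.region) :
    c • z + τ ∈ Q.region := by
  by_cases hzb : z ∈ P.boundary
  · exact h z hzb
  have hbdd := hz.resolve_left hzb
  by_contra hw
  have hwb : c • z + τ ∉ Q.boundary := fun hb => hw (Or.inl hb)
  have hunb : ¬ Bornology.IsBounded (connectedComponentIn Q.boundaryᶜ (c • z + τ)) :=
    fun hb => hw (Or.inr hb)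
  set C := connectedComponentIn Q.boundaryᶜ (c • z + τ) with hC
  have hback : ∀ w : ℝ × ℝ, c • (c⁻¹ • (w - τ)) + τ = w := fun w => by
    rw [smul_inv_smul₀ hc.ne']; abel
  have hcont : Continuous fun w : ℝ × ℝ => c⁻¹ • (w - τ) := by fun_prop
  have hpre : IsPreconnected ((fun w : ℝ × ℝ => c⁻¹ • (w - τ)) '' C) :=
    isPreconnected_connectedComponentIn.image _ hcont.continuousOn
  have hmem : z ∈ (fun w : ℝ × ℝ => c⁻¹ • (w - τ)) '' C :=
    ⟨c • z + τ, mem_connectedComponentIn hwb, by simp [inv_smul_smul₀ hc.ne']⟩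
  have hsub : (fun w : ℝ × ℝ => c⁻¹ • (w - τ)) '' C ⊆ P.boundaryᶜ := by
    rintro _ ⟨w, hwC, rfl⟩ hmemb
    have h1 := h _ hmemb
    simp only [hback] at h1
    have h2 : w ∈ Q.boundaryᶜ := connectedComponentIn_subset _ _ hwC
    have h3 := h1.resolve_left h2
    rw [← connectedComponentIn_eq hwC] at h3
    exact hunb h3
  have hb2 := hbdd.subset (hpre.subset_connectedComponentIn hmem hsub)
  apply hunb
  have h4 : C ⊆ (fun x : ℝ × ℝ => c • x + τ) ''
      ((fun w : ℝ × ℝ => c⁻¹ • (w - τ)) '' C) := by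
    intro w hw
    exact ⟨_, ⟨w, hw, rfl⟩, hback w⟩
  have h5 : LipschitzWith ‖c‖₊ (fun x : ℝ × ℝ => c • x + τ) :=
    LipschitzWith.of_dist_le_mul fun x y => by
      rw [dist_add_right, dist_smul₀]; rfl
  exact (h5.isBounded_image hb2).subset h4

/-- The ray is connected and misses the curve, so it lies in the component of its starting point and
makes that component unbounded. -/
theorem notMem_region_of_ray {L : Polygon} {z d : ℝ × ℝ} (hd : d ≠ 0)
    (h : ∀ t : ℝ, 0 ≤ t → z + t • d ∉ L.boundary) : z ∉ L.region := by
  rintro (hz | hz)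
  · exact h 0 le_rfl (by simpa using hz)
  have hpre : IsPreconnected ((fun t : ℝ => z + t • d) '' Ici 0) :=
    isPreconnected_Ici.image _ (by fun_prop)
  have hsub := hpre.subset_connectedComponentIn (x := z) (F := L.boundaryᶜ)
    ⟨0, by simp, by simp⟩ (by rintro _ ⟨t, ht, rfl⟩; exact h t ht)
  obtain ⟨C, hC⟩ := (hz.subset hsub).exists_norm_le
  have hd' : 0 < ‖d‖ := norm_pos_iff.2 hd
  have hC0 : 0 ≤ C := (norm_nonneg _).trans (hC _ ⟨0, by simp, rfl⟩)
  have ht : 0 ≤ (C + ‖z‖ + 1) / ‖d‖ := by positivity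
  have h1 := hC _ ⟨(C + ‖z‖ + 1) / ‖d‖, ht, rfl⟩
  have h2 : ‖((C + ‖z‖ + 1) / ‖d‖) • d‖ = C + ‖z‖ + 1 := by
    rw [norm_smul, Real.norm_of_nonneg ht]; field_simp
  have h3 := norm_sub_le (z + ((C + ‖z‖ + 1) / ‖d‖) • d) z
  rw [add_sub_cancel_left, h2] at h3
  simp only at h1
  linarith

/-! ### The region bounded by a comb -/

section Comb

variable {m : ℕ} {H E : ℤ} {gR gT g : ℕ → ℤ}

theorem chainEdge_subset_slot (hg : IsSlotSeq m H g) {k : ℕ} (hk : k ≤ 4 * m)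
    {z : ℝ × ℝ} (hz : z ∈ chainEdge H E g k) :
    z.1 = H ∨ ∃ j < m, (g (2 * j + 1) : ℝ) ≤ z.2 ∧ z.2 ≤ g (2 * j + 2) := by
  obtain ⟨h1, h2, h3, h4⟩ := hz
  have hmono : ∀ j < m, (g (2 * j + 1) : ℝ) ≤ g (2 * j + 2) := fun j hj => by
    exact_mod_cast hg.le (by omega) (by omega)
  obtain ⟨j, hj⟩ : ∃ j, k = 4 * j ∨ k = 4 * j + 1 ∨ k = 4 * j + 2 ∨ k = 4 * j + 3 :=
    ⟨k / 4, by omega⟩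
  rcases hj with rfl | rfl | rfl | rfl
  · left
    simp at h1 h2
    exact le_antisymm h2 h1
  all_goals
    refine Or.inr ⟨j, by omega, ?_⟩
    have := hmono j (by omega)
  · rw [show (4 * j + 1 + 1) / 2 = 2 * j + 1 by omega] at h3
    rw [show (4 * j + 1 + 2) / 2 = 2 * j + 1 by omega] at h4
    exact ⟨h3, h4.trans this⟩
  · rw [show (4 * j + 2 + 1) / 2 = 2 * j + 1 by omega] at h3
    rw [show (4 * j + 2 + 2) / 2 = 2 * j + 2 by omega] at h4
    exact ⟨h3, h4⟩
  · rw [show (4 * j + 3 + 1) / 2 = 2 * j + 2 by omega] at h3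
    rw [show (4 * j + 3 + 2) / 2 = 2 * j + 2 by omega] at h4
    exact ⟨this.trans h3, h4⟩

/-- The closed region bounded by a comb. -/
def combSolid (m : ℕ) (H E : ℤ) (gR gT : ℕ → ℤ) : Set (ℝ × ℝ) :=
  Icc (0 : ℝ) H ×ˢ Icc (0 : ℝ) H ∪
    ((⋃ j ∈ Finset.range m, Icc (0 : ℝ) E ×ˢ Icc (gR (2 * j + 1) : ℝ) (gR (2 * j + 2))) ∪
      ⋃ j ∈ Finset.range m, Icc (gT (2 * j + 1) : ℝ) (gT (2 * j + 2)) ×ˢ Icc (0 : ℝ) E)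

/-- The interior of a comb. -/
def combInterior (m : ℕ) (H E : ℤ) (gR gT : ℕ → ℤ) : Set (ℝ × ℝ) :=
  Ioo (0 : ℝ) H ×ˢ Ioo (0 : ℝ) H ∪
    ((⋃ j ∈ Finset.range m, Ioo (0 : ℝ) E ×ˢ Ioo (gR (2 * j + 1) : ℝ) (gR (2 * j + 2))) ∪
      ⋃ j ∈ Finset.range m, Ioo (gT (2 * j + 1) : ℝ) (gT (2 * j + 2)) ×ˢ Ioo (0 : ℝ) E)

theorem mem_combSolid {z : ℝ × ℝ} : z ∈ combSolid m H E gR gT ↔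
    ((0 ≤ z.1 ∧ z.1 ≤ H) ∧ 0 ≤ z.2 ∧ z.2 ≤ H) ∨
    (∃ j < m, (0 ≤ z.1 ∧ z.1 ≤ E) ∧ gR (2 * j + 1) ≤ z.2 ∧ z.2 ≤ gR (2 * j + 2)) ∨
    ∃ j < m, (gT (2 * j + 1) ≤ z.1 ∧ z.1 ≤ gT (2 * j + 2)) ∧ 0 ≤ z.2 ∧ z.2 ≤ E := by
  simp only [combSolid, mem_union, mem_iUnion, Finset.mem_range, mem_prod, mem_Icc, exists_prop]

theorem mem_combInterior {z : ℝ × ℝ} : z ∈ combInterior m H E gR gT ↔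
    ((0 < z.1 ∧ z.1 < H) ∧ 0 < z.2 ∧ z.2 < H) ∨
    (∃ j < m, (0 < z.1 ∧ z.1 < E) ∧ gR (2 * j + 1) < z.2 ∧ z.2 < gR (2 * j + 2)) ∨
    ∃ j < m, (gT (2 * j + 1) < z.1 ∧ z.1 < gT (2 * j + 2)) ∧ 0 < z.2 ∧ z.2 < E := by
  simp only [combInterior, mem_union, mem_iUnion, Finset.mem_range, mem_prod, mem_Ioo,
    exists_prop]

theorem isClosed_combSolid : IsClosed (combSolid m H E gR gT) := by
  refine (isClosed_Icc.prod isClosed_Icc).union (IsClosed.union ?_ ?_)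
  · exact isClosed_biUnion_finset fun j _ => isClosed_Icc.prod isClosed_Icc
  · exact isClosed_biUnion_finset fun j _ => isClosed_Icc.prod isClosed_Icc

theorem isOpen_combInterior : IsOpen (combInterior m H E gR gT) := by
  refine (isOpen_Ioo.prod isOpen_Ioo).union (IsOpen.union ?_ ?_)
  · exact isOpen_biUnion fun j _ => isOpen_Ioo.prod isOpen_Ioo
  · exact isOpen_biUnion fun j _ => isOpen_Ioo.prod isOpen_Ioo

theorem combInterior_subset : combInterior m H E gR gT ⊆ combSolid m H E gR gT := by
  intro z
  rw [mem_combSolid, mem_combInterior]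
  rintro (⟨⟨h1, h2⟩, h3, h4⟩ | ⟨j, hj, ⟨h1, h2⟩, h3, h4⟩ | ⟨j, hj, ⟨h1, h2⟩, h3, h4⟩)
  · exact Or.inl ⟨⟨h1.le, h2.le⟩, h3.le, h4.le⟩
  · exact Or.inr (Or.inl ⟨j, hj, ⟨h1.le, h2.le⟩, h3.le, h4.le⟩)
  · exact Or.inr (Or.inr ⟨j, hj, ⟨h1.le, h2.le⟩, h3.le, h4.le⟩)

theorem exists_between_steps {n : ℕ} {y : ℝ} (h0 : (g 0 : ℝ) ≤ y) (h1 : y ≤ g (n + 1)) :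
    ∃ u ≤ n, (g u : ℝ) ≤ y ∧ y ≤ g (u + 1) := by
  induction n with
  | zero => exact ⟨0, le_rfl, h0, h1⟩
  | succ n ih =>
    rcases le_total y (g (n + 1)) with h | h
    · obtain ⟨u, hu, h2⟩ := ih h
      exact ⟨u, by omega, h2⟩
    · exact ⟨n + 1, le_rfl, h, h1⟩

theorem slot_cases (hg : IsSlotSeq m H g) {z : ℝ × ℝ} {j : ℕ} (hj : j < m)
    (h0 : 0 < z.1) (hE : z.1 ≤ E) (h1 : (g (2 * j + 1) : ℝ) ≤ z.2) (h2 : z.2 ≤ g (2 * j + 2))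
    (hch : ∀ k ≤ 4 * m, z ∉ chainEdge H E g k) :
    ((0 < z.1 ∧ z.1 < H) ∧ 0 < z.2 ∧ z.2 < H) ∨
      ((0 < z.1 ∧ z.1 < E) ∧ g (2 * j + 1) < z.2 ∧ z.2 < g (2 * j + 2)) := by
  have hpos : (0 : ℝ) < z.2 := by
    have := hg.strict (u := 0) (v := 2 * j + 1) (by omega) (by omega)
    rw [hg.zero] at this
    have : (0 : ℝ) < g (2 * j + 1) := by exact_mod_cast this
    linarith
  have hlt : z.2 < H := by
    have := hg.strict (u := 2 * j + 2) (v := 2 * m + 1) (by omega) (by omega)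
    rw [hg.last] at this
    have : (g (2 * j + 2) : ℝ) < H := by exact_mod_cast this
    linarith
  by_cases hH : z.1 < H
  · exact Or.inl ⟨⟨h0, hH⟩, hpos, hlt⟩
  push Not at hH
  refine Or.inr ⟨⟨h0, lt_of_le_of_ne hE fun he => ?_⟩, lt_of_le_of_ne h1 fun he => ?_,
    lt_of_le_of_ne h2 fun he => ?_⟩
  · refine hch (4 * j + 2) (by omega) ?_
    simp only [chainEdge, mem_ofPred_eq, show (4 * j + 2) % 4 = 2 by omega,
      show (4 * j + 2 + 1) / 2 = 2 * j + 1 by omega, show (4 * j + 2 + 2) / 2 = 2 * j + 2 by omega]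
    simp [he, h1, h2]
  · refine hch (4 * j + 1) (by omega) ?_
    simp only [chainEdge, mem_ofPred_eq, show (4 * j + 1) % 4 = 1 by omega,
      show (4 * j + 1 + 1) / 2 = 2 * j + 1 by omega, show (4 * j + 1 + 2) / 2 = 2 * j + 1 by omega]
    simp [← he, hH, hE]
  · refine hch (4 * j + 3) (by omega) ?_
    simp only [chainEdge, mem_ofPred_eq, show (4 * j + 3) % 4 = 3 by omega,
      show (4 * j + 3 + 1) / 2 = 2 * j + 2 by omega, show (4 * j + 3 + 2) / 2 = 2 * j + 2 by omega]
    simp [← he, hH, hE]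

theorem exists_slot_of_side (hg : IsSlotSeq m H g) (hHE : H < E) {z : ℝ × ℝ} (h0 : z.1 = H)
    (h1 : 0 ≤ z.2) (h2 : z.2 ≤ H) (hch : ∀ k ≤ 4 * m, z ∉ chainEdge H E g k) :
    ∃ j < m, (0 < z.1 ∧ z.1 < E) ∧ g (2 * j + 1) < z.2 ∧ z.2 < g (2 * j + 2) := by
  have hH : (0 : ℝ) < H := by exact_mod_cast hg.pos
  have hHE' : (H : ℝ) < E := by exact_mod_cast hHE
  obtain ⟨u, hu, h3, h4⟩ := exists_between_steps (g := g) (n := 2 * m) (y := z.2)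
    (by rw [hg.zero]; simpa using h1) (by rw [hg.last]; exact h2)
  obtain ⟨j, rfl | rfl⟩ : ∃ j, u = 2 * j ∨ u = 2 * j + 1 := ⟨u / 2, by omega⟩
  · exfalso
    refine hch (4 * j) (by omega) ?_
    simp only [chainEdge, mem_ofPred_eq, show (4 * j) % 4 = 0 by omega,
      show (4 * j + 1) / 2 = 2 * j by omega, show (4 * j + 2) / 2 = 2 * j + 1 by omega]
    simp [h0, h3, h4]
  · refine ⟨j, by omega, ?_⟩
    rcases slot_cases (E := E) hg (j := j) (by omega) (by linarith) (by linarith) h3 h4 hch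
      with h | h
    · linarith [h.1.2]
    · exact h

/-- The slot rectangles reach back across the whole square, so the open mouth of a slot is interior
to the union although it lies on a side of the square. A point of the solid on the right or top side
of the square and off the curve is in such a mouth; any other point on the border of its rectangle
is on the curve or interior to the square. -/
theorem combSolid_diff_boundary (h : IsComb m H E gR gT) {z : ℝ × ℝ}
    (hz : z ∈ combSolid m H E gR gT) (hb : z ∉ (comb m H E gR gT).boundary) :
    z ∈ combInterior m H E gR gT := by
  have hH : (0 : ℝ) < H := by exact_mod_cast h.right.pos
  have hHE : (H : ℝ) < E := by exact_mod_cast h.lt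
  rw [mem_comb_boundary h] at hb
  push Not at hb
  obtain ⟨hb1, hb2, hb3, hb4⟩ := hb
  rw [mem_combSolid] at hz
  rw [mem_combInterior]
  have hx0 : z.1 = 0 → 0 ≤ z.2 → H < z.2 := hb2
  have hy0 : z.2 = 0 → 0 ≤ z.1 → H < z.1 := hb1
  rcases hz with ⟨⟨h1, h2⟩, h3, h4⟩ | ⟨j, hj, ⟨h1, h2⟩, h3, h4⟩ | ⟨j, hj, ⟨h1, h2⟩, h3, h4⟩
  · rcases h2.eq_or_lt with h5 | h5
    · exact Or.inr (Or.inl (exists_slot_of_side h.right h.lt h5 h3 h4 hb3))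
    rcases h4.eq_or_lt with h6 | h6
    · obtain ⟨j, hj, h7, h8⟩ :=
        exists_slot_of_side (z := z.swap) h.top h.lt h6 h1 h2 hb4
      exact Or.inr (Or.inr ⟨j, hj, h8, h7⟩)
    refine Or.inl ⟨⟨lt_of_le_of_ne h1 fun he => ?_, h5⟩, lt_of_le_of_ne h3 fun he => ?_, h6⟩
    · linarith [hx0 he.symm h3]
    · linarith [hy0 he.symm h1]
  · have hz2 : 0 ≤ z.2 ∧ z.2 ≤ H := by
      have h5 := h.right.le (u := 0) (v := 2 * j + 1) (by omega) (by omega)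
      have h6 := h.right.le (u := 2 * j + 2) (v := 2 * m + 1) (by omega) (by omega)
      rw [h.right.zero] at h5; rw [h.right.last] at h6
      have h5' : (0 : ℝ) ≤ gR (2 * j + 1) := by exact_mod_cast h5
      have h6' : (gR (2 * j + 2) : ℝ) ≤ H := by exact_mod_cast h6
      constructor <;> linarith
    have h0 : 0 < z.1 := lt_of_le_of_ne h1 fun he => by linarith [hx0 he.symm hz2.1]
    rcases slot_cases h.right hj h0 h2 h3 h4 hb3 with h5 | h5
    · exact Or.inl h5
    · exact Or.inr (Or.inl ⟨j, hj, h5⟩)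
  · have hz1 : 0 ≤ z.1 ∧ z.1 ≤ H := by
      have h5 := h.top.le (u := 0) (v := 2 * j + 1) (by omega) (by omega)
      have h6 := h.top.le (u := 2 * j + 2) (v := 2 * m + 1) (by omega) (by omega)
      rw [h.top.zero] at h5; rw [h.top.last] at h6
      have h5' : (0 : ℝ) ≤ gT (2 * j + 1) := by exact_mod_cast h5
      have h6' : (gT (2 * j + 2) : ℝ) ≤ H := by exact_mod_cast h6
      constructor <;> linarith
    have h0 : 0 < z.2 := lt_of_le_of_ne h3 fun he => by linarith [hy0 he.symm hz1.1]
    rcases slot_cases (z := z.swap) h.top hj h0 h4 h1 h2 hb4 with h5 | h5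
    · exact Or.inl ⟨h5.2, h5.1⟩
    · exact Or.inr (Or.inr ⟨j, hj, h5.2, h5.1⟩)

theorem comb_boundary_subset_solid (h : IsComb m H E gR gT) :
    (comb m H E gR gT).boundary ⊆ combSolid m H E gR gT := by
  have hH : (0 : ℝ) < H := by exact_mod_cast h.right.pos
  intro z hz
  rw [mem_comb_boundary h] at hz
  rw [mem_combSolid]
  rcases hz with ⟨h1, h2, h3⟩ | ⟨h1, h2, h3⟩ | ⟨k, hk, hz⟩ | ⟨k, hk, hz⟩
  · exact Or.inl ⟨⟨h2, h3⟩, h1.ge, h1.trans_le hH.le⟩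
  · exact Or.inl ⟨⟨h1.ge, h1.trans_le hH.le⟩, h2, h3⟩
  · have hb := chainEdge_bounds h.right h.lt hk hz
    rcases chainEdge_subset_slot h.right hk hz with h1 | ⟨j, hj, h1⟩
    · exact Or.inl ⟨⟨by linarith [hb.1], h1.le⟩, hb.2.2.1, hb.2.2.2.1⟩
    · exact Or.inr (Or.inl ⟨j, hj, ⟨by linarith [hb.1], hb.2.1⟩, h1⟩)
  · have hb := chainEdge_bounds h.top h.lt hk hz
    simp only [Prod.fst_swap, Prod.snd_swap] at hb
    rcases chainEdge_subset_slot h.top hk hz with h1 | ⟨j, hj, h1⟩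
    · exact Or.inl ⟨⟨hb.2.2.1, hb.2.2.2.1⟩, by linarith [hb.1], h1.le⟩
    · exact Or.inr (Or.inr ⟨j, hj, h1, by linarith [hb.1], hb.2.1⟩)

theorem combSolid_bounds (h : IsComb m H E gR gT) {z : ℝ × ℝ}
    (hz : z ∈ combSolid m H E gR gT) : 0 ≤ z.1 ∧ z.1 ≤ E ∧ 0 ≤ z.2 ∧ z.2 ≤ E := by
  have hHE : (H : ℝ) < E := by exact_mod_cast h.lt
  rw [mem_combSolid] at hz
  have key : ∀ {g : ℕ → ℤ}, IsSlotSeq m H g → ∀ j < m, (0 : ℝ) ≤ g (2 * j + 1) ∧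
      (g (2 * j + 2) : ℝ) ≤ H := fun {g} hg j hj => by
    have h5 := hg.le (u := 0) (v := 2 * j + 1) (by omega) (by omega)
    have h6 := hg.le (u := 2 * j + 2) (v := 2 * m + 1) (by omega) (by omega)
    rw [hg.zero] at h5; rw [hg.last] at h6
    exact ⟨by exact_mod_cast h5, by exact_mod_cast h6⟩
  rcases hz with ⟨⟨h1, h2⟩, h3, h4⟩ | ⟨j, hj, ⟨h1, h2⟩, h3, h4⟩ | ⟨j, hj, ⟨h1, h2⟩, h3, h4⟩
  · refine ⟨?_, ?_, ?_, ?_⟩ <;> linarith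
  · have := key h.right j hj
    refine ⟨?_, ?_, ?_, ?_⟩ <;> linarith
  · have := key h.top j hj
    refine ⟨?_, ?_, ?_, ?_⟩ <;> linarith

/-- The component of a point of the solid cannot leave the open set `combInterior`: a limit point of
that set lies in the closed solid, and off the curve it is interior again. So the component is
bounded. -/
theorem combSolid_subset_region (h : IsComb m H E gR gT) :
    combSolid m H E gR gT ⊆ (comb m H E gR gT).region := by
  intro z hz
  by_cases hb : z ∈ (comb m H E gR gT).boundary
  · exact Or.inl hb
  refine Or.inr ?_
  have hsub : connectedComponentIn (comb m H E gR gT).boundaryᶜ z ⊆ combInterior m H E gR gT := by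
    refine isPreconnected_connectedComponentIn.subset_of_closure_inter_subset
      isOpen_combInterior ⟨z, mem_connectedComponentIn hb, combSolid_diff_boundary h hz hb⟩ ?_
    rintro w ⟨hw1, hw2⟩
    exact combSolid_diff_boundary h (closure_minimal combInterior_subset isClosed_combSolid hw1)
      (connectedComponentIn_subset _ _ hw2)
  refine (Metric.isBounded_Icc ((0 : ℝ), (0 : ℝ)) ((E : ℝ), (E : ℝ))).subset fun w hw => ?_
  have := combSolid_bounds h (combInterior_subset (hsub hw))
  exact ⟨⟨this.1, this.2.2.1⟩, this.2.1, this.2.2.2⟩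

theorem comb_region_bounds (h : IsComb m H E gR gT) {z : ℝ × ℝ}
    (hz : z ∈ (comb m H E gR gT).region) : 0 ≤ z.1 ∧ z.1 ≤ E ∧ 0 ≤ z.2 ∧ z.2 ≤ E := by
  have key : ∀ w ∈ (comb m H E gR gT).boundary, 0 ≤ w.1 ∧ w.1 ≤ E ∧ 0 ≤ w.2 ∧ w.2 ≤ E :=
    fun w hw => combSolid_bounds h (comb_boundary_subset_solid h hw)
  refine ⟨?_, ?_, ?_, ?_⟩ <;> by_contra hlt <;> push Not at hlt
  · refine notMem_region_of_ray (d := (-1, 0)) (by simp) (fun t ht hw => ?_) hz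
    have := (key _ hw).1
    simp at this; linarith
  · refine notMem_region_of_ray (d := (1, 0)) (by simp) (fun t ht hw => ?_) hz
    have := (key _ hw).2.1
    simp at this; linarith
  · refine notMem_region_of_ray (d := (0, -1)) (by simp) (fun t ht hw => ?_) hz
    have := (key _ hw).2.2.1
    simp at this; linarith
  · refine notMem_region_of_ray (d := (0, 1)) (by simp) (fun t ht hw => ?_) hz
    have := (key _ hw).2.2.2
    simp at this; linarith

/-- The horizontal ray to the right must hit the curve. Beyond `H` the only pieces of the curve to
hit are edges of right slots, and the ray does not change the height. -/
theorem exists_right_slot (h : IsComb m H E gR gT) {z : ℝ × ℝ}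
    (hz : z ∈ (comb m H E gR gT).region) (hH : H < z.1) :
    ∃ j < m, gR (2 * j + 1) ≤ z.2 ∧ z.2 ≤ gR (2 * j + 2) := by
  have hH0 : (0 : ℝ) < H := by exact_mod_cast h.right.pos
  by_contra hno
  refine notMem_region_of_ray (d := (1, 0)) (by simp) (fun t ht hw => hno ?_) hz
  have h0 := (comb_region_bounds h hz).2.2.1
  rw [mem_comb_boundary h] at hw
  rcases hw with ⟨h1, h2, h3⟩ | ⟨h1, h2, h3⟩ | ⟨k, hk, hw⟩ | ⟨k, hk, hw⟩
  · simp at h3; linarith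
  · simp at h1; linarith
  · rcases chainEdge_subset_slot h.right hk hw with h1 | ⟨j, hj, h1⟩
    · simp at h1; linarith
    · exact ⟨j, hj, by simpa using h1⟩
  · have := (chainEdge_bounds h.top h.lt hk hw).2.2.2.1
    simp at this; linarith

theorem exists_top_slot (h : IsComb m H E gR gT) {z : ℝ × ℝ}
    (hz : z ∈ (comb m H E gR gT).region) (hH : H < z.2) :
    ∃ j < m, gT (2 * j + 1) ≤ z.1 ∧ z.1 ≤ gT (2 * j + 2) := by
  have hH0 : (0 : ℝ) < H := by exact_mod_cast h.right.pos
  by_contra hno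
  refine notMem_region_of_ray (d := (0, 1)) (by simp) (fun t ht hw => hno ?_) hz
  rw [mem_comb_boundary h] at hw
  rcases hw with ⟨h1, h2, h3⟩ | ⟨h1, h2, h3⟩ | ⟨k, hk, hw⟩ | ⟨k, hk, hw⟩
  · simp at h1; linarith
  · simp at h3; linarith
  · have := (chainEdge_bounds h.right h.lt hk hw).2.2.2.1
    simp at this; linarith
  · rcases chainEdge_subset_slot h.top hk hw with h1 | ⟨j, hj, h1⟩
    · simp at h1; linarith
    · exact ⟨j, hj, by simpa using h1⟩

theorem comb_tip_right (h : IsComb m H E gR gT) {j : ℕ} (hj : j < m) :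
    ((E : ℝ), (gR (2 * j + 1) : ℝ)) ∈ (comb m H E gR gT).region := by
  have h0 : (0 : ℝ) < H := by exact_mod_cast h.right.pos
  have h1 : (H : ℝ) < E := by exact_mod_cast h.lt
  have h2 : (gR (2 * j + 1) : ℝ) < gR (2 * j + 2) := by exact_mod_cast h.right.lt _ (by omega)
  exact combSolid_subset_region h
    (mem_combSolid.2 (Or.inr (Or.inl ⟨j, hj, ⟨(h0.trans h1).le, le_rfl⟩, le_rfl, h2.le⟩)))

theorem comb_tip_top (h : IsComb m H E gR gT) {j : ℕ} (hj : j < m) :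
    ((gT (2 * j + 1) : ℝ), (E : ℝ)) ∈ (comb m H E gR gT).region := by
  have h0 : (0 : ℝ) < H := by exact_mod_cast h.right.pos
  have h1 : (H : ℝ) < E := by exact_mod_cast h.lt
  have h2 : (gT (2 * j + 1) : ℝ) < gT (2 * j + 2) := by exact_mod_cast h.top.lt _ (by omega)
  exact combSolid_subset_region h
    (mem_combSolid.2 (Or.inr (Or.inr ⟨j, hj, ⟨le_rfl, h2.le⟩, (h0.trans h1).le, le_rfl⟩)))

theorem comb_zero_mem (h : IsComb m H E gR gT) :
    ((0 : ℝ), (0 : ℝ)) ∈ (comb m H E gR gT).region := by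
  have h0 : (0 : ℝ) < H := by exact_mod_cast h.right.pos
  exact combSolid_subset_region h
    (mem_combSolid.2 (Or.inl ⟨⟨le_rfl, h0.le⟩, le_rfl, h0.le⟩))

end Comb

/-! ## Polygons encoding four lists of integers -/

/-- The slot boundaries `0, s 0, s 0 + w, s 1, s 1 + w, …, H`. -/
def slotSeq (m : ℕ) (w H : ℤ) (s : ℕ → ℤ) (u : ℕ) : ℤ :=
  if u = 0 then 0 else if 2 * m < u then H else s ((u - 1) / 2) + if u % 2 = 1 then 0 else w

theorem slotSeq_odd {m : ℕ} {w H : ℤ} {s : ℕ → ℤ} {j : ℕ} (hj : j < m) :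
    slotSeq m w H s (2 * j + 1) = s j := by
  rw [slotSeq, if_neg (by omega), if_neg (by omega), if_pos (by omega)]
  simp

theorem slotSeq_even {m : ℕ} {w H : ℤ} {s : ℕ → ℤ} {j : ℕ} (hj : j < m) :
    slotSeq m w H s (2 * j + 2) = s j + w := by
  rw [slotSeq, if_neg (by omega), if_neg (by omega), if_neg (by omega)]
  congr 2; omega

theorem slotSeq_last {m : ℕ} {w H : ℤ} {s : ℕ → ℤ} : slotSeq m w H s (2 * m + 1) = H := by
  simp [slotSeq]

theorem isSlotSeq_slotSeq {m : ℕ} {w H : ℤ} {s : ℕ → ℤ} (hw : 0 < w) (hH : 0 < H)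
    (h0 : ∀ j < m, 0 < s j) (h1 : ∀ j < m, s j + w < H)
    (h2 : ∀ j, j + 1 < m → s j + w < s (j + 1)) : IsSlotSeq m H (slotSeq m w H s) := by
  refine ⟨by simp [slotSeq], slotSeq_last, fun u hu => ?_⟩
  obtain ⟨j, rfl | rfl⟩ : ∃ j, u = 2 * j ∨ u = 2 * j + 1 := ⟨u / 2, by omega⟩
  · rcases j with _ | j
    · rcases Nat.eq_zero_or_pos m with rfl | hm
      · simpa [slotSeq] using hH
      · rw [slotSeq_odd hm]; simpa [slotSeq] using h0 0 hm
    · rw [show 2 * (j + 1) = 2 * j + 2 by ring, slotSeq_even (by omega)]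
      rcases eq_or_ne m (j + 1) with rfl | hm
      · rw [show 2 * j + 2 + 1 = 2 * (j + 1) + 1 by ring, slotSeq_last]
        exact h1 j (by omega)
      · rw [show 2 * j + 2 + 1 = 2 * (j + 1) + 1 by ring, slotSeq_odd (by omega)]
        exact h2 j (by omega)
  · rw [slotSeq_odd (by omega), slotSeq_even (by omega)]
    omega

/-- The pattern polygon. -/
def pattern (U : ℤ) : Polygon :=
  comb 2 (40000 * U) (48000 * U)
    (slotSeq 2 1 (40000 * U) fun j => 24000 * U + 8000 * U * j)
    (slotSeq 2 1 (40000 * U) fun j => 8000 * U + 8000 * U * j)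

/-- The container polygon with slots at the positions `s 0, …, s (m - 1)` on both sides. -/
def container (U : ℤ) (m : ℕ) (s : ℕ → ℤ) : Polygon :=
  comb m (40800 * U) (48800 * U) (slotSeq m 2 (40800 * U) s) (slotSeq m 2 (40800 * U) s)

/-- The slot positions encoding the four lists. -/
def IsSlot (U : ℤ) (A : Fin 4 → List ℤ) (x : ℤ) : Prop :=
  (∃ a ∈ A 0, x = 8 * (1020 * U - a)) ∨ (∃ a ∈ A 1, x = 8 * (2022 * U + a)) ∨
    (∃ a ∈ A 2, x = 8 * (3020 * U + a)) ∨ ∃ a ∈ A 3, x = 8 * (4022 * U - a)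

/-- The slots are enumerated increasingly and once each, whereas the lists may contain repetitions;
thus `m` can be smaller than the total length of the lists. -/
structure SlotValues (U : ℤ) (A : Fin 4 → List ℤ) (m : ℕ) (s : ℕ → ℤ) : Prop where
  pos : 1 ≤ U
  bound : ∀ j, ∀ a ∈ A j, -U ≤ a ∧ a ≤ U
  lt : ∀ j, j + 1 < m → s j < s (j + 1)
  mem : ∀ x, (∃ j < m, s j = x) ↔ IsSlot U A x

/-! ### Fitting the pattern is equivalent to a zero sum -/

section

variable {U : ℤ} {A : Fin 4 → List ℤ} {m : ℕ} {s : ℕ → ℤ}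

/-- The range keeps all slots strictly inside the side of length `40800 U`; divisibility by 8 keeps
distinct slots further apart than their width 2. -/
theorem IsSlot.bounds (hU : 1 ≤ U) (hA : ∀ j, ∀ a ∈ A j, -U ≤ a ∧ a ≤ U) {x : ℤ}
    (h : IsSlot U A x) : 8152 * U ≤ x ∧ x ≤ 32184 * U ∧ 8 ∣ x := by
  rcases h with ⟨a, ha, rfl⟩ | ⟨a, ha, rfl⟩ | ⟨a, ha, rfl⟩ | ⟨a, ha, rfl⟩ <;>
    have := hA _ a ha <;> refine ⟨by linarith, by linarith, dvd_mul_right _ _⟩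

theorem pattern_isComb (hU : 1 ≤ U) : IsComb 2 (40000 * U) (48000 * U)
    (slotSeq 2 1 (40000 * U) fun j => 24000 * U + 8000 * U * j)
    (slotSeq 2 1 (40000 * U) fun j => 8000 * U + 8000 * U * j) := by
  refine ⟨isSlotSeq_slotSeq one_pos (by omega) ?_ ?_ ?_,
    isSlotSeq_slotSeq one_pos (by omega) ?_ ?_ ?_, by omega⟩
  all_goals
    intro j hj
    have : j = 0 ∨ j = 1 := by omega
    rcases this with rfl | rfl
  all_goals omega

theorem SlotValues.slot (h : SlotValues U A m s) {j : ℕ} (hj : j < m) : IsSlot U A (s j) :=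
  (h.mem _).1 ⟨j, hj, rfl⟩

theorem container_isComb (h : SlotValues U A m s) : IsComb m (40800 * U) (48800 * U)
    (slotSeq m 2 (40800 * U) s) (slotSeq m 2 (40800 * U) s) := by
  have hU := h.pos
  have : IsSlotSeq m (40800 * U) (slotSeq m 2 (40800 * U) s) := by
    refine isSlotSeq_slotSeq two_pos (by omega) (fun j hj => ?_) (fun j hj => ?_) fun j hj => ?_
    · have := (h.slot hj).bounds h.pos h.bound
      omega
    · have := (h.slot hj).bounds h.pos h.bound
      omega
    · have h1 := (h.slot (show j < m by omega)).bounds h.pos h.bound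
      have h2 := (h.slot hj).bounds h.pos h.bound
      have h3 := h.lt j hj
      omega
  exact ⟨this, this, by omega⟩

theorem fits_of_sum_zero (h : SlotValues U A m s) {a₁ a₂ a₃ a₄ : ℤ} (h1 : a₁ ∈ A 0)
    (h2 : a₂ ∈ A 1) (h3 : a₃ ∈ A 2) (h4 : a₄ ∈ A 3) (hsum : a₁ + a₂ + a₃ + a₄ = 0) :
    ∃ c : ℝ, 1 ≤ c ∧ ∃ τ : ℝ × ℝ, ∀ z ∈ (pattern U).region,
      c • z + τ ∈ (container U m s).region := by
  have hU : (1 : ℝ) ≤ U := by exact_mod_cast h.pos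
  obtain ⟨j1, hj1, e1⟩ := (h.mem _).2 (Or.inl ⟨a₁, h1, rfl⟩)
  obtain ⟨j2, hj2, e2⟩ := (h.mem _).2 (Or.inr (Or.inl ⟨a₂, h2, rfl⟩))
  obtain ⟨j3, hj3, e3⟩ := (h.mem _).2 (Or.inr (Or.inr (Or.inl ⟨a₃, h3, rfl⟩)))
  obtain ⟨j4, hj4, e4⟩ := (h.mem _).2 (Or.inr (Or.inr (Or.inr ⟨a₄, h4, rfl⟩)))
  have b1 : -(U : ℝ) ≤ a₁ ∧ (a₁ : ℝ) ≤ U := by exact_mod_cast h.bound _ _ h1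
  have b2 : -(U : ℝ) ≤ a₂ ∧ (a₂ : ℝ) ≤ U := by exact_mod_cast h.bound _ _ h2
  have b3 : -(U : ℝ) ≤ a₃ ∧ (a₃ : ℝ) ≤ U := by exact_mod_cast h.bound _ _ h3
  have hs : (a₁ : ℝ) + a₂ + a₃ + a₄ = 0 := by exact_mod_cast hsum
  -- This scale turns the tooth distance `8000 U` into the slot distance `8016 U + 8 (a₁ + a₂)`,
  -- which for sum zero equals `8016 U - 8 (a₃ + a₄)`. The surplus `2 U` guarantees `1 ≤ c`, and `c
  -- ≤ 2` keeps scaled teeth within the slot width.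
  obtain ⟨c, hc⟩ : ∃ c : ℝ, c = 1 + (2 * U + a₁ + a₂) / (1000 * U) := ⟨_, rfl⟩
  have hU0 : (U : ℝ) ≠ 0 := by positivity
  have hk : c * U = U + (2 * U + a₁ + a₂) / 1000 := by rw [hc]; field_simp
  have hc1 : 1 ≤ c := by
    by_contra hlt
    push Not at hlt
    nlinarith
  have hc2 : c ≤ 2 := by
    by_contra hlt
    push Not at hlt
    nlinarith
  -- The translation moves the first top tooth to `8 (1020 U - a₁)` and the first right tooth to `8
  -- (3020 U + a₃)`; the choice of `c` then places the second ones. The additional `20 U` in the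
  -- slot positions makes both components nonnegative.
  refine ⟨c, hc1, (8 * (18 * U - 2 * a₁ - a₂), 8 * (20 * U + a₃) - 24 * (2 * U + a₁ + a₂)), ?_⟩
  intro z hz
  refine region_subset_of_boundary (by linarith) (fun w hw => ?_) hz
  refine combSolid_subset_region (container_isComb h) ?_
  have hw' := comb_boundary_subset_solid (pattern_isComb h.pos) hw
  rw [mem_combSolid] at hw' ⊢
  have hc0 : 0 ≤ c := by linarith
  simp only [Prod.fst_add, Prod.snd_add, Prod.smul_fst, Prod.smul_snd, smul_eq_mul]
  push_cast at hw' ⊢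
  rcases hw' with ⟨⟨w1, w2⟩, w3, w4⟩ | ⟨j, hj, ⟨w1, w2⟩, w3, w4⟩ | ⟨j, hj, ⟨w1, w2⟩, w3, w4⟩
  · have v1 := mul_le_mul_of_nonneg_left w1 hc0
    have v2 := mul_le_mul_of_nonneg_left w2 hc0
    have v3 := mul_le_mul_of_nonneg_left w3 hc0
    have v4 := mul_le_mul_of_nonneg_left w4 hc0
    left
    refine ⟨⟨?_, ?_⟩, ?_, ?_⟩ <;> linarith
  · have v1 := mul_le_mul_of_nonneg_left w1 hc0
    have v2 := mul_le_mul_of_nonneg_left w2 hc0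
    have v3 := mul_le_mul_of_nonneg_left w3 hc0
    have v4 := mul_le_mul_of_nonneg_left w4 hc0
    rw [slotSeq_odd hj] at v3
    rw [slotSeq_even hj] at v4
    right; left
    have : j = 0 ∨ j = 1 := by omega
    rcases this with rfl | rfl
    · refine ⟨j3, hj3, ⟨?_, ?_⟩, ?_⟩
      · linarith
      · linarith
      · rw [slotSeq_odd hj3, slotSeq_even hj3, e3]
        push_cast at v3 v4 ⊢
        constructor <;> linarith
    · refine ⟨j4, hj4, ⟨?_, ?_⟩, ?_⟩
      · linarith
      · linarith
      · rw [slotSeq_odd hj4, slotSeq_even hj4, e4]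
        push_cast at v3 v4 ⊢
        constructor <;> linarith
  · have v1 := mul_le_mul_of_nonneg_left w1 hc0
    have v2 := mul_le_mul_of_nonneg_left w2 hc0
    have v3 := mul_le_mul_of_nonneg_left w3 hc0
    have v4 := mul_le_mul_of_nonneg_left w4 hc0
    rw [slotSeq_odd hj] at v1
    rw [slotSeq_even hj] at v2
    right; right
    have : j = 0 ∨ j = 1 := by omega
    rcases this with rfl | rfl
    · refine ⟨j1, hj1, ?_, ?_, ?_⟩
      · rw [slotSeq_odd hj1, slotSeq_even hj1, e1]
        push_cast at v1 v2 ⊢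
        constructor <;> linarith
      · linarith
      · linarith
    · refine ⟨j2, hj2, ?_, ?_, ?_⟩
      · rw [slotSeq_odd hj2, slotSeq_even hj2, e2]
        push_cast at v1 v2 ⊢
        constructor <;> linarith
      · linarith
      · linarith

/-- Five points of the pattern suffice: the origin, whose image forces a nonnegative translation,
and one corner of each tooth tip. -/
theorem sum_zero_of_fits (h : SlotValues U A m s) {c : ℝ} (hc : 1 ≤ c) {τ : ℝ × ℝ}
    (hfit : ∀ z ∈ (pattern U).region, c • z + τ ∈ (container U m s).region) :
    ∃ a₁ ∈ A 0, ∃ a₂ ∈ A 1, ∃ a₃ ∈ A 2, ∃ a₄ ∈ A 3, a₁ + a₂ + a₃ + a₄ = 0 := by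
  have hU : (1 : ℝ) ≤ U := by exact_mod_cast h.pos
  have hP := pattern_isComb h.pos
  have hQ := container_isComb h
  obtain ⟨k, hk⟩ : ∃ k : ℝ, k = c * U := ⟨_, rfl⟩
  have hkU : (U : ℝ) ≤ k := by rw [hk]; nlinarith
  have hcm : ∀ r : ℝ, c * (r * U) = r * k := fun r => by rw [hk]; ring
  have f0 := hfit _ (comb_zero_mem hP)
  have f1 := hfit _ (comb_tip_top hP (j := 0) (by omega))
  have f2 := hfit _ (comb_tip_top hP (j := 1) (by omega))
  have f3 := hfit _ (comb_tip_right hP (j := 0) (by omega))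
  have f4 := hfit _ (comb_tip_right hP (j := 1) (by omega))
  rw [slotSeq_odd (by omega)] at f1 f2 f3 f4
  have c0 := comb_region_bounds hQ f0
  have c1 := comb_region_bounds hQ f1
  have c3 := comb_region_bounds hQ f3
  obtain ⟨τx, τy⟩ := τ
  simp only [Prod.fst_add, Prod.snd_add, Prod.smul_fst, Prod.smul_snd, smul_eq_mul, mul_zero,
    zero_add] at c0 c1 c3
  push_cast at c0 c1 c3
  rw [hcm] at c1 c3
  -- Since `c ≥ 1` and the translation is nonnegative, every tip is pushed to at least `48000 U`,
  -- beyond the square of side `40800 U`, hence into a slot.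
  obtain ⟨j1, hj1, u1, v1⟩ := exists_top_slot hQ f1 (by simp [hcm]; linarith)
  obtain ⟨j2, hj2, u2, v2⟩ := exists_top_slot hQ f2 (by simp [hcm]; linarith)
  obtain ⟨j3, hj3, u3, v3⟩ := exists_right_slot hQ f3 (by simp [hcm]; linarith)
  obtain ⟨j4, hj4, u4, v4⟩ := exists_right_slot hQ f4 (by simp [hcm]; linarith)
  rw [slotSeq_odd hj1] at u1
  rw [slotSeq_even hj1] at v1
  rw [slotSeq_odd hj2] at u2
  rw [slotSeq_even hj2] at v2
  rw [slotSeq_odd hj3] at u3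
  rw [slotSeq_even hj3] at v3
  rw [slotSeq_odd hj4] at u4
  rw [slotSeq_even hj4] at v4
  simp only [Prod.fst_add, Prod.snd_add, Prod.smul_fst, Prod.smul_snd, smul_eq_mul] at *
  push_cast at u1 v1 u2 v2 u3 v3 u4 v4
  simp only [mul_add, hcm, mul_zero, add_zero, mul_one] at u1 v1 u2 v2 u3 v3 u4 v4
  have hb : ∀ j, ∀ a ∈ A j, -(U : ℝ) ≤ a ∧ (a : ℝ) ≤ U := fun j a ha => by
    exact_mod_cast h.bound j a ha
  have key : ∀ j < m, (∃ a ∈ A 0, (s j : ℝ) = 8 * (1020 * U - a)) ∨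
      (∃ a ∈ A 1, (s j : ℝ) = 8 * (2022 * U + a)) ∨
      (∃ a ∈ A 2, (s j : ℝ) = 8 * (3020 * U + a)) ∨
      ∃ a ∈ A 3, (s j : ℝ) = 8 * (4022 * U - a) := by
    intro j hj
    exact_mod_cast h.slot hj
  -- The tips stay within `48800 U`, so `48000 k` plus either translation is at most `48800 U`. This
  -- locates every tooth to within about `1100 U`, whereas the slots of different lists are nearly
  -- `8000 U` apart.
  obtain ⟨a₁, m1, e1⟩ : ∃ a ∈ A 0, (s j1 : ℝ) = 8 * (1020 * U - a) := by
    rcases key j1 hj1 with h' | ⟨a, ha, e⟩ | ⟨a, ha, e⟩ | ⟨a, ha, e⟩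
    · exact h'
    all_goals have := hb _ a ha; linarith
  obtain ⟨a₂, m2, e2⟩ : ∃ a ∈ A 1, (s j2 : ℝ) = 8 * (2022 * U + a) := by
    rcases key j2 hj2 with ⟨a, ha, e⟩ | h' | ⟨a, ha, e⟩ | ⟨a, ha, e⟩
    · have := hb _ a ha; linarith
    · exact h'
    all_goals have := hb _ a ha; linarith
  obtain ⟨a₃, m3, e3⟩ : ∃ a ∈ A 2, (s j3 : ℝ) = 8 * (3020 * U + a) := by
    rcases key j3 hj3 with ⟨a, ha, e⟩ | ⟨a, ha, e⟩ | h' | ⟨a, ha, e⟩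
    · have := hb _ a ha; linarith
    · have := hb _ a ha; linarith
    · exact h'
    · have := hb _ a ha; linarith
  obtain ⟨a₄, m4, e4⟩ : ∃ a ∈ A 3, (s j4 : ℝ) = 8 * (4022 * U - a) := by
    rcases key j4 hj4 with ⟨a, ha, e⟩ | ⟨a, ha, e⟩ | ⟨a, ha, e⟩ | h'
    · have := hb _ a ha; linarith
    · have := hb _ a ha; linarith
    · have := hb _ a ha; linarith
    · exact h'
  refine ⟨a₁, m1, a₂, m2, a₃, m3, a₄, m4, ?_⟩
  -- Each tooth lies within 2 of the start of its slot. Comparing the two tooth distances gives `8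
  -- |a₁ + a₂ + a₃ + a₄| ≤ 4`.
  have l1 : ((a₁ + a₂ + a₃ + a₄ : ℤ) : ℝ) < (1 : ℤ) := by push_cast; linarith
  have l2 : ((-1 : ℤ) : ℝ) < (a₁ + a₂ + a₃ + a₄ : ℤ) := by push_cast; linarith
  have l1' := Int.cast_lt.1 l1
  have l2' := Int.cast_lt.1 l2
  omega

/-- The largest scaling factor is at least `1` iff the 4SUM instance is solvable. -/
theorem one_le_largestScale_iff (h : SlotValues U A m s) {r : ℝ}
    (hr : IsLargestScale (pattern U) (container U m s) r) :
    1 ≤ r ↔ ∃ a : Fin 4 → ℤ, (∀ j, a j ∈ A j) ∧ ∑ j, a j = 0 := by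
  constructor
  · intro h1
    obtain ⟨_, τ, hτ⟩ := hr.1
    obtain ⟨a₁, m1, a₂, m2, a₃, m3, a₄, m4, hs⟩ := sum_zero_of_fits h h1 hτ
    refine ⟨![a₁, a₂, a₃, a₄], fun j => ?_, ?_⟩
    · fin_cases j <;> assumption
    · simpa [Fin.sum_univ_four] using hs
  · rintro ⟨a, ha, hs⟩
    rw [Fin.sum_univ_four] at hs
    obtain ⟨c, hc, τ, hτ⟩ := fits_of_sum_zero h (ha 0) (ha 1) (ha 2) (ha 3) hs
    exact hc.trans (hr.2 ⟨by linarith, τ, hτ⟩)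

end

end Geometry

/-! ## Reasoning about programs -/

/-- Value of an expression, disregarding overflow. -/
def Expr.val (σ : Store) : Expr → ℤ
  | .const v => v
  | .cell a i => σ a (i.val σ)
  | .add e f => e.val σ + f.val σ
  | .sub e f => e.val σ - f.val σ
  | .mul e f => e.val σ * f.val σ
  | .div e f => e.val σ / f.val σ
  | .lt e f => if e.val σ < f.val σ then 1 else 0
  | .eq e f => if e.val σ = f.val σ then 1 else 0

/-- No overflow occurs in the evaluation of the expression. -/
def Expr.Ok (W : ℕ) (σ : Store) : Expr → Prop
  | .const v => v.natAbs ≤ W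
  | .cell a i => i.Ok W σ ∧ (σ a (i.val σ)).natAbs ≤ W
  | .add e f => e.Ok W σ ∧ f.Ok W σ ∧ (e.val σ + f.val σ).natAbs ≤ W
  | .sub e f => e.Ok W σ ∧ f.Ok W σ ∧ (e.val σ - f.val σ).natAbs ≤ W
  | .mul e f => e.Ok W σ ∧ f.Ok W σ ∧ (e.val σ * f.val σ).natAbs ≤ W
  | .div e f => e.Ok W σ ∧ f.Ok W σ ∧ (e.val σ / f.val σ).natAbs ≤ W
  | .lt e f => e.Ok W σ ∧ f.Ok W σ
  | .eq e f => e.Ok W σ ∧ f.Ok W σ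

theorem Expr.eval_eq_val {W : ℕ} {σ : Store} {e : Expr} (h : e.Ok W σ) :
    e.eval W σ = some (e.val σ) := by
  induction e with
  | const v => simp [eval, val, word]; exact h
  | cell a i ih => simp [eval, val, ih h.1, word, h.2]
  | add e f ihe ihf => simp [eval, val, ihe h.1, ihf h.2.1, word, h.2.2]
  | sub e f ihe ihf => simp [eval, val, ihe h.1, ihf h.2.1, word, h.2.2]
  | mul e f ihe ihf => simp [eval, val, ihe h.1, ihf h.2.1, word, h.2.2]
  | div e f ihe ihf => simp [eval, val, ihe h.1, ihf h.2.1, word, h.2.2]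
  | lt e f ihe ihf => simp [eval, val, ihe h.1, ihf h.2]
  | eq e f ihe ihf => simp [eval, val, ihe h.1, ihf h.2]

attribute [simp] Expr.val Expr.Ok Expr.cost

@[simp] theorem Store.write_self (σ : Store) (a : ℕ) (k v : ℤ) :
    σ.write a k v a = fun j => if j = k then v else σ a j := by
  funext j; simp [Store.write]

@[simp] theorem Store.write_of_ne (σ : Store) {a b : ℕ} (h : b ≠ a) (k v : ℤ) :
    σ.write a k v b = σ b := by
  funext j; simp [Store.write, h]

/-- Started in `σ`, the program halts within `T` steps in a store satisfying `Q`. -/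
def Runs (W : ℕ) (s : Prog) (σ : Store) (T : ℕ) (Q : Store → Prop) : Prop :=
  ∃ t σ', Exec W s σ t σ' ∧ t ≤ T ∧ Q σ'

/-! ### Rules for halting, cost and overflow -/

section Rules

variable {W : ℕ} {σ : Store} {Q R : Store → Prop} {T : ℕ}

theorem Runs.imp {s : Prog} (h : Runs W s σ T R) (hQ : ∀ σ', R σ' → Q σ') : Runs W s σ T Q := by
  obtain ⟨t, σ', h1, h2, h3⟩ := h
  exact ⟨t, σ', h1, h2, hQ _ h3⟩

theorem Runs.mono {s : Prog} {T' : ℕ} (h : Runs W s σ T' Q) (hT : T' ≤ T) : Runs W s σ T Q := by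
  obtain ⟨t, σ', h1, h2, h3⟩ := h
  exact ⟨t, σ', h1, h2.trans hT, h3⟩

theorem Runs.skip (hT : 1 ≤ T) (hQ : Q σ) : Runs W .skip σ T Q := ⟨1, σ, .skip σ, hT, hQ⟩

theorem Runs.assign {a : ℕ} {i e : Expr} (hi : i.Ok W σ) (he : e.Ok W σ)
    (hT : i.cost + e.cost + 1 ≤ T) (hQ : Q (σ.write a (i.val σ) (e.val σ))) :
    Runs W (.assign a i e) σ T Q :=
  ⟨_, _, .assign (Expr.eval_eq_val hi) (Expr.eval_eq_val he), hT, hQ⟩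

theorem Runs.seq {s t : Prog} {T₁ T₂ : ℕ} (hs : Runs W s σ T₁ R)
    (ht : ∀ σ', R σ' → Runs W t σ' T₂ Q) (hT : T₁ + T₂ ≤ T) : Runs W (.seq s t) σ T Q := by
  obtain ⟨t1, σ1, h1, h2, h3⟩ := hs
  obtain ⟨t2, σ2, h4, h5, h6⟩ := ht σ1 h3
  exact ⟨_, _, .seq h1 h4, by omega, h6⟩

theorem Runs.assign_seq {a : ℕ} {i e : Expr} {t : Prog} (hi : i.Ok W σ) (he : e.Ok W σ)
    (hT : i.cost + e.cost + 1 ≤ T)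
    (ht : Runs W t (σ.write a (i.val σ) (e.val σ)) (T - (i.cost + e.cost + 1)) Q) :
    Runs W (.seq (.assign a i e) t) σ T Q :=
  Runs.seq (R := fun σ' => σ' = σ.write a (i.val σ) (e.val σ)) (Runs.assign hi he le_rfl rfl)
    (fun σ' h => by subst h; exact ht) (by omega)

theorem Runs.ite {e : Expr} {s t : Prog} (he : e.Ok W σ) (hT : e.cost + 1 ≤ T)
    (hs : e.val σ ≠ 0 → Runs W s σ (T - (e.cost + 1)) Q)
    (ht : e.val σ = 0 → Runs W t σ (T - (e.cost + 1)) Q) : Runs W (.ite e s t) σ T Q := by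
  have hev := Expr.eval_eq_val he
  by_cases h : e.val σ = 0
  · obtain ⟨t1, σ1, h1, h2, h3⟩ := ht h
    rw [h] at hev
    exact ⟨_, _, .ite_false hev h1, by omega, h3⟩
  · obtain ⟨t1, σ1, h1, h2, h3⟩ := hs h
    exact ⟨_, _, .ite_true hev h h1, by omega, h3⟩

/-- Loop rule: `n` in `Inv n σ` bounds the number of remaining steps. -/
theorem Runs.loop {e : Expr} {s : Prog} (Inv : ℕ → Store → Prop)
    (h : ∀ n σ, Inv n σ → e.Ok W σ ∧ (e.val σ = 0 → Q σ) ∧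
      (e.val σ ≠ 0 → ∃ n' T, n' + T + e.cost + 1 ≤ n ∧ Runs W s σ T (Inv n')))
    {n : ℕ} (hσ : Inv n σ) : Runs W (.loop e s) σ (n + e.cost + 1) Q := by
  induction n using Nat.strong_induction_on generalizing σ with
  | _ n ih =>
    obtain ⟨hok, hdone, hstep⟩ := h n σ hσ
    have hev := Expr.eval_eq_val hok
    by_cases h0 : e.val σ = 0
    · rw [h0] at hev
      exact ⟨_, _, .loop_false hev, by omega, hdone h0⟩
    · obtain ⟨n', T, hn, t1, σ1, h1, h2, h3⟩ := hstep h0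
      obtain ⟨t2, σ2, h4, h5, h6⟩ := ih n' (by omega) h3
      exact ⟨_, _, .loop_true hev h0 h1 h4, by omega, h6⟩

/-- The scalar variable stored in cell `0` of array `a`. -/
abbrev Expr.var (a : ℕ) : Expr := .cell a (.const 0)

/-- `for i in [0, n)`. -/
def Prog.for (i : ℕ) (n : Expr) (s : Prog) : Prog :=
  .seq (.assign i (.const 0) (.const 0))
    (.loop (.lt (.var i) n) (.seq s (.assign i (.const 0) (.add (.var i) (.const 1)))))

theorem Runs.for {i : ℕ} {n : Expr} {s : Prog} {N Tb : ℕ} (Inv : ℕ → Store → Prop)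
    (hW : N + 1 ≤ W) (hinit : Inv 0 (σ.write i 0 0))
    (hcond : ∀ k ≤ N, ∀ σ, Inv k σ → σ i 0 = k ∧ n.Ok W σ ∧ n.val σ = N)
    (hstep : ∀ k < N, ∀ σ, Inv k σ →
      Runs W s σ Tb fun σ' => σ' i 0 = k ∧ Inv (k + 1) (σ'.write i 0 (k + 1)))
    (hpost : ∀ σ, Inv N σ → Q σ) (hT : N * (Tb + n.cost + 10) + n.cost + 7 ≤ T) :
    Runs W (.for i n s) σ T Q := by
  refine Runs.assign_seq (by simp [Expr.Ok]) (by simp [Expr.Ok]) (by simp [Expr.cost]; omega) ?_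
  -- A round costs `n.cost + 4` for the test, `Tb` for the body and 6 for the increment.
  refine Runs.mono (Runs.loop (n := N * (Tb + n.cost + 10))
    (fun r σ => ∃ k ≤ N, r = (N - k) * (Tb + n.cost + 10) ∧ Inv k σ) ?_
    ⟨0, by simpa [Expr.val] using hinit⟩)
    (by simp [Expr.cost]; omega)
  rintro r σ ⟨k, hk, rfl, hI⟩
  obtain ⟨h1, h2, h3⟩ := hcond k hk σ hI
  refine ⟨⟨⟨by simp [Expr.Ok], by simp [Expr.val, h1]; omega⟩, h2⟩, ?_, ?_⟩
  · intro h0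
    simp only [Expr.val, h1, h3, Nat.cast_lt] at h0
    obtain rfl : k = N := by
      by_contra hne
      rw [if_pos (by omega)] at h0
      exact absurd h0 one_ne_zero
    exact hpost σ hI
  · intro h0
    simp only [Expr.val, h1, h3, Nat.cast_lt] at h0
    have hkN : k < N := by
      by_contra hne
      rw [if_neg hne] at h0
      exact h0 rfl
    refine ⟨(N - (k + 1)) * (Tb + n.cost + 10), Tb + 6, ?_, ?_⟩
    · obtain ⟨d, rfl⟩ : ∃ d, N = k + 1 + d := ⟨N - (k + 1), by omega⟩
      rw [show k + 1 + d - k = d + 1 by omega, show k + 1 + d - (k + 1) = d by omega, add_mul]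
      simp [Expr.cost]
      omega
    · refine Runs.seq (hstep k hkN σ hI) (fun σ' hσ' => ?_) (le_refl (Tb + 6))
      refine Runs.assign (by simp [Expr.Ok]) ⟨⟨by simp [Expr.Ok], ?_⟩, ?_, ?_⟩
        (by simp [Expr.cost]) ⟨k + 1, hkN, rfl, ?_⟩
      · simp [Expr.val, hσ'.1]; omega
      · simp [Expr.Ok]; omega
      · simp [Expr.val, hσ'.1]; omega
      · simpa [Expr.val, hσ'.1] using hσ'.2

end Rules

/-! ### Frame property, bounded stores and larger word ranges -/

/-- The arrays to which a program writes. -/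
def Prog.writes : Prog → List ℕ
  | .skip => []
  | .assign a _ _ => [a]
  | .seq s t => s.writes ++ t.writes
  | .ite _ s t => s.writes ++ t.writes
  | .loop _ s => s.writes

theorem Exec.frame {W : ℕ} {s : Prog} {σ σ' : Store} {t : ℕ} (h : Exec W s σ t σ') {a : ℕ}
    (ha : a ∉ s.writes) : σ' a = σ a := by
  induction h with
  | skip => rfl
  | assign =>
    funext j
    simp only [Prog.writes, List.mem_singleton] at ha
    simp [Store.write, ha]
  | seq _ _ ih1 ih2 =>
    simp only [Prog.writes, List.mem_append, not_or] at ha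
    rw [ih2 ha.2, ih1 ha.1]
  | ite_true _ _ _ ih =>
    simp only [Prog.writes, List.mem_append, not_or] at ha
    exact ih ha.1
  | ite_false _ _ ih =>
    simp only [Prog.writes, List.mem_append, not_or] at ha
    exact ih ha.2
  | loop_true _ _ _ _ ih1 ih2 => rw [ih2 ha, ih1 ha]
  | loop_false => rfl

/-- All cells hold machine words. -/
def Bounded (W : ℕ) (σ : Store) : Prop := ∀ a i, (σ a i).natAbs ≤ W

theorem word_eq_some {W : ℕ} {x v : ℤ} (h : word W x = some v) : x = v ∧ v.natAbs ≤ W := by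
  unfold word at h
  split_ifs at h with h1
  cases h
  exact ⟨rfl, h1⟩

theorem Expr.eval_natAbs_le {W : ℕ} (hW : 1 ≤ W) {σ : Store} {e : Expr} {v : ℤ}
    (h : e.eval W σ = some v) : v.natAbs ≤ W := by
  cases e with
  | const => exact (word_eq_some h).2
  | cell =>
    obtain ⟨_, _, h1⟩ := Option.bind_eq_some_iff.1 h
    exact (word_eq_some h1).2
  | add | sub | mul | div =>
    obtain ⟨_, _, h1⟩ := Option.bind_eq_some_iff.1 h
    obtain ⟨_, _, h2⟩ := Option.bind_eq_some_iff.1 h1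
    exact (word_eq_some h2).2
  | lt | eq =>
    obtain ⟨_, _, h1⟩ := Option.bind_eq_some_iff.1 h
    obtain ⟨_, _, h2⟩ := Option.bind_eq_some_iff.1 h1
    simp only [Option.some.injEq] at h2
    subst h2
    split_ifs <;> simp [hW]

theorem Bounded.write {W : ℕ} {σ : Store} (h : Bounded W σ) {a : ℕ} {k v : ℤ}
    (hv : v.natAbs ≤ W) : Bounded W (σ.write a k v) := by
  intro b j
  unfold Store.write
  split_ifs
  · exact hv
  · exact h b j

theorem Exec.bounded {W : ℕ} (hW : 1 ≤ W) {s : Prog} {σ σ' : Store} {t : ℕ}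
    (h : Exec W s σ t σ') (hσ : Bounded W σ) : Bounded W σ' := by
  induction h with
  | skip => exact hσ
  | assign _ he => exact hσ.write (Expr.eval_natAbs_le hW he)
  | seq _ _ ih1 ih2 => exact ih2 (ih1 hσ)
  | ite_true _ _ _ ih => exact ih hσ
  | ite_false _ _ ih => exact ih hσ
  | loop_true _ _ _ _ ih1 ih2 => exact ih2 (ih1 hσ)
  | loop_false => exact hσ

/-- With this, a piece of program is specified only by what it computes: untouched arrays and the
word bound come for free. -/
theorem Runs.frame {W : ℕ} (hW : 1 ≤ W) {s : Prog} {σ : Store} {T : ℕ} {Q : Store → Prop}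
    (h : Runs W s σ T Q) (hσ : Bounded W σ) :
    Runs W s σ T fun σ' => Q σ' ∧ Bounded W σ' ∧ ∀ a ∉ s.writes, σ' a = σ a := by
  obtain ⟨t, σ', h1, h2, h3⟩ := h
  exact ⟨t, σ', h1, h2, h3, h1.bounded hW hσ, fun a ha => h1.frame ha⟩

theorem word_mono {W W' : ℕ} (hW : W ≤ W') {x v : ℤ} (h : word W x = some v) :
    word W' x = some v := by
  obtain ⟨rfl, h2⟩ := word_eq_some h
  simp [word, h2.trans hW]

theorem Expr.eval_mono {W W' : ℕ} (hW : W ≤ W') {σ : Store} {e : Expr} {v : ℤ}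
    (h : e.eval W σ = some v) : e.eval W' σ = some v := by
  induction e generalizing v with
  | const => exact word_mono hW h
  | cell a i ih =>
    obtain ⟨k, h1, h2⟩ := Option.bind_eq_some_iff.1 h
    exact Option.bind_eq_some_iff.2 ⟨k, ih h1, word_mono hW h2⟩
  | add e f ihe ihf | sub e f ihe ihf | mul e f ihe ihf | div e f ihe ihf =>
    obtain ⟨x, h1, h2⟩ := Option.bind_eq_some_iff.1 h
    obtain ⟨y, h3, h4⟩ := Option.bind_eq_some_iff.1 h2
    exact Option.bind_eq_some_iff.2 ⟨x, ihe h1,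
      Option.bind_eq_some_iff.2 ⟨y, ihf h3, word_mono hW h4⟩⟩
  | lt e f ihe ihf | eq e f ihe ihf =>
    obtain ⟨x, h1, h2⟩ := Option.bind_eq_some_iff.1 h
    obtain ⟨y, h3, h4⟩ := Option.bind_eq_some_iff.1 h2
    exact Option.bind_eq_some_iff.2 ⟨x, ihe h1, Option.bind_eq_some_iff.2 ⟨y, ihf h3, h4⟩⟩

/-- Overflow can only abort a run, so a halting run is reproduced verbatim on longer words. This
allows the geometric algorithm to run inside the reduction, which uses a larger word range. -/
theorem Exec.word_mono {W W' : ℕ} (hW : W ≤ W') {s : Prog} {σ σ' : Store} {t : ℕ}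
    (h : Exec W s σ t σ') : Exec W' s σ t σ' := by
  induction h with
  | skip => exact .skip _
  | assign hi he => exact .assign (Expr.eval_mono hW hi) (Expr.eval_mono hW he)
  | seq _ _ ih1 ih2 => exact .seq ih1 ih2
  | ite_true he hv _ ih => exact .ite_true (Expr.eval_mono hW he) hv ih
  | ite_false he _ ih => exact .ite_false (Expr.eval_mono hW he) ih
  | loop_true he hv _ _ ih1 ih2 => exact .loop_true (Expr.eval_mono hW he) hv ih1 ih2
  | loop_false he => exact .loop_false (Expr.eval_mono hW he)

/-! ### Running a program on other arrays -/

/-- Array `a` is replaced by array `a + d`. -/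
def Expr.shift (d : ℕ) : Expr → Expr
  | .const v => .const v
  | .cell a i => .cell (a + d) (i.shift d)
  | .add e f => .add (e.shift d) (f.shift d)
  | .sub e f => .sub (e.shift d) (f.shift d)
  | .mul e f => .mul (e.shift d) (f.shift d)
  | .div e f => .div (e.shift d) (f.shift d)
  | .lt e f => .lt (e.shift d) (f.shift d)
  | .eq e f => .eq (e.shift d) (f.shift d)

def Prog.shift (d : ℕ) : Prog → Prog
  | .skip => .skip
  | .assign a i e => .assign (a + d) (i.shift d) (e.shift d)
  | .seq s t => .seq (s.shift d) (t.shift d)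
  | .ite e s t => .ite (e.shift d) (s.shift d) (t.shift d)
  | .loop e s => .loop (e.shift d) (s.shift d)

theorem Expr.shift_cost (d : ℕ) (e : Expr) : (e.shift d).cost = e.cost := by
  induction e <;> simp_all [shift, cost]

theorem Expr.shift_eval {W d : ℕ} {σ τ : Store} (h : ∀ a, τ (a + d) = σ a) (e : Expr) :
    (e.shift d).eval W τ = e.eval W σ := by
  induction e <;> simp_all [shift, eval]

/-- The reduction works on low arrays and runs the assumed algorithm on those from 40 on, where it
finds exactly the initial store that it expects. -/
theorem Exec.shift {W d : ℕ} {s : Prog} {σ σ' τ : Store} {t : ℕ} (h : Exec W s σ t σ')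
    (hτ : ∀ a, τ (a + d) = σ a) :
    ∃ τ', Exec W (s.shift d) τ t τ' ∧ ∀ a, τ' (a + d) = σ' a := by
  induction h generalizing τ with
  | skip => exact ⟨τ, .skip _, hτ⟩
  | @assign a i e σ k v hi he =>
    rw [← Expr.shift_eval hτ] at hi he
    refine ⟨τ.write (a + d) k v, ?_, fun b => ?_⟩
    · have := Exec.assign (a := a + d) hi he
      rwa [Expr.shift_cost, Expr.shift_cost] at this
    · funext j
      simp [Store.write, hτ]
  | seq _ _ ih1 ih2 =>
    obtain ⟨τ1, h1, hτ1⟩ := ih1 hτ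
    obtain ⟨τ2, h2, hτ2⟩ := ih2 hτ1
    exact ⟨τ2, .seq h1 h2, hτ2⟩
  | @ite_true e s u _ _ _ _ he hv _ ih =>
    obtain ⟨τ1, h1, hτ1⟩ := ih hτ
    rw [← Expr.shift_eval hτ] at he
    refine ⟨τ1, ?_, hτ1⟩
    have := Exec.ite_true (t := u.shift d) he hv h1
    rwa [Expr.shift_cost] at this
  | @ite_false e s u _ _ _ he _ ih =>
    obtain ⟨τ1, h1, hτ1⟩ := ih hτ
    rw [← Expr.shift_eval hτ] at he
    refine ⟨τ1, ?_, hτ1⟩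
    have := Exec.ite_false (s := s.shift d) he h1
    rwa [Expr.shift_cost] at this
  | loop_true he hv _ _ ih1 ih2 =>
    obtain ⟨τ1, h1, hτ1⟩ := ih1 hτ
    obtain ⟨τ2, h2, hτ2⟩ := ih2 hτ1
    rw [← Expr.shift_eval hτ] at he
    refine ⟨τ2, ?_, hτ2⟩
    have := Exec.loop_true he hv h1 h2
    rwa [Expr.shift_cost] at this
  | @loop_false e s _ he =>
    rw [← Expr.shift_eval hτ] at he
    refine ⟨τ, ?_, hτ⟩
    have := Exec.loop_false (s := s.shift d) he
    rwa [Expr.shift_cost] at this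

open Placement.Expr Placement.Prog

/-! ## Merge sort -/

/-- The cells `[s, k)` of the output hold the values consumed so far, sorted and below everything
still waiting. `src` and `tgt` record values but not multiplicities, which is enough because
repetitions are removed after sorting. -/
structure MergeInv (α β₀ β : ℤ → ℤ) (s e₁ e₂ i j k : ℤ) : Prop where
  hsi : s ≤ i
  hie : i ≤ e₁
  hej : e₁ ≤ j
  hje : j ≤ e₂
  hk : k = i + j - e₁
  low : ∀ x < s, β x = β₀ x
  src : ∀ x, s ≤ x → x < k → ∃ y, (s ≤ y ∧ y < i ∨ e₁ ≤ y ∧ y < j) ∧ β x = α y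
  tgt : ∀ y, (s ≤ y ∧ y < i ∨ e₁ ≤ y ∧ y < j) → ∃ x, s ≤ x ∧ x < k ∧ β x = α y
  sorted : ∀ x y, s ≤ x → x ≤ y → y < k → β x ≤ β y
  bnd : ∀ x y, s ≤ x → x < k → (i ≤ y ∧ y < e₁ ∨ j ≤ y ∧ y < e₂) → β x ≤ α y

section Merge

variable {α β₀ β : ℤ → ℤ} {s e₁ e₂ i j k : ℤ}

theorem MergeInv.init (h1 : s ≤ e₁) (h2 : e₁ ≤ e₂) : MergeInv α β β s e₁ e₂ s e₁ s where
  hsi := le_rfl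
  hie := h1
  hej := le_rfl
  hje := h2
  hk := by omega
  low _ _ := rfl
  src x _ _ := by omega
  tgt y _ := by omega
  sorted x y _ _ _ := by omega
  bnd x y _ _ _ := by omega

theorem MergeInv.left (h : MergeInv α β₀ β s e₁ e₂ i j k) (hi : i < e₁)
    (h1 : ∀ y, i ≤ y → y < e₁ → α i ≤ α y) (h2 : ∀ y, j ≤ y → y < e₂ → α i ≤ α y) :
    MergeInv α β₀ (fun x => if x = k then α i else β x) s e₁ e₂ (i + 1) j (k + 1) := by
  obtain ⟨a1, a2, a3, a4, a5, a6, a7, a8, a9, a10⟩ := h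
  refine ⟨by omega, by omega, a3, a4, by omega, ?_, ?_, ?_, ?_, ?_⟩
  · intro x hx
    rw [if_neg (by omega)]
    exact a6 x hx
  · intro x hx hxk
    by_cases he : x = k
    · exact ⟨i, by omega, by simp [he]⟩
    · obtain ⟨y, hy, e⟩ := a7 x hx (by omega)
      exact ⟨y, by omega, by simpa [he] using e⟩
  · intro y hy
    by_cases he : y = i
    · exact ⟨k, by omega, by omega, by simp [he]⟩
    · obtain ⟨x, hx, hxk, e⟩ := a8 y (by omega)
      exact ⟨x, hx, by omega, by simpa [show x ≠ k by omega] using e⟩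
  · intro x y hx hxy hy
    by_cases he : y = k
    · by_cases hx' : x = k
      · simp [he, hx']
      · simpa [he, hx'] using a10 x i hx (by omega) (by omega)
    · simpa [he, show x ≠ k by omega] using a9 x y hx hxy (by omega)
  · intro x y hx hxk hy
    by_cases he : x = k
    · simp only [he, if_true]
      rcases hy with hy | hy
      · exact h1 y (by omega) hy.2
      · exact h2 y hy.1 hy.2
    · simpa [he] using a10 x y hx (by omega) (by omega)

theorem MergeInv.right (h : MergeInv α β₀ β s e₁ e₂ i j k) (hj : j < e₂)
    (h1 : ∀ y, i ≤ y → y < e₁ → α j ≤ α y) (h2 : ∀ y, j ≤ y → y < e₂ → α j ≤ α y) :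
    MergeInv α β₀ (fun x => if x = k then α j else β x) s e₁ e₂ i (j + 1) (k + 1) := by
  obtain ⟨a1, a2, a3, a4, a5, a6, a7, a8, a9, a10⟩ := h
  refine ⟨by omega, by omega, by omega, by omega, by omega, ?_, ?_, ?_, ?_, ?_⟩
  · intro x hx
    rw [if_neg (by omega)]
    exact a6 x hx
  · intro x hx hxk
    by_cases he : x = k
    · exact ⟨j, by omega, by simp [he]⟩
    · obtain ⟨y, hy, e⟩ := a7 x hx (by omega)
      exact ⟨y, by omega, by simpa [he] using e⟩
  · intro y hy
    by_cases he : y = j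
    · exact ⟨k, by omega, by omega, by simp [he]⟩
    · obtain ⟨x, hx, hxk, e⟩ := a8 y (by omega)
      exact ⟨x, hx, by omega, by simpa [show x ≠ k by omega] using e⟩
  · intro x y hx hxy hy
    by_cases he : y = k
    · by_cases hx' : x = k
      · simp [he, hx']
      · simpa [he, hx'] using a10 x j hx (by omega) (by omega)
    · simpa [he, show x ≠ k by omega] using a9 x y hx hxy (by omega)
  · intro x y hx hxk hy
    by_cases he : x = k
    · simp only [he, if_true]
      rcases hy with hy | hy
      · exact h1 y (by omega) hy.2
      · exact h2 y (by omega) hy.2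
    · simpa [he] using a10 x y hx (by omega) (by omega)

end Merge

/-- Choose the next element: array `8` is the output, array `5` the input, the blocks are
`[s, e₁)` and `[e₁, e₂)`; `11`, `12`, `13`, `14`, `15` hold `e₁`, `e₂`, `i`, `j`, `k`. -/
def mergeStep : Prog :=
  .seq
    (.ite (.mul (.lt (var 14) (var 12))
        (.sub (.add (.lt (.cell 5 (var 14)) (.cell 5 (var 13))) (.const 1))
          (.lt (var 13) (var 11))))
      (.seq (.assign 8 (var 15) (.cell 5 (var 14)))
        (.assign 14 (.const 0) (.add (var 14) (.const 1))))
      (.seq (.assign 8 (var 15) (.cell 5 (var 13)))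
        (.assign 13 (.const 0) (.add (var 13) (.const 1)))))
    (.assign 15 (.const 0) (.add (var 15) (.const 1)))

def mergeLoop : Prog := .loop (.lt (var 15) (var 12)) mergeStep

/-- The state during the merging of two blocks. -/
structure MergeState (W : ℕ) (α β₀ : ℤ → ℤ) (s e₁ e₂ : ℤ) (σ : Store) : Prop where
  bounded : Bounded W σ
  input : σ 5 = α
  he₁ : σ 11 0 = e₁
  he₂ : σ 12 0 = e₂
  inv : MergeInv α β₀ (σ 8) s e₁ e₂ (σ 13 0) (σ 14 0) (σ 15 0)

theorem mergeStep_runs {W : ℕ} {α β₀ : ℤ → ℤ} {s e₁ e₂ : ℤ} {σ : Store} (hs : 0 ≤ s)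
    (hW : e₂ + 2 ≤ W)
    (h1 : ∀ x y, s ≤ x → x ≤ y → y < e₁ → α x ≤ α y)
    (h2 : ∀ x y, e₁ ≤ x → x ≤ y → y < e₂ → α x ≤ α y)
    (h : MergeState W α β₀ s e₁ e₂ σ) (hlt : σ 15 0 < e₂) :
    Runs W mergeStep σ 60 fun σ' => MergeState W α β₀ s e₁ e₂ σ' ∧ σ' 15 0 = σ 15 0 + 1 := by
  obtain ⟨hb, hα, he1, he2, inv⟩ := h
  obtain ⟨k, hk⟩ : ∃ k, σ 15 0 = k := ⟨_, rfl⟩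
  obtain ⟨i, hi⟩ : ∃ i, σ 13 0 = i := ⟨_, rfl⟩
  obtain ⟨j, hj⟩ : ∃ j, σ 14 0 = j := ⟨_, rfl⟩
  rw [hk, hi, hj] at inv
  rw [hk] at hlt ⊢
  have a1 := inv.hsi; have a2 := inv.hie; have a3 := inv.hej; have a4 := inv.hje
  have a5 := inv.hk
  have hαb : ∀ x, (α x).natAbs ≤ W := fun x => hα ▸ hb 5 x
  refine Runs.seq (T₁ := 50) (T₂ := 10) (R := fun σ' => Bounded W σ' ∧ σ' 5 = α ∧ σ' 11 0 = e₁ ∧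
    σ' 12 0 = e₂ ∧ σ' 15 0 = k ∧
    MergeInv α β₀ (σ' 8) s e₁ e₂ (σ' 13 0) (σ' 14 0) (k + 1)) ?_ ?_ (by norm_num)
  -- In the absence of Boolean connectives the condition is a product: it is nonzero iff the right
  -- block is not exhausted and either its head is smaller or the left block is exhausted. Both
  -- heads are read in any case; this is harmless since every cell holds a word.
  · refine Runs.ite ?_ (by simp) (fun hc => ?_) fun hc => ?_
    · simp only [Expr.Ok, Expr.val, hi, hj, he1, he2, hα]
      have := hαb i; have := hαb j
      refine ⟨⟨?_, ?_⟩, ⟨⟨⟨?_, ?_⟩, ?_, ?_⟩, ?_, ?_⟩, ?_⟩ <;> (try split_ifs) <;> simp <;> omega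
    · simp only [Expr.val, hi, hj, he1, he2, hα] at hc
      have hj2 : j < e₂ := by
        by_contra hno
        rw [if_neg hno] at hc
        simp at hc
      rw [if_pos hj2] at hc
      have hij : ∀ y, i ≤ y → y < e₁ → α j ≤ α y := by
        intro y hy hye
        have h4 : α j < α i := by
          by_contra hno
          rw [if_neg hno, if_pos (by omega)] at hc
          simp at hc
        exact h4.le.trans (h1 i y a1 hy hye)
      have hinv := inv.right hj2 hij (h2 j · a3)
      refine Runs.assign_seq ?_ ?_ (by simp) (Runs.assign ?_ ?_ (by simp) ?_)
      · simp [hk]; omega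
      · simp [hj, hα, hαb]; omega
      · simp
      · simp [hj]; omega
      · refine ⟨?_, ?_⟩
        · refine Bounded.write (Bounded.write hb ?_) ?_ <;>
            simp [hj, hα, hαb]; omega
        · simpa [hi, hj, hk, hα, he1, he2] using hinv
    · simp only [Expr.val, hi, hj, he1, he2, hα] at hc
      have hcase : i < e₁ ∧ (j < e₂ → α i ≤ α j) := by
        by_cases hj2 : j < e₂
        · rw [if_pos hj2] at hc
          by_cases h4 : α j < α i
          · rw [if_pos h4] at hc; split_ifs at hc <;> simp at hc
          · rw [if_neg h4] at hc
            split_ifs at hc with h5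
            · exact ⟨h5, fun _ => not_lt.1 h4⟩
            · simp at hc
        · exact ⟨by omega, fun h => absurd h hj2⟩
      have hinv := inv.left hcase.1 (h1 i · a1)
        fun y hy hye => (hcase.2 (by omega)).trans (h2 j y a3 hy hye)
      refine Runs.assign_seq ?_ ?_ (by simp) (Runs.assign ?_ ?_ (by simp) ?_)
      · simp [hk]; omega
      · simp [hi, hα, hαb]; omega
      · simp
      · simp [hi]; omega
      · refine ⟨?_, ?_⟩
        · refine Bounded.write (Bounded.write hb ?_) ?_ <;>
            simp [hi, hα, hαb]; omega
        · simpa [hi, hj, hk, hα, he1, he2] using hinv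
  · rintro σ' ⟨hb', b1, b2, b3, b4, b5⟩
    refine Runs.assign ?_ ?_ (by simp) ⟨⟨?_, ?_, ?_, ?_, ?_⟩, ?_⟩
    · simp
    · simp [b4]; omega
    · refine Bounded.write hb' ?_
      simp [b4]; omega
    all_goals simp [b1, b2, b3, b4]
    exact b5

theorem mergeLoop_runs {W : ℕ} {α β₀ : ℤ → ℤ} {s e₁ e₂ : ℤ} {σ : Store} (hs : 0 ≤ s)
    (hW : e₂ + 2 ≤ W)
    (h1 : ∀ x y, s ≤ x → x ≤ y → y < e₁ → α x ≤ α y)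
    (h2 : ∀ x y, e₁ ≤ x → x ≤ y → y < e₂ → α x ≤ α y)
    (h : MergeState W α β₀ s e₁ e₂ σ) :
    Runs W mergeLoop σ (66 * (e₂ - σ 15 0).toNat + 6)
      fun σ' => MergeState W α β₀ s e₁ e₂ σ' ∧ σ' 15 0 = e₂ := by
  refine Runs.loop (n := 66 * (e₂ - σ 15 0).toNat)
    (fun n σ => n = 66 * (e₂ - σ 15 0).toNat ∧ MergeState W α β₀ s e₁ e₂ σ) ?_ ⟨rfl, h⟩
  rintro n σ ⟨rfl, h⟩
  have a1 := h.inv.hsi; have a2 := h.inv.hie; have a3 := h.inv.hej; have a4 := h.inv.hje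
  have a5 := h.inv.hk
  refine ⟨?_, ?_, ?_⟩
  · simp [h.bounded _ _]
  · simp only [Expr.val, h.he₂]
    intro h0
    refine ⟨h, ?_⟩
    split_ifs at h0
    · exact absurd h0 one_ne_zero
    · omega
  · simp only [Expr.val, h.he₂]
    intro h0
    have hlt : σ 15 0 < e₂ := by
      by_contra hno
      rw [if_neg hno] at h0; exact h0 rfl
    refine ⟨66 * (e₂ - σ 15 0 - 1).toNat, 60, ?_, ?_⟩
    · simp; omega
    · refine (mergeStep_runs hs hW h1 h2 h hlt).imp fun σ' h' => ⟨?_, h'.1⟩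
      rw [h'.2]; congr 2; omega

/-- Blocks of length `w` are sorted. -/
def SortedBlocks (α : ℤ → ℤ) (w m : ℤ) : Prop :=
  ∀ r x y, 0 ≤ x → w * r ≤ x → x ≤ y → y < w * (r + 1) → y < m → α x ≤ α y

/-- The part `[0, s)` of the output is finished. By `start`, `s` is the beginning of a pair of
blocks unless the pass is over. -/
structure PassInv (α β : ℤ → ℤ) (w m s : ℤ) : Prop where
  nonneg : 0 ≤ s
  le : s ≤ m
  start : s = m ∨ ∃ r, s = 2 * w * r
  src : ∀ x, 0 ≤ x → x < s → ∃ y, 0 ≤ y ∧ y < m ∧ β x = α y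
  tgt : ∀ y, 0 ≤ y → y < s → ∃ x, 0 ≤ x ∧ x < s ∧ β x = α y
  sorted : SortedBlocks β (2 * w) s

/-- The arrays have the same set of values on `[0, m)`. -/
def SameValues (m : ℤ) (α β : ℤ → ℤ) : Prop :=
  ∀ v, (∃ x, 0 ≤ x ∧ x < m ∧ α x = v) ↔ ∃ x, 0 ≤ x ∧ x < m ∧ β x = v

section Pass

variable {α β β' : ℤ → ℤ} {w m s e₁ e₂ : ℤ}

theorem SortedBlocks.first (h : SortedBlocks α w m) {r : ℤ} (h0 : 0 ≤ s)
    (hr : s = 2 * w * r) (h1 : e₁ = min (s + w) m) :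
    ∀ x y, s ≤ x → x ≤ y → y < e₁ → α x ≤ α y := fun x y hx hxy hy =>
  h (2 * r) x y (by omega) (by linarith) hxy
    (by have : w * (2 * r + 1) = s + w := by rw [hr]; ring
        omega) (by omega)

theorem SortedBlocks.second (h : SortedBlocks α w m) (hw : 0 < w) {r : ℤ} (h0 : 0 ≤ s)
    (hr : s = 2 * w * r) (h1 : e₁ = min (s + w) m) (h2 : e₂ = min (e₁ + w) m) :
    ∀ x y, e₁ ≤ x → x ≤ y → y < e₂ → α x ≤ α y := fun x y hx hxy hy => by
  have h3 : w * (2 * r + 1) = s + w := by rw [hr]; ring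
  have h4 : w * (2 * r + 1 + 1) = s + w + w := by rw [hr]; ring
  exact h (2 * r + 1) x y (by omega) (by omega) hxy (by omega) (by omega)

theorem PassInv.step (h : PassInv α β w m s) (hw : 0 < w) {r : ℤ} (hr : s = 2 * w * r)
    (hsm : s < m) (h1 : e₁ = min (s + w) m) (h2 : e₂ = min (e₁ + w) m) {i j : ℤ}
    (hm : MergeInv α β β' s e₁ e₂ i j e₂) : PassInv α β' w m e₂ := by
  have b1 := hm.hie; have b2 := hm.hje; have b3 := hm.hk; have b4 := hm.hej
  have b0 := h.nonneg
  obtain rfl : i = e₁ := by omega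
  obtain rfl : j = e₂ := by omega
  have hsrc : ∀ x, 0 ≤ x → x < j → ∃ y, 0 ≤ y ∧ y < m ∧ β' x = α y := by
    intro x hx hxe
    by_cases hxs : x < s
    · rw [hm.low x hxs]; exact h.src x hx hxs
    · obtain ⟨y, hy, e⟩ := hm.src x (by omega) hxe
      exact ⟨y, by omega, by omega, e⟩
  have htgt : ∀ y, 0 ≤ y → y < j → ∃ x, 0 ≤ x ∧ x < j ∧ β' x = α y := by
    intro y hy hye
    by_cases hys : y < s
    · obtain ⟨x, hx, hxs, e⟩ := h.tgt y hy hys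
      exact ⟨x, hx, by omega, by rw [hm.low x hxs, e]⟩
    · obtain ⟨x, hx, hxe, e⟩ := hm.tgt y (by omega)
      exact ⟨x, by omega, hxe, e⟩
  refine ⟨by omega, by omega, ?_, hsrc, htgt, ?_⟩
  · by_cases hjm : j = m
    · exact Or.inl hjm
    · refine Or.inr ⟨r + 1, ?_⟩
      have : 2 * w * (r + 1) = s + w + w := by rw [hr]; ring
      omega
  · intro r' x y hx0 hx hxy hy hye
    by_cases hys : y < s
    · rw [hm.low x (by omega), hm.low y hys]
      exact h.sorted r' x y hx0 hx hxy hy hys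
    · have hr' : r ≤ r' := by
        by_contra hlt
        have : 2 * w * (r' + 1) ≤ 2 * w * r := mul_le_mul_of_nonneg_left (by omega) (by omega)
        omega
      have : 2 * w * r ≤ 2 * w * r' := mul_le_mul_of_nonneg_left hr' (by omega)
      exact hm.sorted x y (by omega) hxy (by omega)

theorem PassInv.final (h : PassInv α β w m m) (hβ : ∀ x, 0 ≤ x → x < m → β' x = β x) :
    SortedBlocks β' (2 * w) m ∧ SameValues m α β' := by
  refine ⟨fun r x y hx0 hx hxy hy hym => ?_, fun v => ⟨?_, ?_⟩⟩
  · rw [hβ x hx0 (by omega), hβ y (by omega) hym]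
    exact h.sorted r x y hx0 hx hxy hy hym
  · rintro ⟨y, hy, hym, rfl⟩
    obtain ⟨x, hx, hxm, e⟩ := h.tgt y hy hym
    exact ⟨x, hx, hxm, by rw [hβ x hx hxm, e]⟩
  · rintro ⟨x, hx, hxm, rfl⟩
    obtain ⟨y, hy, hym, e⟩ := h.src x hx hxm
    exact ⟨y, hy, hym, by rw [hβ x hx hxm, e]⟩

end Pass

/-- The minimum of two expressions. -/
def Expr.min (e f : Expr) : Expr := .add f (.mul (.sub e f) (.lt e f))

@[simp] theorem Expr.val_min (σ : Store) (e f : Expr) :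
    (Expr.min e f).val σ = Min.min (e.val σ) (f.val σ) := by
  simp only [Expr.min, Expr.val]
  split_ifs <;> omega

theorem Expr.ok_min {W : ℕ} {σ : Store} {e f : Expr} (he : e.Ok W σ) (hf : f.Ok W σ)
    (h1 : 0 ≤ e.val σ) (h2 : e.val σ ≤ W) (h3 : 0 ≤ f.val σ) (h4 : f.val σ ≤ W) :
    (Expr.min e f).Ok W σ := by
  simp only [Expr.min, Expr.val, Expr.Ok]
  refine ⟨hf, ⟨⟨he, hf, by omega⟩, ⟨he, hf⟩, ?_⟩, ?_⟩ <;> split_ifs <;> omega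

/-- Merge the blocks `[s, s + w)` and `[s + w, s + 2 * w)`; `6`, `9`, `10` hold `m`, `w`, `s`. -/
def mergeBlock : Prog :=
  .seq (.assign 11 (.const 0) (Expr.min (.add (var 10) (var 9)) (var 6)))
  (.seq (.assign 12 (.const 0) (Expr.min (.add (var 11) (var 9)) (var 6)))
  (.seq (.assign 13 (.const 0) (var 10))
  (.seq (.assign 14 (.const 0) (var 11))
  (.seq (.assign 15 (.const 0) (var 10))
  (.seq mergeLoop
    (.assign 10 (.const 0) (var 12)))))))

structure PassState (W : ℕ) (α : ℤ → ℤ) (w m : ℤ) (σ : Store) : Prop where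
  bounded : Bounded W σ
  input : σ 5 = α
  len : σ 6 0 = m
  width : σ 9 0 = w
  inv : PassInv α (σ 8) w m (σ 10 0)

theorem mergeBlock_runs {W : ℕ} {α : ℤ → ℤ} {w m : ℤ} {σ : Store} (hw : 0 < w) (hwm : w < m)
    (hW : 4 * m + 4 ≤ W) (hα : SortedBlocks α w m) (h : PassState W α w m σ)
    (hlt : σ 10 0 < m) :
    Runs W mergeBlock σ (160 * (min (min (σ 10 0 + w) m + w) m - σ 10 0).toNat)
      fun σ' => PassState W α w m σ' ∧ σ' 10 0 = min (min (σ 10 0 + w) m + w) m := by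
  obtain ⟨hb, hin, hlen, hwid, inv⟩ := h
  obtain ⟨s, hs⟩ : ∃ s, σ 10 0 = s := ⟨_, rfl⟩
  rw [hs] at inv hlt ⊢
  have hs0 := inv.nonneg
  obtain ⟨e₁, he₁⟩ : ∃ e, e = min (s + w) m := ⟨_, rfl⟩
  obtain ⟨e₂, he₂⟩ : ∃ e, e = min (e₁ + w) m := ⟨_, rfl⟩
  rw [← he₁, ← he₂]
  obtain ⟨r, hr⟩ : ∃ r, s = 2 * w * r := inv.start.resolve_left (by omega)
  have hse : s < e₂ := by omega
  -- The pair of blocks is nonempty, so the constant overhead can be charged to its length.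
  obtain ⟨N, hN⟩ : ∃ N, (e₂ - s).toNat = N + 1 := ⟨(e₂ - s).toNat - 1, by omega⟩
  rw [hN]
  refine Runs.assign_seq (by simp) (Expr.ok_min ?_ ?_ ?_ ?_ ?_ ?_) (by simp [Expr.min]; omega) ?_
  · simp [hs, hwid]; omega
  · simp [hlen]; omega
  · simp [hs, hwid]; omega
  · simp [hs, hwid]; omega
  · simp [hlen]; omega
  · simp [hlen]; omega
  simp only [val_min, val, hs, hwid, hlen, ← he₁]
  refine Runs.assign_seq (by simp) (Expr.ok_min ?_ ?_ ?_ ?_ ?_ ?_) (by simp [Expr.min]; omega) ?_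
  · simp [hwid]; omega
  · simp [hlen]; omega
  · simp [hwid]; omega
  · simp [hwid]; omega
  · simp [hlen]; omega
  · simp [hlen]; omega
  have e1 : ((σ.write 11 0 e₁) 11 0) = e₁ := by simp
  simp only [val_min, val, e1, ne_eq, Store.write_of_ne, Nat.reduceEqDiff,
    not_false_eq_true, hwid, hlen, ← he₂]
  refine Runs.assign_seq (by simp) ?_ (by simp [Expr.min]; omega) ?_
  · simp [hs]; omega
  refine Runs.assign_seq (by simp) ?_ (by simp [Expr.min]; omega) ?_
  · simp; omega
  refine Runs.assign_seq (by simp) ?_ (by simp [Expr.min]; omega) ?_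
  · simp [hs]; omega
  have hst : MergeState W α (σ 8) s e₁ e₂ (((((σ.write 11 0 e₁).write 12 0 e₂).write 13 0 s).write
      14 0 e₁).write 15 0 s) := by
    refine ⟨?_, by simp [hin], by simp, by simp, ?_⟩
    · exact ((((hb.write (by omega)).write (by omega)).write (by omega)).write (by omega)).write
        (by omega)
    · simpa using MergeInv.init (by omega) (by omega)
  have hrun := (mergeLoop_runs hs0 (by omega) (hα.first hs0 hr he₁)
    (hα.second hw hs0 hr he₁ he₂) hst).frame (by omega) hst.bounded
  simp only [val, ne_eq, Store.write_of_ne, Nat.reduceEqDiff,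
    not_false_eq_true, hs, e1]
  refine Runs.seq hrun (T₂ := 5) ?_ (by simp [Expr.min]; omega)
  rintro σ' ⟨⟨hm, hk⟩, hb', hfr⟩
  have hf6 := hfr 6 (by decide)
  have hf9 := hfr 9 (by decide)
  have hinv := hm.inv
  rw [hk] at hinv
  refine Runs.assign (by simp) ?_ (by simp) ⟨⟨?_, ?_, ?_, ?_, ?_⟩, ?_⟩
  · simp [hm.he₂]; omega
  · refine hb'.write ?_
    simp [hm.he₂]; omega
  · simp [hm.input]
  · simp [hf6, hlen]
  · simp [hf9, hwid]
  · simpa [hm.he₂] using inv.step hw hr hlt he₁ he₂ hinv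
  · simp [hm.he₂]

/-- Merge pairs of sorted blocks of length `w`. -/
def mergePass : Prog :=
  .seq (.assign 10 (.const 0) (.const 0))
  (.seq (.loop (.lt (var 10) (var 6)) mergeBlock)
    (.for 13 (var 6) (.assign 5 (var 13) (.cell 8 (var 13)))))

theorem mergePass_runs {W m : ℕ} {w : ℤ} {σ : Store} (hw : 0 < w) (hwm : w < m)
    (hW : 4 * m + 4 ≤ W) (hα : SortedBlocks (σ 5) w m) (hb : Bounded W σ) (hlen : σ 6 0 = m)
    (hwid : σ 9 0 = w) :
    Runs W mergePass σ (300 * m + 30) fun σ' => SortedBlocks (σ' 5) (2 * w) m ∧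
      SameValues m (σ 5) (σ' 5) ∧ σ' 6 0 = m ∧ σ' 9 0 = w ∧ Bounded W σ' := by
  refine Runs.assign_seq (by simp) (by simp) (by simp) ?_
  simp only [val]
  have hrun : Runs W (.loop (.lt (var 10) (var 6)) mergeBlock) (σ.write 10 0 0) (200 * m + 6)
      fun σ' => PassState W (σ 5) w m σ' ∧ σ' 10 0 = m := by
    refine Runs.mono (Runs.loop (n := 200 * m)
      (fun n σ' => n = 200 * (m - σ' 10 0).toNat ∧ PassState W (σ 5) w m σ') ?_ ⟨?_, ?_⟩) ?_
    · rintro n σ' ⟨rfl, hst⟩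
      have h0 := hst.inv.nonneg
      have h1 := hst.inv.le
      refine ⟨?_, ?_, ?_⟩
      · simp [hst.len]; omega
      · simp only [val, hst.len]
        intro h2
        split_ifs at h2
        · exact absurd h2 one_ne_zero
        · exact ⟨hst, by omega⟩
      · simp only [val, hst.len]
        intro h2
        have hlt : σ' 10 0 < m := by
          by_contra hno
          rw [if_neg hno] at h2
          exact h2 rfl
        refine ⟨200 * (m - min (min (σ' 10 0 + w) m + w) m).toNat, _, ?_,
          (mergeBlock_runs hw hwm (by exact_mod_cast hW) hα hst hlt).imp fun σ'' h => ⟨?_, h.1⟩⟩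
        · simp; omega
        · rw [h.2]
    · simp
    · refine ⟨hb.write (by simp), by simp, by simpa using hlen, by simpa using hwid, ?_⟩
      refine ⟨by simp, by simp, Or.inr ⟨0, by simp⟩, ?_, ?_, ?_⟩
      · intro x hx hx'; simp at hx'; omega
      · intro x hx hx'; simp at hx'; omega
      · intro r x y hx _ hxy _ hy; simp at hy; omega
    · simp
  refine Runs.seq hrun (T₂ := 60 * m + 10) ?_ (by simp; omega)
  rintro σ₁ ⟨hst, hs⟩
  have hinv := hst.inv
  rw [hs] at hinv
  refine Runs.for (N := m) (Tb := 10) (fun k σ' => Bounded W σ' ∧ σ' 13 0 = k ∧ σ' 6 0 = m ∧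
    σ' 9 0 = w ∧ σ' 8 = σ₁ 8 ∧ ∀ x : ℤ, 0 ≤ x → x < k → σ' 5 x = σ₁ 8 x) (by omega) ?_ ?_ ?_ ?_ ?_
  · refine ⟨hst.bounded.write (by simp), by simp, by simpa using hst.len,
      by simpa using hst.width, by simp, fun x hx hx' => ?_⟩
    simp at hx'; omega
  · rintro k hk σ' ⟨hb', h1, h2, -⟩
    refine ⟨h1, ?_, ?_⟩
    · simp [h2]; omega
    · simp [h2]
  · rintro k hk σ' ⟨hb', h1, h2, h3, h4, h5⟩
    have hb8 := hb' 8
    rw [h4] at hb8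
    refine Runs.assign ?_ ?_ (by simp) ⟨?_, ?_, ?_, ?_, ?_, ?_, ?_⟩
    · simp [h1]; omega
    · simp [h1, h4, hb8]; omega
    · simp [h1]
    · refine (hb'.write ?_).write (by omega)
      simp [h4, hb8]
    · simp
    · simp [h2]
    · simp [h3]
    · simp [h4]
    · intro x hx hxk
      push_cast at hxk
      simp only [val, h1, h4, ne_eq, Store.write_of_ne, Store.write_self,
        Nat.reduceEqDiff, not_false_eq_true]
      split_ifs with he
      · rw [he]
      · exact h5 x hx (by omega)
  · rintro σ' ⟨hb', h1, h2, h3, h4, h5⟩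
    obtain ⟨h6, h7⟩ := hinv.final h5
    exact ⟨h6, h7, h2, h3, hb'⟩
  · simp; omega

/-- Bottom-up merge sort of the cells `[0, m)` of array `5`. -/
def sortProg : Prog :=
  .seq (.assign 9 (.const 0) (.const 1))
    (.loop (.lt (var 9) (var 6))
      (.seq mergePass (.assign 9 (.const 0) (.add (var 9) (var 9)))))

theorem SameValues.trans {m : ℤ} {α β γ : ℤ → ℤ} (h : SameValues m α β)
    (h' : SameValues m β γ) : SameValues m α γ := fun v => (h v).trans (h' v)

theorem sortProg_runs {W m : ℕ} {σ : Store} (hW : 4 * m + 4 ≤ W) (hb : Bounded W σ)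
    (hlen : σ 6 0 = m) :
    Runs W sortProg σ (Nat.clog 2 m * (300 * m + 50) + 20) fun σ' =>
      (∀ x y : ℤ, 0 ≤ x → x ≤ y → y < m → σ' 5 x ≤ σ' 5 y) ∧ SameValues m (σ 5) (σ' 5) ∧
      σ' 6 0 = m := by
  refine Runs.assign_seq (by simp) (by simp; omega) (by simp) ?_
  simp only [val]
  refine Runs.mono (Runs.loop (n := Nat.clog 2 m * (300 * m + 50))
    (fun n σ' => ∃ h : ℕ, n = (Nat.clog 2 m - h) * (300 * m + 50) ∧ σ' 9 0 = 2 ^ h ∧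
      Bounded W σ' ∧ σ' 6 0 = m ∧ SortedBlocks (σ' 5) (2 ^ h) m ∧ SameValues m (σ 5) (σ' 5)) ?_
    ⟨0, rfl, by simp, hb.write (by simp; omega), by simpa using hlen, ?_, ?_⟩) ?_
  · rintro n σ' ⟨h, rfl, h1, h2, h3, h4, h5⟩
    refine ⟨?_, ?_, ?_⟩
    · simp [h3, h2 _ _]; omega
    · intro h6
      simp only [val, h1, h3] at h6
      refine ⟨fun x y hx hxy hy => ?_, h5, h3⟩
      split_ifs at h6 with h7
      · exact absurd h6 one_ne_zero
      -- The loop stops with `m ≤ 2 ^ h`; block 0 is then the whole array.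
      · exact h4 0 x y hx (by simpa using hx) hxy (by simp; omega) hy
    · simp only [val, h1, h3]
      intro h6
      have hlt : (2 : ℤ) ^ h < m := by
        by_contra hno
        rw [if_neg hno] at h6
        exact h6 rfl
      have hlt' : 2 ^ h < m := by exact_mod_cast hlt
      -- Round `h` takes place only while `2 ^ h < m`, which bounds the number of passes by the
      -- rounded-up logarithm.
      have hclog : h < Nat.clog 2 m := (Nat.lt_clog_iff_pow_lt one_lt_two).2 hlt'
      refine ⟨(Nat.clog 2 m - (h + 1)) * (300 * m + 50), 300 * m + 30 + 8, ?_, ?_⟩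
      · obtain ⟨d, hd⟩ : ∃ d, Nat.clog 2 m = h + 1 + d := ⟨Nat.clog 2 m - (h + 1), by omega⟩
        rw [hd, show h + 1 + d - h = d + 1 by omega, show h + 1 + d - (h + 1) = d by omega,
          add_mul]
        simp; omega
      · refine Runs.seq (mergePass_runs (by positivity) hlt (by omega) h4 h2 h3 h1) ?_ le_rfl
        rintro σ'' ⟨g1, g2, g3, g4, g5⟩
        have hpos : 0 < σ'' 9 0 := g4 ▸ by positivity
        rw [← g4] at hlt
        refine Runs.assign (by simp) ?_ (by simp) ⟨h + 1, rfl, ?_, ?_, ?_, ?_, ?_⟩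
        · simp; omega
        · simp [g4]; ring
        · refine g5.write ?_
          simp; omega
        · simp [g3]
        · simpa [pow_succ'] using g1
        · simpa using h5.trans g2
  · intro r x y _ h1 h2 h3 _
    simp at h1 h3
    rw [show x = y by omega]
  · intro v; simp
  · simp

/-! ## Writing the polygons -/

/-- From the sorted array `5`, the distinct values `s 0 < s 1 < …` are written together with
`s 0 + 2, s 1 + 2, …` to the cells `1, 2, …` of array `16`; `17` holds their number. -/
def dedupProg : Prog :=
  .seq (.assign 17 (.const 0) (.const 0))
    (.for 13 (var 6)
      (.ite (.eq (.cell 5 (var 13)) (.cell 16 (.sub (.add (var 17) (var 17)) (.const 1)))) .skip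
        (.seq (.assign 16 (.add (.add (var 17) (var 17)) (.const 1)) (.cell 5 (var 13)))
        (.seq (.assign 16 (.add (.add (var 17) (var 17)) (.const 2))
            (.add (.cell 5 (var 13)) (.const 2)))
          (.assign 17 (.const 0) (.add (var 17) (.const 1)))))))

/-- Every new value is compared with the last one written, in cell `2 * c - 1`. For `c = 0` this is
cell `-1`, whose value 0 is a sentinel since slot positions are positive; cell 0 stays 0 as the
start of the slot sequence. -/
structure DedupInv (α γ : ℤ → ℤ) (k c : ℕ) : Prop where
  le : c ≤ k
  zero : γ 0 = 0
  neg_one : γ (-1) = 0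
  even : ∀ j : ℕ, j < c → γ (2 * j + 2) = γ (2 * j + 1) + 2
  lt : ∀ j : ℕ, j + 1 < c → γ (2 * j + 1) < γ (2 * (j + 1 : ℕ) + 1)
  mem : ∀ v, (∃ j : ℕ, j < c ∧ γ (2 * j + 1) = v) ↔ ∃ x : ℤ, 0 ≤ x ∧ x < k ∧ α x = v
  last : k = 0 ∧ c = 0 ∨ 0 < k ∧ 0 < c ∧ γ (2 * c - 1) = α (k - 1)

theorem DedupInv.skip {α γ : ℤ → ℤ} {k c : ℕ} (h : DedupInv α γ k c) (hpos : 0 < α k)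
    (he : α k = γ (2 * c - 1)) : DedupInv α γ (k + 1) c := by
  obtain ⟨a1, a2, a3, a4, a5, a6, a7⟩ := h
  rcases a7 with ⟨rfl, rfl⟩ | ⟨hk, hc, hl⟩
  · simp [a3] at he hpos; omega
  refine ⟨by omega, a2, a3, a4, a5, fun v => ?_, Or.inr ⟨by omega, hc, ?_⟩⟩
  · rw [a6]
    constructor
    · rintro ⟨x, hx, hxk, e⟩
      exact ⟨x, hx, by push_cast; omega, e⟩
    · rintro ⟨x, hx, hxk, e⟩
      by_cases hxe : x = k
      · exact ⟨k - 1, by omega, by omega, by rw [← e, hxe, he, hl]⟩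
      · exact ⟨x, hx, by push_cast at hxk; omega, e⟩
  · rw [← he]; simp

theorem DedupInv.push {α γ γ' : ℤ → ℤ} {k c : ℕ} (h : DedupInv α γ k c)
    (hmono : 0 < k → α (k - 1) ≤ α k) (hne : α k ≠ γ (2 * c - 1))
    (hγ : ∀ x, γ' x = if x = 2 * c + 2 then α k + 2 else if x = 2 * c + 1 then α k else γ x) :
    DedupInv α γ' (k + 1) (c + 1) := by
  obtain ⟨a1, a2, a3, a4, a5, a6, a7⟩ := h
  have hold : ∀ x : ℤ, x ≤ 2 * c → γ' x = γ x := fun x hx => by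
    rw [hγ, if_neg (by omega), if_neg (by omega)]
  have h1 : γ' (2 * c + 1) = α k := by rw [hγ, if_neg (by omega), if_pos rfl]
  have h2 : γ' (2 * c + 2) = α k + 2 := by rw [hγ, if_pos rfl]
  refine ⟨by omega, by rw [hold _ (by omega), a2], by rw [hold _ (by omega), a3], ?_, ?_,
    fun v => ⟨?_, ?_⟩, Or.inr ⟨by omega, by omega, ?_⟩⟩
  · intro j hj
    rcases eq_or_ne j c with rfl | hne'
    · rw [h1, h2]
    · rw [hold _ (by omega), hold _ (by omega), a4 j (by omega)]
  · intro j hj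
    rcases eq_or_ne (j + 1) c with rfl | hne'
    · rw [h1, hold _ (by omega)]
      rcases a7 with ⟨_, h0⟩ | ⟨hk, _, hl⟩
      · omega
      have e : (2 * ((j + 1 : ℕ) : ℤ) - 1) = 2 * j + 1 := by push_cast; ring
      rw [e] at hl hne
      have := hmono hk
      rw [hl] at hne ⊢
      omega
    · rw [hold _ (by omega), hold _ (by omega)]
      exact a5 j (by omega)
  · rintro ⟨j, hj, rfl⟩
    rcases eq_or_ne j c with rfl | hne'
    · exact ⟨k, by omega, by push_cast; omega, h1.symm⟩
    · obtain ⟨x, hx, hxk, e⟩ := (a6 _).1 ⟨j, by omega, rfl⟩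
      exact ⟨x, hx, by push_cast; omega, by rw [e, hold _ (by omega)]⟩
  · rintro ⟨x, hx, hxk, rfl⟩
    by_cases hxe : x = k
    · exact ⟨c, by omega, by rw [h1, hxe]⟩
    · obtain ⟨j, hj, e⟩ := (a6 _).2 ⟨x, hx, by push_cast at hxk; omega, rfl⟩
      exact ⟨j, by omega, by rw [← e, hold _ (by omega)]⟩
  · push_cast
    rw [show 2 * ((c : ℤ) + 1) - 1 = 2 * c + 1 by ring, h1]
    simp

theorem dedupProg_runs {W m : ℕ} {σ : Store} (hW : 4 * m + 4 ≤ W) (hb : Bounded W σ)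
    (hlen : σ 6 0 = m) (h16 : σ 16 = 0)
    (hsort : ∀ x y : ℤ, 0 ≤ x → x ≤ y → y < m → σ 5 x ≤ σ 5 y)
    (hpos : ∀ x : ℤ, 0 ≤ x → x < m → 0 < σ 5 x ∧ σ 5 x + 2 ≤ W) :
    Runs W dedupProg σ (60 * m + 20) fun σ' =>
      ∃ c : ℕ, σ' 17 0 = c ∧ DedupInv (σ 5) (σ' 16) m c := by
  refine Runs.assign_seq (by simp) (by simp) (by simp) ?_
  simp only [val]
  refine Runs.for (N := m) (Tb := 45) (fun k σ' => Bounded W σ' ∧ σ' 13 0 = k ∧ σ' 6 0 = m ∧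
    σ' 5 = σ 5 ∧ ∃ c : ℕ, σ' 17 0 = c ∧ DedupInv (σ 5) (σ' 16) k c) (by omega) ?_ ?_ ?_ ?_ ?_
  · refine ⟨(hb.write (by simp)).write (by simp), by simp, by simpa using hlen, by simp, 0,
      by simp, ?_⟩
    simp only [ne_eq, Nat.reduceEqDiff, not_false_eq_true,
      Store.write_of_ne, h16]
    refine ⟨le_rfl, rfl, rfl, fun j hj => by omega, fun j hj => by omega, fun v => ?_, by simp⟩
    constructor
    · rintro ⟨j, hj, _⟩; omega
    · rintro ⟨x, hx, hx', _⟩; push_cast at hx'; omega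
  · rintro k hk σ' ⟨hb', h1, h2, -⟩
    refine ⟨h1, ?_, ?_⟩
    · simp [h2]; omega
    · simp [h2]
  · rintro k hk σ' ⟨hb', h1, h2, h3, c, h4, hinv⟩
    have hck := hinv.le
    have hk0 := hpos k (by omega) (by omega)
    have hb16 := hb' 16
    have e1 : (c : ℤ) + c - 1 = 2 * c - 1 := by ring
    refine Runs.ite ?_ (by simp) (fun hc => ?_) fun hc => ?_
    · simp [h1, h3, h4, hb16]; omega
    · simp only [val, h1, h3, h4, e1] at hc
      have he : σ 5 k = σ' 16 (2 * c - 1) := by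
        by_contra hno
        rw [if_neg hno] at hc; exact hc rfl
      refine Runs.skip (by simp) ⟨h1, hb'.write (by omega), by simp, by simp [h2], by simp [h3],
        c, by simp [h4], ?_⟩
      simpa using hinv.skip hk0.1 he
    · simp only [val, h1, h3, h4, e1] at hc
      have he : σ 5 k ≠ σ' 16 (2 * c - 1) := by
        intro hno
        rw [if_pos hno] at hc; exact one_ne_zero hc
      refine Runs.assign_seq ?_ ?_ (by simp) ?_
      · simp [h4]; omega
      · simp [h1, h3]; omega
      refine Runs.assign_seq ?_ ?_ (by simp) ?_
      · simp [h4]; omega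
      · simp [h1, h3]; omega
      refine Runs.assign ?_ ?_ (by simp) ⟨?_, ?_, ?_, ?_, ?_, c + 1, ?_, ?_⟩
      · simp
      · simp [h4]; omega
      · simp [h1]
      · refine (((hb'.write ?_).write ?_).write ?_).write (by omega) <;> simp [h1, h3, h4] <;> omega
      · simp
      · simp [h2]
      · simp [h3]
      · simp [h4]
      · refine hinv.push (fun hk' => hsort _ _ (by omega) (by omega) (by omega)) he fun x => ?_
        simp [h1, h3, h4]
        rw [show (c : ℤ) + c = 2 * c by ring]
  · rintro σ' ⟨_, _, _, _, h⟩
    exact h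
  · simp; omega

/-! ### Writing the vertices of a comb -/

/-- The first coordinate of the vertices of a chain: `13`, `21`, `22` hold `k`, `H`, `E`. -/
def chainFstExpr : Expr :=
  .add (var 21) (.mul (.sub (var 22) (var 21))
    (.sub (.div (var 13) (.const 2)) (.mul (.const 2) (.div (var 13) (.const 4)))))

def halfExpr : Expr := .div (.add (var 13) (.const 1)) (.const 2)

def mirrorExpr : Expr := .sub (.add (.mul (.const 8) (var 20)) (.const 3)) (var 13)

/-- Write the coordinates of a comb to the arrays `X` and `Y`; the arrays `a` and `b` hold the
slot sequences, and `20`, `21`, `22` hold `m`, `H`, `E`. -/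
def combProg (a b X Y : ℕ) : Prog :=
  .for 13 (.add (.mul (.const 4) (var 20)) (.const 2))
    (.seq (.assign X (.add (var 13) (.const 1)) chainFstExpr)
    (.seq (.assign Y (.add (var 13) (.const 1)) (.cell a halfExpr))
    (.seq (.assign X mirrorExpr (.cell b halfExpr))
      (.assign Y mirrorExpr chainFstExpr))))

/-- The machine has no remainder operation; `k / 2 % 2` is computed as `k / 2 - 2 * (k / 4)`. -/
theorem combChain_fst_int {H E : ℤ} {g : ℕ → ℤ} {k : ℕ} :
    (combChain H E g k).1 = H + (E - H) * ((k : ℤ) / 2 - 2 * (k / 4)) := by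
  simp only [combChain]
  congr 2
  omega

/-- Round `k` writes vertex `k + 1` of the right chain and its counterpart `8 * m + 3 - k` of the
top chain, so after `k` rounds `k` vertices are done at either end of the list. The corner is
written twice with the same value, and vertex 0, the origin, is already present in zeroed arrays. -/
theorem combProg_runs {W m a b X Y : ℕ} {H E : ℤ} {gR gT : ℕ → ℤ} {σ : Store}
    (h : IsComb m H E gR gT) (ha : 14 ≤ a ∧ a < 20) (hb : 14 ≤ b ∧ b < 20) (hX : 30 ≤ X)
    (hY : 30 ≤ Y) (hXY : X ≠ Y) (hW : 8 * m + 8 ≤ W) (hE : E ≤ W) (hbd : Bounded W σ)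
    (h20 : σ 20 0 = m) (h21 : σ 21 0 = H) (h22 : σ 22 0 = E)
    (haR : ∀ u : ℕ, u ≤ 2 * m + 1 → σ a u = gR u) (hbT : ∀ u : ℕ, u ≤ 2 * m + 1 → σ b u = gT u)
    (hX0 : σ X = 0) (hY0 : σ Y = 0) :
    Runs W (combProg a b X Y) σ (600 * m + 300) fun σ' =>
      σ' X = (fun i => if 0 ≤ i then ((comb m H E gR gT).map Prod.fst).getD i.toNat 0 else 0) ∧
      σ' Y = fun i => if 0 ≤ i then ((comb m H E gR gT).map Prod.snd).getD i.toNat 0 else 0 := by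
  have hH := h.right.pos
  have hHE := h.lt
  refine Runs.for (N := 4 * m + 2) (Tb := 100) (fun k σ' => Bounded W σ' ∧ σ' 13 0 = k ∧
    σ' 20 = σ 20 ∧ σ' 21 = σ 21 ∧ σ' 22 = σ 22 ∧ σ' a = σ a ∧ σ' b = σ b ∧
    (∀ i : ℤ, σ' X i = if (1 ≤ i ∧ i ≤ k) ∨ (8 * m + 3 - k < i ∧ i ≤ 8 * m + 3) then
      ((comb m H E gR gT).vertex i.toNat).1 else 0) ∧
    (∀ i : ℤ, σ' Y i = if (1 ≤ i ∧ i ≤ k) ∨ (8 * m + 3 - k < i ∧ i ≤ 8 * m + 3) then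
      ((comb m H E gR gT).vertex i.toNat).2 else 0)) (by omega) ?_ ?_ ?_ ?_ ?_
  · simp (disch := omega) only [Store.write_of_ne, hX0, hY0]
    refine ⟨hbd.write (by simp), by simp, trivial, trivial, trivial, trivial, trivial, ?_, ?_⟩ <;>
    · intro i
      rw [if_neg (by push_cast; omega)]
      rfl
  · rintro k hk σ' ⟨hb', h1, h2, -⟩
    refine ⟨h1, ?_, ?_⟩
    · simp [h2, h20]; omega
    · simp [h2, h20]
  · rintro k hk σ' ⟨hb', h1, h2, h3, h4, h5, h6, h7, h8⟩
    have hx01 : (k : ℤ) / 2 - 2 * (k / 4) = 0 ∨ (k : ℤ) / 2 - 2 * (k / 4) = 1 := by omega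
    have hfst : ∀ g : ℕ → ℤ, 0 ≤ (combChain H E g k).1 ∧ (combChain H E g k).1 ≤ E ∧
        0 ≤ (E - H) * ((k : ℤ) / 2 - 2 * (k / 4)) ∧
        (E - H) * ((k : ℤ) / 2 - 2 * (k / 4)) ≤ E := fun g => by
      rw [combChain_fst_int]
      rcases hx01 with hx | hx <;> rw [hx] <;> omega
    have hhalf : ((k : ℤ) + 1) / 2 = ((k + 1) / 2 : ℕ) := by omega
    have hR := comb_vertex_right (m := m) (H := H) (E := E) (gR := gR) (gT := gT) (k := k)
      (by omega)
    have hT := comb_vertex_top h (i := 8 * m + 3 - k) (k := k) (by omega) (by omega)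
    have hcf := hfst gR
    have hcf' := hfst gT
    rw [combChain_fst_int] at hcf hcf'
    have haW := hb' a
    have hbW := hb' b
    rw [h5] at haW
    rw [h6] at hbW
    have okfst : ∀ τ : Store, τ 13 0 = k → τ 21 0 = H → τ 22 0 = E → chainFstExpr.Ok W τ ∧
        chainFstExpr.val τ = H + (E - H) * ((k : ℤ) / 2 - 2 * (k / 4)) := by
      intro τ t1 t2 t3
      simp only [chainFstExpr, Ok, val, t1, t2, t3, and_true]
      refine ⟨⟨?_, ?_⟩, ⟨⟨⟨?_, ?_⟩, ⟨?_, ?_⟩, ?_⟩, ⟨⟨⟨?_, ?_⟩, ?_, ?_⟩, ⟨?_, ⟨⟨?_, ?_⟩, ?_, ?_⟩, ?_⟩,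
        ?_⟩, ?_⟩, ?_⟩ <;> omega
    have okhalf : ∀ τ : Store, τ 13 0 = k → halfExpr.Ok W τ ∧
        halfExpr.val τ = ((k + 1) / 2 : ℕ) := by
      intro τ t1
      simp only [halfExpr, Ok, val, t1, hhalf, and_true]
      refine ⟨⟨⟨?_, ?_⟩, ?_, ?_⟩, ?_, ?_⟩ <;> omega
    have okmir : ∀ τ : Store, τ 13 0 = k → τ 20 0 = m → mirrorExpr.Ok W τ ∧
        mirrorExpr.val τ = 8 * m + 3 - k := by
      intro τ t1 t2
      simp only [mirrorExpr, Ok, val, t1, t2, and_true]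
      refine ⟨⟨⟨?_, ⟨?_, ?_⟩, ?_⟩, ?_, ?_⟩, ⟨?_, ?_⟩, ?_⟩ <;> omega
    obtain ⟨u, hu⟩ : ∃ u, u = (k + 1) / 2 := ⟨_, rfl⟩
    rw [← hu] at okhalf
    obtain ⟨x, hx⟩ : ∃ x, x = H + (E - H) * ((k : ℤ) / 2 - 2 * (k / 4)) := ⟨_, rfl⟩
    rw [← hx] at okfst hcf
    have o1 := okfst σ' h1 (by rw [h3, h21]) (by rw [h4, h22])
    refine Runs.assign_seq ?_ o1.1 (by simp [chainFstExpr]) ?_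
    · simp [h1]; omega
    rw [o1.2]
    simp only [val, h1]
    obtain ⟨σ₁, hσ₁⟩ : ∃ τ, τ = σ'.write X (k + 1) x := ⟨_, rfl⟩
    rw [← hσ₁]
    have r1 : ∀ r, r ≠ X → σ₁ r = σ' r := fun r hr => by rw [hσ₁, Store.write_of_ne _ hr]
    have o2 := okhalf σ₁ (by rw [r1 _ (by omega), h1])
    refine Runs.assign_seq ?_ ⟨o2.1, ?_⟩ (by simp [chainFstExpr, halfExpr]) ?_
    · simp [r1 13 (by omega), h1]; omega
    · rw [o2.2, r1 a (by omega), h5]; exact haW _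
    simp only [val, o2.2, r1 13 (by omega), h1, r1 a (by omega), h5]
    obtain ⟨σ₂, hσ₂⟩ : ∃ τ, τ = σ₁.write Y (k + 1) (σ a u) := ⟨_, rfl⟩
    rw [← hσ₂]
    have r2 : ∀ r, r ≠ X → r ≠ Y → σ₂ r = σ' r := fun r hr hr' => by
      rw [hσ₂, Store.write_of_ne _ hr', r1 _ hr]
    have o3 := okhalf σ₂ (by rw [r2 _ (by omega) (by omega), h1])
    have o4 := okmir σ₂ (by rw [r2 _ (by omega) (by omega), h1])
      (by rw [r2 _ (by omega) (by omega), h2, h20])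
    refine Runs.assign_seq o4.1 ⟨o3.1, ?_⟩ (by simp [chainFstExpr, halfExpr, mirrorExpr]) ?_
    · rw [o3.2, r2 b (by omega) (by omega), h6]; exact hbW _
    simp only [val, o3.2, o4.2, r2 b (by omega) (by omega), h6]
    obtain ⟨σ₃, hσ₃⟩ : ∃ τ, τ = σ₂.write X (8 * m + 3 - k) (σ b u) := ⟨_, rfl⟩
    rw [← hσ₃]
    have r3 : ∀ r, r ≠ X → r ≠ Y → σ₃ r = σ' r := fun r hr hr' => by
      rw [hσ₃, Store.write_of_ne _ hr, r2 _ hr hr']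
    have o5 := okfst σ₃ (by rw [r3 _ (by omega) (by omega), h1])
      (by rw [r3 _ (by omega) (by omega), h3, h21]) (by rw [r3 _ (by omega) (by omega), h4, h22])
    have o6 := okmir σ₃ (by rw [r3 _ (by omega) (by omega), h1])
      (by rw [r3 _ (by omega) (by omega), h2, h20])
    refine Runs.assign o6.1 o5.1 (by simp [chainFstExpr, halfExpr, mirrorExpr]) ?_
    rw [o5.2, o6.2]
    have haW' := haW u
    have hbW' := hbW u
    have hXc : (combChain H E gR k).1 = x := by rw [combChain_fst_int, hx]
    have hXc' : (combChain H E gT k).1 = x := by rw [combChain_fst_int, hx]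
    have hYc : (combChain H E gR k).2 = σ a u := by
      rw [haR u (by omega), hu]; rfl
    have hYc' : (combChain H E gT k).2 = σ b u := by
      rw [hbT u (by omega), hu]; rfl
    refine ⟨?_, ?_, ?_, ?_, ?_, ?_, ?_, ?_, ?_, ?_⟩
    · rw [Store.write_of_ne _ (by omega), r3 _ (by omega) (by omega), h1]
    · refine Bounded.write (Bounded.write ?_ (by omega)) (by omega)
      rw [hσ₃, hσ₂, hσ₁]
      exact ((hb'.write (by omega)).write (by omega)).write (by omega)
    · simp
    · simp (disch := omega) only [Store.write_of_ne, r3, h2]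
    · simp (disch := omega) only [Store.write_of_ne, r3, h3]
    · simp (disch := omega) only [Store.write_of_ne, r3, h4]
    · simp (disch := omega) only [Store.write_of_ne, r3, h5]
    · simp (disch := omega) only [Store.write_of_ne, r3, h6]
    · intro i
      rw [Store.write_of_ne _ (by omega), Store.write_of_ne _ hXY, hσ₃, Store.write_self, hσ₂,
        Store.write_of_ne _ hXY, hσ₁, Store.write_self]
      simp only
      by_cases hi : i = 8 * m + 3 - k
      · rw [if_pos hi, if_pos (by push_cast; omega), show i.toNat = 8 * m + 3 - k by omega, hT,
          Prod.fst_swap, hYc']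
      · rw [if_neg hi]
        by_cases hi' : i = k + 1
        · rw [if_pos hi', if_pos (by push_cast; omega), show i.toNat = k + 1 by omega, hR, hXc]
        · rw [if_neg hi', h7]
          refine if_congr ?_ rfl rfl
          push_cast; omega
    · intro i
      rw [Store.write_of_ne _ (by omega), Store.write_self, hσ₃, Store.write_of_ne _ hXY.symm, hσ₂,
        Store.write_self, hσ₁, Store.write_of_ne _ hXY.symm]
      simp only
      by_cases hi : i = 8 * m + 3 - k
      · rw [if_pos hi, if_pos (by push_cast; omega), show i.toNat = 8 * m + 3 - k by omega, hT,
          Prod.snd_swap, hXc']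
      · rw [if_neg hi]
        by_cases hi' : i = k + 1
        · rw [if_pos hi', if_pos (by push_cast; omega), show i.toNat = k + 1 by omega, hR, hYc]
        · rw [if_neg hi', h8]
          refine if_congr ?_ rfl rfl
          push_cast; omega
  · rintro σ' ⟨-, -, -, -, -, -, -, h7, h8⟩
    have hv0 : (comb m H E gR gT).vertex 0 = (0, 0) := by
      rw [comb_vertex (by omega)]; rfl
    -- After `4 * m + 2` rounds the two index ranges cover everything except index 0, where both
    -- coordinates are 0.
    have key : ∀ (f : ℤ × ℤ → ℤ), f (0, 0) = 0 → ∀ i : ℤ,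
        (if (1 ≤ i ∧ i ≤ (4 * m + 2 : ℕ)) ∨
          (8 * m + 3 - (4 * m + 2 : ℕ) < i ∧ i ≤ 8 * m + 3) then
          f ((comb m H E gR gT).vertex i.toNat) else 0) =
        if 0 ≤ i then ((comb m H E gR gT).map f).getD i.toNat 0 else 0 := by
      intro f hf i
      by_cases hi : 0 ≤ i ∧ i ≤ 8 * m + 3
      · have hlt : i.toNat < (comb m H E gR gT).length := by rw [comb_length]; omega
        rw [if_pos hi.1]
        have e : ((comb m H E gR gT).map f).getD i.toNat 0 =
            f ((comb m H E gR gT).vertex i.toNat) := by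
          rw [Polygon.vertex, Nat.mod_eq_of_lt hlt, ← List.getD_map (f := f), hf]
        rw [e]
        by_cases h0 : i = 0
        · rw [if_neg (by omega), h0]
          simp [hv0, hf]
        · rw [if_pos (by push_cast; omega)]
      · rw [if_neg (by push_cast; omega)]
        split_ifs with h0
        · rw [List.getD_eq_default]
          rw [List.length_map, comb_length]; omega
        · rfl
    exact ⟨funext fun i => (h7 i).trans (key Prod.fst rfl i),
      funext fun i => (h8 i).trans (key Prod.snd rfl i)⟩
  · simp; omega

/-- `v * U`, where `7` holds `U`. -/
def scaleExpr (v : ℤ) : Expr := .mul (.const v) (var 7)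

theorem scaleExpr_ok {W U : ℕ} {v : ℤ} {σ : Store} (h7 : σ 7 0 = U) (hU : 1 ≤ U) (h0 : 0 ≤ v)
    (h1 : v ≤ 100000) (hW : 100000 * U + 10 ≤ W) :
    (scaleExpr v).Ok W σ ∧ (scaleExpr v).val σ = v * U ∧ 0 ≤ v * U ∧ v * U + 10 ≤ W := by
  have h2 : 0 ≤ v * U := by positivity
  have h3 : v * U ≤ 100000 * U := mul_le_mul_of_nonneg_right h1 (by positivity)
  simp only [scaleExpr, Ok, val, h7, true_and]
  refine ⟨⟨?_, ⟨?_, ?_⟩, ?_⟩, h2, ?_⟩ <;> omega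

/-- Write the slot sequence `0, v U, v U + 1, w U, w U + 1, 40000 U`. -/
def patternSlots (a : ℕ) (v w : ℤ) : Prog :=
  .seq (.assign a (.const 1) (scaleExpr v))
  (.seq (.assign a (.const 2) (.add (scaleExpr v) (.const 1)))
  (.seq (.assign a (.const 3) (scaleExpr w))
  (.seq (.assign a (.const 4) (.add (scaleExpr w) (.const 1)))
    (.assign a (.const 5) (scaleExpr 40000)))))

theorem patternSlots_runs {W U a : ℕ} {v w : ℤ} {s : ℕ → ℤ} {σ : Store} (h7 : σ 7 0 = U)
    (hU : 1 ≤ U) (hv : 0 ≤ v) (hv' : v ≤ 100000) (hw : 0 ≤ w) (hw' : w ≤ 100000)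
    (hW : 100000 * U + 10 ≤ W) (ha : 14 ≤ a) (ha0 : σ a 0 = 0) (hs0 : s 0 = v * U)
    (hs1 : s 1 = w * U) :
    Runs W (patternSlots a v w) σ 60 fun σ' =>
      ∀ u : ℕ, u ≤ 2 * 2 + 1 → σ' a u = slotSeq 2 1 (40000 * U) s u := by
  have ok : ∀ (τ : Store) (x : ℤ), τ 7 0 = U → 0 ≤ x → x ≤ 100000 →
    (scaleExpr x).Ok W τ ∧ (scaleExpr x).val τ = x * U ∧ 0 ≤ x * U ∧ x * U + 10 ≤ W :=
    fun τ x h h' h'' => scaleExpr_ok h hU h' h'' hW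
  have o1 := ok σ v h7 hv hv'
  refine Runs.assign_seq (by simp; omega) o1.1 (by simp [scaleExpr]) ?_
  simp only [o1.2.1, val]
  have o2 := ok (σ.write a 1 (v * U)) v (by rw [Store.write_of_ne _ (by omega), h7]) hv hv'
  refine Runs.assign_seq (by simp; omega) ⟨o2.1, by simp; omega, ?_⟩ (by simp [scaleExpr]) ?_
  · rw [o2.2.1]; simp; omega
  simp only [o2.2.1, val]
  obtain ⟨τ₂, hτ₂⟩ : ∃ τ, τ = (σ.write a 1 (v * U)).write a 2 (v * U + 1) := ⟨_, rfl⟩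
  rw [← hτ₂]
  have o3 := ok τ₂ w (by simp (disch := omega) only [hτ₂, Store.write_of_ne, h7]) hw hw'
  refine Runs.assign_seq (by simp; omega) o3.1 (by simp [scaleExpr]) ?_
  simp only [o3.2.1, val]
  obtain ⟨τ₃, hτ₃⟩ : ∃ τ, τ = τ₂.write a 3 (w * U) := ⟨_, rfl⟩
  rw [← hτ₃]
  have o4 := ok τ₃ w (by simp (disch := omega) only [hτ₂, hτ₃, Store.write_of_ne, h7]) hw hw'
  refine Runs.assign_seq (by simp; omega) ⟨o4.1, by simp; omega, ?_⟩ (by simp [scaleExpr]) ?_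
  · rw [o4.2.1]; simp; omega
  simp only [o4.2.1, val]
  obtain ⟨τ₄, hτ₄⟩ : ∃ τ, τ = τ₃.write a 4 (w * U + 1) := ⟨_, rfl⟩
  rw [← hτ₄]
  have o5 := ok τ₄ 40000 (by simp (disch := omega) only [hτ₂, hτ₃, hτ₄, Store.write_of_ne, h7])
    (by norm_num) (by norm_num)
  refine Runs.assign (by simp; omega) o5.1 (by simp [scaleExpr]) fun u hu => ?_
  rw [o5.2.1, hτ₄, hτ₃, hτ₂]
  have hu' : u = 0 ∨ u = 1 ∨ u = 2 ∨ u = 3 ∨ u = 4 ∨ u = 5 := by omega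
  rcases hu' with rfl | rfl | rfl | rfl | rfl | rfl <;> simp [slotSeq, ha0, hs0, hs1]

/-- Write the pattern polygon to the arrays `41` and `42`. -/
def patternProg : Prog :=
  .seq (.assign 20 (.const 0) (.const 2))
  (.seq (.assign 21 (.const 0) (scaleExpr 40000))
  (.seq (.assign 22 (.const 0) (scaleExpr 48000))
  (.seq (patternSlots 18 24000 32000)
  (.seq (patternSlots 19 8000 16000)
    (combProg 18 19 41 42)))))

theorem patternProg_runs {W U : ℕ} {σ : Store} (h7 : σ 7 0 = U) (hU : 1 ≤ U)
    (hW : 100000 * U + 40 ≤ W) (hb : Bounded W σ) (h18 : σ 18 0 = 0) (h19 : σ 19 0 = 0)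
    (h41 : σ 41 = 0) (h42 : σ 42 = 0) :
    Runs W patternProg σ 2000 fun σ' =>
      σ' 41 = (fun i => if 0 ≤ i then ((pattern U).map Prod.fst).getD i.toNat 0 else 0) ∧
      σ' 42 = fun i => if 0 ≤ i then ((pattern U).map Prod.snd).getD i.toNat 0 else 0 := by
  refine Runs.assign_seq (by simp) (by simp; omega) (by simp) ?_
  simp only [val]
  have o1 := scaleExpr_ok (v := 40000) (W := W) (σ := σ.write 20 0 2) (by simpa using h7) hU
    (by norm_num) (by norm_num) (by omega)
  refine Runs.assign_seq (by simp) o1.1 (by simp [scaleExpr]) ?_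
  simp only [val, o1.2.1]
  have o2 := scaleExpr_ok (v := 48000) (W := W)
    (σ := (σ.write 20 0 2).write 21 0 (40000 * U)) (by simpa using h7) hU
    (by norm_num) (by norm_num) (by omega)
  refine Runs.assign_seq (by simp) o2.1 (by simp [scaleExpr]) ?_
  simp only [val, o2.2.1]
  have hb0 : Bounded W (((σ.write 20 0 2).write 21 0 (40000 * U)).write 22 0 (48000 * U)) :=
    ((hb.write (by omega)).write (by omega)).write (by omega)
  refine Runs.seq (Runs.frame (by omega) (patternSlots_runs (a := 18) (U := U)
    (s := fun j : ℕ => 24000 * (U : ℤ) + 8000 * U * j) (by simpa using h7) hU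
    (by norm_num) (by norm_num) (by norm_num) (by norm_num) (by omega) (by omega)
    (by simpa using h18) (by simp) (by simp; ring)) hb0) (T₂ := 1900) ?_ (by simp [scaleExpr])
  rintro σ₁ ⟨s1, b1, f1⟩
  refine Runs.seq (Runs.frame (by omega) (patternSlots_runs (a := 19) (U := U)
    (s := fun j : ℕ => 8000 * (U : ℤ) + 8000 * U * j)
    (by rw [f1 7 (by decide)]; simpa using h7) hU
    (by norm_num) (by norm_num) (by norm_num) (by norm_num) (by omega) (by omega)
    (by rw [f1 19 (by decide)]; simpa using h19) (by simp) (by simp; ring)) b1)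
    (T₂ := 1800) ?_ (by simp)
  rintro σ₂ ⟨s2, b2, f2⟩
  refine Runs.mono (combProg_runs (m := 2) (H := 40000 * U) (E := 48000 * U)
    (pattern_isComb (U := U) (by omega)) (by omega) (by omega) (by omega) (by omega) (by omega)
    (by omega) (by omega) b2 ?_ ?_ ?_ ?_ s2 ?_ ?_) (by norm_num)
  · rw [f2 20 (by decide), f1 20 (by decide)]; simp
  · rw [f2 21 (by decide), f1 21 (by decide)]; simp
  · rw [f2 22 (by decide), f1 22 (by decide)]; simp
  · rw [f2 18 (by decide)]; exact s1
  · rw [f2 41 (by decide), f1 41 (by decide)]; simpa using h41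
  · rw [f2 42 (by decide), f1 42 (by decide)]; simpa using h42

/-- Write the container polygon to the arrays `43` and `44`. -/
def containerProg : Prog :=
  .seq (.assign 20 (.const 0) (var 17))
  (.seq (.assign 21 (.const 0) (scaleExpr 40800))
  (.seq (.assign 22 (.const 0) (scaleExpr 48800))
  (.seq (.assign 16 (.add (.add (var 17) (var 17)) (.const 1)) (var 21))
    (combProg 16 16 43 44))))

theorem containerProg_runs {W U c : ℕ} {A : Fin 4 → List ℤ} {s : ℕ → ℤ} {σ : Store}
    (h7 : σ 7 0 = U) (hW : 100000 * U + 10 * c + 40 ≤ W) (hb : Bounded W σ)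
    (hs : SlotValues U A c s) (h17 : σ 17 0 = c) (h0 : σ 16 0 = 0)
    (hodd : ∀ j : ℕ, j < c → σ 16 (2 * j + 1) = s j)
    (heven : ∀ j : ℕ, j < c → σ 16 (2 * j + 2) = s j + 2) (h43 : σ 43 = 0) (h44 : σ 44 = 0) :
    Runs W containerProg σ (600 * c + 400) fun σ' =>
      σ' 43 = (fun i => if 0 ≤ i then ((container U c s).map Prod.fst).getD i.toNat 0 else 0) ∧
      σ' 44 = fun i => if 0 ≤ i then ((container U c s).map Prod.snd).getD i.toNat 0 else 0 := by
  have hU : 1 ≤ U := by exact_mod_cast hs.pos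
  refine Runs.assign_seq (by simp) (by simp [h17]; omega) (by simp) ?_
  simp only [val, h17]
  have o1 := scaleExpr_ok (v := 40800) (W := W) (σ := σ.write 20 0 c) (by simpa using h7) hU
    (by norm_num) (by norm_num) (by omega)
  refine Runs.assign_seq (by simp) o1.1 (by simp [scaleExpr]) ?_
  simp only [val, o1.2.1]
  have o2 := scaleExpr_ok (v := 48800) (W := W)
    (σ := (σ.write 20 0 c).write 21 0 (40800 * U)) (by simpa using h7) hU
    (by norm_num) (by norm_num) (by omega)
  refine Runs.assign_seq (by simp) o2.1 (by simp [scaleExpr]) ?_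
  simp only [val, o2.2.1]
  -- The array left by the removal of repetitions already is the slot sequence, apart from the final
  -- entry `H`.
  refine Runs.assign_seq (by simp [h17]; omega) (by simp; omega) (by simp [scaleExpr]) ?_
  have e : (c : ℤ) + c + 1 = 2 * c + 1 := by ring
  simp only [val, ne_eq, Store.write_of_ne, Store.write_self, Nat.reduceEqDiff, not_false_eq_true,
    h17, if_true, e]
  have hseq : ∀ u : ℕ, u ≤ 2 * c + 1 →
      ((((σ.write 20 0 c).write 21 0 (40800 * U)).write 22 0 (48800 * U)).write 16 (2 * c + 1)
        (40800 * U)) 16 u = slotSeq c 2 (40800 * U) s u := by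
    intro u hu
    simp only [ne_eq, Store.write_of_ne, Store.write_self, Nat.reduceEqDiff, not_false_eq_true]
    by_cases hu1 : u = 2 * c + 1
    · rw [if_pos (by omega), hu1, slotSeq_last]
    rw [if_neg (by omega)]
    rcases Nat.eq_zero_or_pos u with rfl | hu0
    · simpa [slotSeq] using h0
    obtain ⟨j, rfl | rfl⟩ : ∃ j, u = 2 * j + 1 ∨ u = 2 * j + 2 := ⟨(u - 1) / 2, by omega⟩
    · rw [slotSeq_odd (by omega)]; exact_mod_cast hodd j (by omega)
    · rw [slotSeq_even (by omega)]; exact_mod_cast heven j (by omega)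
  refine Runs.mono (combProg_runs (m := c) (H := 40800 * U) (E := 48800 * U)
    (container_isComb hs) (by omega) (by omega) (by omega) (by omega) (by omega)
    (by omega) (by omega) ?_ ?_ ?_ ?_ hseq hseq ?_ ?_) (by simp [scaleExpr])
  · exact (((hb.write (by omega)).write (by omega)).write (by omega)).write (by omega)
  · simp
  · simp
  · simp
  · simpa using h43
  · simpa using h44

/-! ### The reduction from slot positions to the geometric problem -/

/-- From the numbers in the cells `[0, m)` of array `5`, build the input of the geometric
problem in the arrays `40, …, 44`. -/
def buildProg : Prog :=
  .seq sortProg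
  (.seq dedupProg
  (.seq containerProg
  (.seq patternProg
  (.seq (.assign 40 (.const 0) (.const 20))
    (.assign 40 (.const 1) (.add (.mul (.const 8) (var 17)) (.const 4)))))))

theorem buildProg_runs {W U m : ℕ} {A : Fin 4 → List ℤ} {σ : Store} (hU : 1 ≤ U)
    (hW : 100000 * U + 40 * m + 100 ≤ W) (hb : Bounded W σ) (h6 : σ 6 0 = m) (h7 : σ 7 0 = U)
    (hz : ∀ a, 16 ≤ a → σ a = 0) (hA : ∀ j, ∀ a ∈ A j, -(U : ℤ) ≤ a ∧ a ≤ U)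
    (hval : ∀ v, (∃ x, 0 ≤ x ∧ x < (m : ℤ) ∧ σ 5 x = v) ↔ IsSlot U A v) :
    Runs W buildProg σ (Nat.clog 2 m * (300 * m + 50) + 700 * m + 3000) fun σ' =>
      ∃ (c : ℕ) (s : ℕ → ℤ), c ≤ m ∧ SlotValues U A c s ∧
        ∀ a, σ' (a + 40) = load (Instance.input ⟨pattern U, container U c s⟩) a := by
  have hU' : (1 : ℤ) ≤ U := by exact_mod_cast hU
  refine Runs.seq (Runs.frame (by omega) (sortProg_runs (by omega) hb h6) hb)
    (T₂ := 700 * m + 2900) ?_ (by omega)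
  rintro σ₁ ⟨⟨hsort, hsame, h6'⟩, b1, f1⟩
  have hval1 : ∀ v, (∃ x, 0 ≤ x ∧ x < (m : ℤ) ∧ σ₁ 5 x = v) ↔ IsSlot U A v := fun v =>
    (hsame v).symm.trans (hval v)
  have hz1 : ∀ a, 16 ≤ a → σ₁ a = 0 := fun a ha => by
    rw [f1 a, hz a ha]
    intro hmem
    have : ∀ b ∈ sortProg.writes, b < 16 := by decide
    exact absurd (this a hmem) (by omega)
  refine Runs.seq (Runs.frame (by omega) (dedupProg_runs (by omega) b1 h6' (hz1 16 le_rfl) hsort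
    fun x hx hxm => ?_) b1) (T₂ := 640 * m + 2800) ?_ (by omega)
  · have := ((hval1 _).1 ⟨x, hx, hxm, rfl⟩).bounds hU' hA
    constructor <;> omega
  rintro σ₂ ⟨⟨c, h17, hd⟩, b2, f2⟩
  have hz2 : ∀ a, 18 ≤ a → σ₂ a = 0 := fun a ha => by
    rw [f2 a, hz1 a (by omega)]
    intro hmem
    have : ∀ b ∈ dedupProg.writes, b < 18 := by decide
    exact absurd (this a hmem) (by omega)
  have hcm := hd.le
  have hs : SlotValues U A c fun j : ℕ => σ₂ 16 (2 * j + 1) := by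
    refine ⟨hU', hA, fun j hj => hd.lt j hj, fun x => ?_⟩
    rw [hd.mem, hval1]
  have h7₂ : σ₂ 7 0 = U := by rw [f2 7 (by decide), f1 7 (by decide), h7]
  refine Runs.seq (Runs.frame (by omega) (containerProg_runs h7₂ (by omega) b2 hs h17 hd.zero
    (fun j _ => rfl) hd.even (hz2 43 (by omega)) (hz2 44 (by omega))) b2)
    (T₂ := 2300) ?_ (by omega)
  rintro σ₃ ⟨⟨h43, h44⟩, b3, f3⟩
  have hz3 : ∀ a, 18 ≤ a → a ∉ containerProg.writes → σ₃ a = 0 := fun a ha ha' => by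
    rw [f3 a ha', hz2 a ha]
  refine Runs.seq (Runs.frame (by omega) (patternProg_runs (U := U)
    (by rw [f3 7 (by decide), h7₂]) hU (by omega) b3 ?_ ?_ (hz3 41 (by omega) (by decide))
    (hz3 42 (by omega) (by decide))) b3) (T₂ := 200) ?_ (by omega)
  · rw [hz3 18 (by omega) (by decide)]; rfl
  · rw [hz3 19 (by omega) (by decide)]; rfl
  rintro σ₄ ⟨⟨h41, h42⟩, b4, f4⟩
  have h17₄ : σ₄ 17 0 = c := by rw [f4 17 (by decide), f3 17 (by decide), h17]
  refine Runs.assign_seq (by simp) (by simp; omega) (by simp) ?_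
  refine Runs.assign (by simp; omega) (by simp [h17₄]; omega) (by simp)
    ⟨c, _, hcm, hs, fun a => ?_⟩
  simp only [val, ne_eq, Store.write_of_ne, Nat.reduceEqDiff, not_false_eq_true, h17₄]
  have hlenP : (pattern U).length = 20 := comb_length
  have hlenQ : (container U c fun j : ℕ => σ₂ 16 (2 * j + 1)).length = 8 * c + 4 := comb_length
  have h40 : σ₄ 40 = 0 := by rw [f4 40 (by decide), hz3 40 (by omega) (by decide)]
  have h43₄ : σ₄ 43 = σ₃ 43 := f4 43 (by decide)
  have h44₄ : σ₄ 44 = σ₃ 44 := f4 44 (by decide)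
  funext i
  obtain rfl | rfl | rfl | rfl | rfl | ha : a = 0 ∨ a = 1 ∨ a = 2 ∨ a = 3 ∨ a = 4 ∨ 5 ≤ a := by
    omega
  · simp only [zero_add, Store.write_self, h40, load, Instance.input, hlenP, hlenQ]
    by_cases hi0 : i = 0
    · simp [hi0]
    by_cases hi1 : i = 1
    · simp [hi1]
    rw [if_neg hi1, if_neg hi0]
    split_ifs with hi
    · rw [List.getD_cons_zero, List.getD_eq_default]
      · rfl
      · simp; omega
    · rfl
  · simp [h41, load, Instance.input]
  · simp [h42, load, Instance.input]
  · simp [h43₄, h43, load, Instance.input]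
  · simp [h44₄, h44, load, Instance.input]
  -- Arrays from 45 on are never touched, so the shifted store agrees everywhere with a freshly
  -- loaded instance.
  · rw [Store.write_of_ne _ (by omega), Store.write_of_ne _ (by omega), f4, hz3]
    · have he : (Instance.input ⟨pattern U, container U c fun j : ℕ => σ₂ 16 (2 * j + 1)⟩).getD a []
          = [] := List.getD_eq_default _ _ (by simp [Instance.input]; omega)
      simp only [load, he]
      simp
    · omega
    · intro hmem
      have : ∀ b ∈ containerProg.writes, b < 45 := by decide
      exact absurd (this _ hmem) (by omega)
    · intro hmem
      have : ∀ b ∈ patternProg.writes, b < 45 := by decide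
      exact absurd (this _ hmem) (by omega)

/-- Decide a 4SUM instance given in the form of slot positions by an algorithm for the geometric
problem. -/
def reduceProg (lc : Prog) : Prog :=
  .seq buildProg
  (.seq (lc.shift 40)
    (.assign 0 (.const 0) (.sub (.const 1) (.lt (.cell 40 (.const 0)) (.cell 40 (.const 1))))))

theorem reduceProg_runs {W W' U m T : ℕ} {A : Fin 4 → List ℤ} {σ : Store} {lc : Prog}
    (hU : 1 ≤ U) (hW : 100000 * U + 40 * m + 100 ≤ W) (hb : Bounded W σ) (h6 : σ 6 0 = m)
    (h7 : σ 7 0 = U) (hz : ∀ a, 16 ≤ a → σ a = 0)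
    (hA : ∀ j, ∀ a ∈ A j, -(U : ℤ) ≤ a ∧ a ≤ U)
    (hval : ∀ v, (∃ x, 0 ≤ x ∧ x < (m : ℤ) ∧ σ 5 x = v) ↔ IsSlot U A v) (hW' : W' ≤ W)
    (hlc : ∀ (c : ℕ) (s : ℕ → ℤ), c ≤ m → SlotValues U A c s → ∃ t σ',
      Exec W' lc (load (Instance.input ⟨pattern U, container U c s⟩)) t σ' ∧
      Instance.Correct ⟨pattern U, container U c s⟩ σ' ∧ t ≤ T) :
    Runs W (reduceProg lc) σ (Nat.clog 2 m * (300 * m + 50) + 700 * m + 3100 + T)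
      (Decides (∃ a : Fin 4 → ℤ, (∀ j, a j ∈ A j) ∧ ∑ j, a j = 0)) := by
  refine Runs.seq (Runs.frame (by omega) (buildProg_runs hU hW hb h6 h7 hz hA hval) hb)
    (T₂ := T + 20) ?_ (by omega)
  rintro σ₁ ⟨⟨c, s, hcm, hs, hload⟩, b1, -⟩
  obtain ⟨t, τ, hex, hcor, ht⟩ := hlc c s hcm hs
  obtain ⟨σ₂, hex₂, hτ⟩ := (hex.word_mono hW').shift hload
  have b2 := hex₂.bounded (by omega) b1
  refine Runs.seq (T₁ := T) (T₂ := 20) (R := fun σ' => σ' = σ₂) ⟨t, σ₂, hex₂, ht, rfl⟩ ?_ le_rfl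
  intro σ' hσ'
  rw [hσ']
  have e40 : ∀ i, σ₂ 40 i = τ 0 i := fun i => congrFun (hτ 0) i
  have hb40 := b2 40
  obtain ⟨hpos, hlarge⟩ := hcor
  have hiff := one_le_largestScale_iff hs hlarge
  have hpos' : (0 : ℝ) < (τ 0 1 : ℝ) := by exact_mod_cast hpos
  -- The denominator is positive, so the scale is at least 1 iff the numerator is not smaller than
  -- the denominator: a single comparison decides.
  rw [one_le_div hpos', Int.cast_le] at hiff
  refine Runs.assign (by simp) ?_ (by simp) ?_
  · simp only [Ok, val]
    refine ⟨by simp; omega, ⟨⟨by simp, hb40 _⟩, ⟨by simp; omega, hb40 _⟩⟩, ?_⟩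
    split_ifs <;> omega
  · simp only [val, e40]
    by_cases hlt : τ 0 0 < τ 0 1
    · exact Or.inr ⟨fun h => absurd (hiff.2 h) (by omega), by simp [hlt]⟩
    · exact Or.inl ⟨hiff.1 (by omega), by simp [hlt]⟩

/-! ## Sizes and running times -/

theorem maxAbs_le {l : List ℤ} {B : ℕ} (h : ∀ x ∈ l, x.natAbs ≤ B) : maxAbs l ≤ B := by
  induction l with
  | nil => simp [maxAbs]
  | cons a l ih =>
    have h1 := h a (by simp)
    have h2 := ih fun x hx => h x (by simp [hx])
    simp only [maxAbs, List.map_cons, List.foldr_cons] at h2 ⊢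
    omega

theorem natAbs_le_maxAbs {l : List ℤ} {x : ℤ} (hx : x ∈ l) : x.natAbs ≤ maxAbs l := by
  induction l with
  | nil => simp at hx
  | cons a l ih =>
    simp only [maxAbs, List.map_cons, List.foldr_cons] at ih ⊢
    rcases List.mem_cons.1 hx with rfl | h
    · omega
    · have := ih h
      omega

theorem combVertex_bounds {m : ℕ} {H E : ℤ} {gR gT : ℕ → ℤ} (h : IsComb m H E gR gT) {i : ℕ}
    (hi : i < 8 * m + 4) : (combVertex m H E gR gT i).1.natAbs ≤ E.toNat ∧
      (combVertex m H E gR gT i).2.natAbs ≤ E.toNat := by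
  have hH := h.right.pos
  have hE := h.lt
  unfold combVertex
  split_ifs
  · simp
  · have := combChain_bounds h.right h.lt (k := i - 1) (by omega)
    constructor <;> omega
  · have := combChain_bounds h.top h.lt (k := 8 * m + 3 - i) (by omega)
    simp only [Prod.fst_swap, Prod.snd_swap]
    constructor <;> omega

theorem comb_maxCoord_le {m : ℕ} {H E : ℤ} {gR gT : ℕ → ℤ} (h : IsComb m H E gR gT) :
    (comb m H E gR gT).maxCoord ≤ E.toNat := by
  refine max_le (maxAbs_le fun x hx => ?_) (maxAbs_le fun x hx => ?_) <;>
  · simp only [comb, List.mem_map, List.mem_range] at hx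
    obtain ⟨_, ⟨i, hi, rfl⟩, rfl⟩ := hx
    have := combVertex_bounds h hi
    omega

section Instance

variable {U c : ℕ} {A : Fin 4 → List ℤ} {s : ℕ → ℤ}

theorem pattern_length : (pattern U).length = 20 := comb_length

theorem container_length : (container U c s).length = 8 * c + 4 := comb_length

theorem pattern_maxCoord_le (hU : 1 ≤ U) : (pattern U).maxCoord ≤ 48000 * U := by
  have := comb_maxCoord_le (pattern_isComb (U := U) (by omega))
  unfold pattern
  omega

theorem container_maxCoord_le (hs : SlotValues U A c s) :
    (container U c s).maxCoord ≤ 48800 * U := by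
  have := comb_maxCoord_le (container_isComb hs)
  unfold container
  omega

theorem instance_valid (hU : 1 ≤ U) (hs : SlotValues U A c s) :
    Instance.Valid ⟨pattern U, container U c s⟩ :=
  ⟨comb_isSimple (pattern_isComb (by omega)), comb_isOrthogonal (pattern_isComb (by omega)),
    comb_isSimple (container_isComb hs), comb_isOrthogonal (container_isComb hs)⟩

theorem instance_size_le (hU : 1 ≤ U) (hs : SlotValues U A c s) :
    Instance.size ⟨pattern U, container U c s⟩ + 2 ≤ 100000 * U + 8 * c + 30 := by
  have h1 := pattern_maxCoord_le hU
  have h2 := container_maxCoord_le hs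
  simp only [Instance.size, pattern_length, container_length]
  omega

/-- The elements of the first list give distinct slots. This lower bound on the number of vertices
is what makes coordinates of order `n ^ 4` polynomial in `q`. -/
theorem length_le_of_slotValues (hs : SlotValues U A c s) (hnd : (A 0).Nodup) :
    (A 0).length ≤ c := by
  rw [← List.toFinset_card_of_nodup hnd]
  have hinj : Function.Injective fun a : ℤ => 8 * (1020 * (U : ℤ) - a) := fun a b h => by
    simp only at h; omega
  rw [← Finset.card_image_of_injective _ hinj]
  refine (Finset.card_le_card (t := (Finset.range c).image s) fun x hx => ?_).trans
    (Finset.card_image_le.trans (Finset.card_range c).le)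
  obtain ⟨a, ha, rfl⟩ := Finset.mem_image.1 hx
  obtain ⟨j, hj, e⟩ := (hs.mem _).2 (Or.inl ⟨a, List.mem_toFinset.1 ha, rfl⟩)
  exact Finset.mem_image.2 ⟨j, Finset.mem_range.2 hj, e⟩

end Instance

/-- Replacing `ε` by `min ε (1 / 2)` keeps the exponent at least `3 / 2`, so that the `m log m` of
sorting is dominated. -/
theorem largestCopy_weaken {restrict : Instance → Prop} {ε : ℝ}
    (h : LargestCopyInTime restrict (2 - ε)) :
    ∃ (lc : Prog) (c K : ℕ), ∀ I : Instance, I.Valid → restrict I → ∃ (t : ℕ) (σ : Store),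
      Exec ((I.size + 2) ^ c) lc (load I.input) t σ ∧ I.Correct σ ∧
        (t : ℝ) ≤ K * (I.Q.length : ℝ) ^ (2 - min ε (1 / 2)) := by
  obtain ⟨lc, c, K, hlc⟩ := h
  refine ⟨lc, c, K, fun I hI hr => ?_⟩
  obtain ⟨t, σ, h1, h2, h3⟩ := hlc I ⟨hI, hr⟩
  refine ⟨t, σ, h1, h2, h3.trans (mul_le_mul_of_nonneg_left ?_ (by positivity))⟩
  refine Real.rpow_le_rpow_of_exponent_le ?_ (by linarith [min_le_left ε (1 / 2)])
  have := hI.2.2.1.1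
  exact_mod_cast (by omega : 1 ≤ I.Q.length)

theorem reduceProg_runs_of_largestCopy {restrict : Instance → Prop} {lc : Prog} {cw K : ℕ} {e : ℝ}
    (he : 0 ≤ e)
    (hlc : ∀ I : Instance, I.Valid → restrict I → ∃ (t : ℕ) (σ : Store),
      Exec ((I.size + 2) ^ cw) lc (load I.input) t σ ∧ I.Correct σ ∧
        (t : ℝ) ≤ K * (I.Q.length : ℝ) ^ e)
    {W U m : ℕ} {A : Fin 4 → List ℤ} {σ : Store} (hm : 1 ≤ m)
    (hr : ∀ (c : ℕ) (s : ℕ → ℤ), SlotValues U A c s → restrict ⟨pattern U, container U c s⟩)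
    (hU : 1 ≤ U) (hW : 100000 * U + 40 * m + 100 ≤ W)
    (hW' : (100000 * U + 40 * m + 100) ^ cw ≤ W) (hb : Bounded W σ) (h6 : σ 6 0 = m)
    (h7 : σ 7 0 = U) (hz : ∀ a, 16 ≤ a → σ a = 0)
    (hA : ∀ j, ∀ a ∈ A j, -(U : ℤ) ≤ a ∧ a ≤ U)
    (hval : ∀ v, (∃ x, 0 ≤ x ∧ x < (m : ℤ) ∧ σ 5 x = v) ↔ IsSlot U A v) :
    Runs W (reduceProg lc) σ (Nat.clog 2 m * (300 * m + 50) + 700 * m + 3100 +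
        ⌊(K : ℝ) * (12 * m : ℝ) ^ e⌋₊)
      (Decides (∃ a : Fin 4 → ℤ, (∀ j, a j ∈ A j) ∧ ∑ j, a j = 0)) := by
  refine reduceProg_runs hU hW hb h6 h7 hz hA hval hW' fun c s hc hs => ?_
  obtain ⟨t, τ, h1, h2, h3⟩ := hlc _ (instance_valid hU hs) (hr c s hs)
  refine ⟨t, τ, h1.word_mono (Nat.pow_le_pow_left ?_ _), h2, Nat.le_floor (h3.trans ?_)⟩
  · have := instance_size_le hU hs
    omega
  · simp only [container_length]
    refine mul_le_mul_of_nonneg_left (Real.rpow_le_rpow (by positivity) ?_ he) (by positivity)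
    exact_mod_cast (by omega : 8 * c + 4 ≤ 12 * m)

theorem sq_le_four_mul_two_pow (n : ℕ) : n ^ 2 ≤ 4 * 2 ^ n := by
  have h1 : n / 2 + 1 ≤ 2 ^ (n / 2) := Nat.lt_two_pow_self
  have h2 : n ≤ 2 * 2 ^ (n / 2) := by omega
  calc n ^ 2 ≤ (2 * 2 ^ (n / 2)) ^ 2 := Nat.pow_le_pow_left h2 2
    _ = 4 * 2 ^ (n / 2 * 2) := by rw [mul_pow, ← pow_mul]; norm_num
    _ ≤ 4 * 2 ^ n := Nat.mul_le_mul_left 4 (Nat.pow_le_pow_right two_pos (by omega))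

/-- A crude bound that suffices to place `m log m` below `m ^ (3 / 2)`; it comes from `l ^ 2 ≤ 4 * 2
^ l`. -/
theorem clog_le_sqrt {m : ℕ} (hm : 1 ≤ m) : (Nat.clog 2 m : ℝ) ≤ 3 * √m := by
  have hm' : (1 : ℝ) ≤ √m := Real.one_le_sqrt.2 (by exact_mod_cast hm)
  rcases Nat.eq_zero_or_pos (Nat.clog 2 m) with h | h
  · rw [h]; simp
  obtain ⟨l, hl⟩ : ∃ l, Nat.clog 2 m = l + 1 := ⟨Nat.clog 2 m - 1, by omega⟩
  have h1 : 2 ^ l < m := (Nat.lt_clog_iff_pow_lt one_lt_two).1 (by omega)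
  have h2 : l ^ 2 ≤ 4 * m := (sq_le_four_mul_two_pow l).trans (by omega)
  have h3 : (l : ℝ) ≤ 2 * √m := by
    refine abs_le_of_sq_le_sq' ?_ (by positivity) |>.2
    rw [mul_pow, Real.sq_sqrt (by positivity)]
    norm_num
    exact_mod_cast h2
  rw [hl]
  push_cast
  linarith

/-- Here `x` is `n` for 4SUM and `2 ^ (n / 4)` for Subset Sum. With `m ^ e ≤ 256 x ^ e`, the terms
of the reduction contribute `(3 * 350 + 700 + 3100) * 256 ≤ 1280000`, and the algorithm contributes
`144 * 256 ≤ 40000` times `K`. -/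
theorem reduce_time_le {m K : ℕ} {x e : ℝ} (hm : 1 ≤ m) (hmx : (m : ℝ) ≤ 16 * x)
    (he : 3 / 2 ≤ e) (he' : e ≤ 2) :
    ((Nat.clog 2 m * (300 * m + 50) + 700 * m + 3100 + ⌊(K : ℝ) * (12 * m : ℝ) ^ e⌋₊ : ℕ) : ℝ) ≤
      (1280000 + 40000 * K) * x ^ e := by
  have hm' : (1 : ℝ) ≤ m := by exact_mod_cast hm
  have hx0 : 0 < x := by linarith
  have hs : (1 : ℝ) ≤ √m := Real.one_le_sqrt.2 hm'
  have hss : √m * √m = m := Real.mul_self_sqrt (by positivity)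
  have hme : √m * m ≤ (m : ℝ) ^ e := by
    calc √m * m = (m : ℝ) ^ (3 / 2 : ℝ) := by
          rw [Real.sqrt_eq_rpow, ← Real.rpow_add_one (by positivity)]; norm_num
      _ ≤ (m : ℝ) ^ e := Real.rpow_le_rpow_of_exponent_le hm' he
  have hxe : (m : ℝ) ^ e ≤ 256 * x ^ e := by
    calc (m : ℝ) ^ e ≤ (16 * x) ^ e := Real.rpow_le_rpow (by positivity) hmx (by linarith)
      _ = 16 ^ e * x ^ e := Real.mul_rpow (by norm_num) hx0.le
      _ ≤ 16 ^ (2 : ℝ) * x ^ e := mul_le_mul_of_nonneg_right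
          (Real.rpow_le_rpow_of_exponent_le (by norm_num) he') (by positivity)
      _ = 256 * x ^ e := by norm_num
  have hKe : (K : ℝ) * (12 * m : ℝ) ^ e ≤ 40000 * K * x ^ e := by
    have h1 : (12 * m : ℝ) ^ e ≤ 144 * (m : ℝ) ^ e := by
      calc (12 * m : ℝ) ^ e = 12 ^ e * (m : ℝ) ^ e := Real.mul_rpow (by norm_num) (by positivity)
        _ ≤ 12 ^ (2 : ℝ) * (m : ℝ) ^ e := mul_le_mul_of_nonneg_right
          (Real.rpow_le_rpow_of_exponent_le (by norm_num) he') (by positivity)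
        _ = 144 * (m : ℝ) ^ e := by norm_num
    have h2 : (12 * m : ℝ) ^ e ≤ 40000 * x ^ e := by
      have : 0 ≤ x ^ e := by positivity
      linarith
    calc (K : ℝ) * (12 * m : ℝ) ^ e ≤ K * (40000 * x ^ e) :=
          mul_le_mul_of_nonneg_left h2 (by positivity)
      _ = 40000 * K * x ^ e := by ring
  have hfl := (Nat.floor_le (show (0 : ℝ) ≤ (K : ℝ) * (12 * m : ℝ) ^ e by positivity)).trans hKe
  have hcl := clog_le_sqrt hm
  have hsort : (Nat.clog 2 m : ℝ) * (300 * m + 50) ≤ 3 * √m * (350 * m) :=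
    mul_le_mul hcl (by linarith) (by positivity) (by positivity)
  have hmm : (m : ℝ) ≤ √m * m := by nlinarith
  push_cast
  nlinarith

/-! ## Reduction from 4SUM -/

theorem mem_iff_getD {l : List ℤ} {a : ℤ} :
    a ∈ l ↔ ∃ x : ℤ, 0 ≤ x ∧ x < l.length ∧ l.getD x.toNat 0 = a := by
  constructor
  · intro h
    obtain ⟨i, hi, rfl⟩ := List.mem_iff_getElem.1 h
    exact ⟨i, by omega, by omega, by simp [hi]⟩
  · rintro ⟨x, hx, hxl, rfl⟩
    rw [List.getD_eq_getElem _ _ (by omega)]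
    exact List.getElem_mem _

theorem load_bounded {W : ℕ} {input : List (List ℤ)}
    (h : ∀ l ∈ input, ∀ x ∈ l, x.natAbs ≤ W) : Bounded W (load input) := by
  intro a i
  unfold load
  split_ifs
  · rcases lt_or_ge a input.length with ha | ha
    · rw [List.getD_eq_getElem _ _ ha]
      rcases lt_or_ge i.toNat input[a].length with hi | hi
      · rw [List.getD_eq_getElem _ _ hi]
        exact h _ (List.getElem_mem ha) _ (List.getElem_mem hi)
      · rw [List.getD_eq_default _ _ hi]; simp
    · rw [List.getD_eq_default _ _ ha]; simp
  · simp

/-- Fill array `5` with the slot positions; `0` and `7` hold `n` and `U`. -/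
def fourSumFill : Prog :=
  .for 13 (var 0)
    (.seq (.assign 5 (var 13)
        (.mul (.const 8) (.sub (scaleExpr 1020) (.cell 1 (var 13)))))
    (.seq (.assign 5 (.add (var 0) (var 13))
        (.mul (.const 8) (.add (scaleExpr 2022) (.cell 2 (var 13)))))
    (.seq (.assign 5 (.add (.mul (.const 2) (var 0)) (var 13))
        (.mul (.const 8) (.add (scaleExpr 3020) (.cell 3 (var 13)))))
      (.assign 5 (.add (.mul (.const 3) (var 0)) (var 13))
        (.mul (.const 8) (.sub (scaleExpr 4022) (.cell 4 (var 13))))))))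

theorem fourSumFill_runs {W n U : ℕ} {σ : Store} (hW : 100000 * U + 160 * n + 100 ≤ W)
    (h0 : σ 0 0 = n) (h7 : σ 7 0 = U) (hU : 1 ≤ U)
    (hA : ∀ j, 1 ≤ j → j ≤ 4 → ∀ i, -(U : ℤ) ≤ σ j i ∧ σ j i ≤ U) :
    Runs W fourSumFill σ (120 * n + 10) fun σ' => ∀ x : ℤ, 0 ≤ x → x < n →
      σ' 5 x = 8 * (1020 * U - σ 1 x) ∧ σ' 5 (n + x) = 8 * (2022 * U + σ 2 x) ∧
      σ' 5 (2 * n + x) = 8 * (3020 * U + σ 3 x) ∧ σ' 5 (3 * n + x) = 8 * (4022 * U - σ 4 x) := by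
  refine Runs.for (N := n) (Tb := 100) (fun k σ' => σ' 13 0 = k ∧
    (∀ a, a ≠ 5 → a ≠ 13 → σ' a = σ a) ∧ ∀ x : ℤ, 0 ≤ x → x < k →
      σ' 5 x = 8 * (1020 * U - σ 1 x) ∧ σ' 5 (n + x) = 8 * (2022 * U + σ 2 x) ∧
      σ' 5 (2 * n + x) = 8 * (3020 * U + σ 3 x) ∧ σ' 5 (3 * n + x) = 8 * (4022 * U - σ 4 x))
    (by omega) ?_ ?_ ?_ ?_ ?_
  · refine ⟨by simp, fun a ha ha' => by simp [ha'], fun x hx hxk => ?_⟩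
    push_cast at hxk; omega
  · rintro k hk σ' ⟨h1, h2, -⟩
    have := h2 0 (by decide) (by decide)
    refine ⟨h1, ?_, ?_⟩
    · simp [this, h0]; omega
    · simp [this, h0]
  · rintro k hk σ' ⟨h1, h2, h3⟩
    have r0 := h2 0 (by decide) (by decide)
    have r1 := h2 1 (by decide) (by decide)
    have r2 := h2 2 (by decide) (by decide)
    have r3 := h2 3 (by decide) (by decide)
    have r4 := h2 4 (by decide) (by decide)
    have r7 := h2 7 (by decide) (by decide)
    have a1 := hA 1 (by norm_num) (by norm_num) k
    have a2 := hA 2 (by norm_num) (by norm_num) k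
    have a3 := hA 3 (by norm_num) (by norm_num) k
    have a4 := hA 4 (by norm_num) (by norm_num) k
    refine Runs.assign_seq ?_ ?_ (by simp [scaleExpr]) ?_
    · simp [h1]; omega
    · simp [scaleExpr, h1, r1, r7, h7]; omega
    refine Runs.assign_seq ?_ ?_ (by simp [scaleExpr]) ?_
    · simp [h1, r0, h0]; omega
    · simp [scaleExpr, h1, r2, r7, h7]; omega
    refine Runs.assign_seq ?_ ?_ (by simp [scaleExpr]) ?_
    · simp [h1, r0, h0]; omega
    · simp [scaleExpr, h1, r3, r7, h7]; omega
    refine Runs.assign ?_ ?_ (by simp [scaleExpr]) ?_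
    · simp [h1, r0, h0]; omega
    · simp [scaleExpr, h1, r4, r7, h7]; omega
    simp only [val, scaleExpr, ne_eq, Store.write_of_ne, Nat.reduceEqDiff, not_false_eq_true, h1,
      r0, h0, r1, r2, r3, r4, r7, h7, Store.write_self, OfNat.zero_ne_ofNat]
    refine ⟨trivial, by simp, fun a ha ha' => ?_, fun x hx hxk => ?_⟩
    · simp [ha, ha', h2]
    · push_cast at hxk
      by_cases hxe : x = k
      · subst hxe
        refine ⟨?_, ?_, ?_, ?_⟩ <;> split_ifs <;> first | rfl | omega
      · have := h3 x hx (by omega)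
        refine ⟨?_, ?_, ?_, ?_⟩ <;> split_ifs <;> first | omega
  · rintro σ' ⟨-, -, h⟩
    exact h
  · simp; omega

def fourSumProg (lc : Prog) : Prog :=
  .seq (.assign 7 (.const 0) (.mul (.mul (var 0) (var 0)) (.mul (var 0) (var 0))))
  (.seq (.assign 6 (.const 0) (.mul (.const 4) (var 0)))
  (.seq fourSumFill (reduceProg lc)))

theorem fourSum_pow_bound {n c : ℕ} (hn : 1 ≤ n) :
    100000 * n ^ 4 + 40 * (4 * n) + 100 ≤ (n + 2) ^ (15 * (c + 1)) ∧
      (100000 * n ^ 4 + 40 * (4 * n) + 100) ^ c ≤ (n + 2) ^ (15 * (c + 1)) := by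
  have h1 : n ≤ n ^ 4 := Nat.le_self_pow (by norm_num) n
  have h2 : 1 ≤ n ^ 4 := Nat.one_le_pow _ _ hn
  have h3 : 100000 * n ^ 4 + 40 * (4 * n) + 100 ≤ (n + 2) ^ 15 := by
    -- As `n` and `1` are at most `n ^ 4`, the coefficients add up to less than `3 ^ 11`, and `3 ≤ n
    -- + 2`.
    calc 100000 * n ^ 4 + 40 * (4 * n) + 100 ≤ 3 ^ 11 * n ^ 4 := by omega
      _ ≤ (n + 2) ^ 11 * (n + 2) ^ 4 :=
        Nat.mul_le_mul (Nat.pow_le_pow_left (by omega) _) (Nat.pow_le_pow_left (by omega) _)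
      _ = (n + 2) ^ 15 := by rw [← pow_add]
  refine ⟨h3.trans (Nat.pow_le_pow_right (by omega) (by omega)), ?_⟩
  calc _ ≤ ((n + 2) ^ 15) ^ c := Nat.pow_le_pow_left h3 c
    _ = (n + 2) ^ (15 * c) := by rw [← pow_mul]
    _ ≤ _ := Nat.pow_le_pow_right (by omega) (by omega)

theorem fourSumProg_runs {lc : Prog} {cw K : ℕ} {e : ℝ} (he : 0 ≤ e)
    (hlc : ∀ I : Instance, I.Valid → (I.P.length ≤ 20 ∧ I.P.maxCoord ≤ I.Q.length ^ 9 ∧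
      I.Q.maxCoord ≤ I.Q.length ^ 9) → ∃ (t : ℕ) (σ : Store),
      Exec ((I.size + 2) ^ cw) lc (load I.input) t σ ∧ I.Correct σ ∧
        (t : ℝ) ≤ K * (I.Q.length : ℝ) ^ e)
    {I : FourSum} (hI : I.Valid) :
    Runs ((I.n + 2) ^ (15 * (cw + 1))) (fourSumProg lc) (load I.input)
      (Nat.clog 2 (4 * I.n) * (300 * (4 * I.n) + 50) + 700 * (4 * I.n) + 3100 +
        ⌊(K : ℝ) * (12 * (4 * I.n : ℕ) : ℝ) ^ e⌋₊ + (120 * I.n + 50)) (Decides I.Yes) := by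
  obtain ⟨hn, hA⟩ := hI
  obtain ⟨n, A⟩ := I
  simp only at hn hA ⊢
  obtain ⟨hW1, hW2⟩ := fourSum_pow_bound (c := cw) hn
  set W := (n + 2) ^ (15 * (cw + 1))
  obtain ⟨U, hU⟩ : ∃ U, U = n ^ 4 := ⟨_, rfl⟩
  simp only [← hU] at hW1 hW2 hA
  have hnU : n ≤ U := by rw [hU]; exact Nat.le_self_pow (by norm_num) n
  have hU1 : 1 ≤ U := hn.trans hnU
  have hAb : ∀ j, ∀ a ∈ A j, -(U : ℤ) ≤ a ∧ a ≤ U := fun j a ha => by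
    have := (hA j).2.2 a ha
    omega
  have hb : Bounded W (load (FourSum.input ⟨n, A⟩)) := by
    refine load_bounded fun l hl x hx => ?_
    simp only [FourSum.input, List.mem_cons, List.not_mem_nil, or_false] at hl
    rcases hl with rfl | rfl | rfl | rfl | rfl
    · simp only [List.mem_singleton] at hx
      omega
    all_goals have := hAb _ x hx; omega
  have hl0 : load (FourSum.input ⟨n, A⟩) 0 0 = n := rfl
  have hlA : ∀ (a : ℕ) (j : Fin 4), (a = 1 ∧ j = 0 ∨ a = 2 ∧ j = 1 ∨ a = 3 ∧ j = 2 ∨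
      a = 4 ∧ j = 3) → ∀ i : ℤ, load (FourSum.input ⟨n, A⟩) a i =
        if 0 ≤ i then (A j).getD i.toNat 0 else 0 := by
    rintro a j (⟨rfl, rfl⟩ | ⟨rfl, rfl⟩ | ⟨rfl, rfl⟩ | ⟨rfl, rfl⟩) i <;> rfl
  have hlAb : ∀ a, 1 ≤ a → a ≤ 4 → ∀ i, -(U : ℤ) ≤ load (FourSum.input ⟨n, A⟩) a i ∧
      load (FourSum.input ⟨n, A⟩) a i ≤ U := by
    intro a h1 h4 i
    have key : ∀ j : Fin 4, -(U : ℤ) ≤ (if 0 ≤ i then (A j).getD i.toNat 0 else 0) ∧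
        (if 0 ≤ i then (A j).getD i.toNat 0 else 0) ≤ (U : ℤ) := by
      intro j
      split_ifs
      · rcases lt_or_ge i.toNat (A j).length with hi | hi
        · rw [List.getD_eq_getElem _ _ hi]
          exact hAb j _ (List.getElem_mem hi)
        · rw [List.getD_eq_default _ _ hi]; omega
      · omega
    obtain rfl | rfl | rfl | rfl : a = 1 ∨ a = 2 ∨ a = 3 ∨ a = 4 := by omega
    · exact key 0
    · exact key 1
    · exact key 2
    · exact key 3
  have hlz : ∀ a, 5 ≤ a → load (FourSum.input ⟨n, A⟩) a = 0 := by
    intro a ha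
    funext i
    have he' : (FourSum.input ⟨n, A⟩).getD a [] = [] :=
      List.getD_eq_default _ _ (by simp [FourSum.input]; omega)
    simp only [load, he']
    simp
  obtain ⟨σ, hσ⟩ : ∃ σ, σ = load (FourSum.input ⟨n, A⟩) := ⟨_, rfl⟩
  rw [← hσ] at hb hl0 hlA hlAb hlz ⊢
  have hnn : (n : ℤ) * n * (n * n) = U := by rw [hU]; push_cast; ring
  have hnn2 : n * n ≤ U := by
    calc n * n = n * n * 1 := by ring
      _ ≤ n * n * (n * n) := Nat.mul_le_mul_left _ (Nat.one_le_iff_ne_zero.2 (by positivity))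
      _ = U := by rw [hU]; ring
  have hnn3 : (n : ℤ) * n ≤ U := by exact_mod_cast hnn2
  have hnn4 : 0 ≤ (n : ℤ) * n := by positivity
  refine Runs.assign_seq (by simp) ?_ (by simp; omega) ?_
  · simp only [Ok, val, hl0, hnn]
    simp
    omega
  simp only [val, hl0, hnn]
  refine Runs.assign_seq (by simp) ?_ (by simp; omega) ?_
  · simp [hl0]; omega
  simp only [val, ne_eq, Store.write_of_ne, OfNat.zero_ne_ofNat, not_false_eq_true, hl0]
  have hb1 : Bounded W ((σ.write 7 0 U).write 6 0 (4 * n)) :=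
    (hb.write (by omega)).write (by omega)
  refine Runs.seq (Runs.frame (by omega) (fourSumFill_runs (n := n) (U := U) (by omega)
    (by simp [hl0]) (by simp) hU1 ?_) hb1)
    (T₂ := Nat.clog 2 (4 * n) * (300 * (4 * n) + 50) + 700 * (4 * n) + 3100 +
        ⌊(K : ℝ) * (12 * (4 * n : ℕ) : ℝ) ^ e⌋₊) ?_ (by simp; omega)
  · intro j h1 h4 i
    simpa (disch := omega) only [Store.write_of_ne] using hlAb j h1 h4 i
  rintro σ₁ ⟨hfill, b1, f1⟩
  have g6 := f1 6 (by decide)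
  have g7 := f1 7 (by decide)
  refine reduceProg_runs_of_largestCopy (A := A) he hlc (by omega) ?_ hU1 hW1 hW2 b1 (by simp [g6])
    (by simp [g7]) ?_ hAb ?_
  · intro c s hs
    have hc := length_le_of_slotValues hs (hA 0).2.1
    rw [(hA 0).1] at hc
    have hq : 48800 * U ≤ (8 * c + 4) ^ 9 := by
      have h12 : 8 * 1 + 4 ≤ 8 * c + 4 := by omega
      -- The container has at least 12 vertices and at least `n`: five factors `q` absorb the
      -- constant, four absorb `n ^ 4`. This is the exponent 9.
      calc 48800 * U ≤ 12 ^ 5 * n ^ 4 := by omega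
        _ ≤ (8 * c + 4) ^ 5 * (8 * c + 4) ^ 4 :=
          Nat.mul_le_mul (Nat.pow_le_pow_left (by omega) _) (Nat.pow_le_pow_left (by omega) _)
        _ = (8 * c + 4) ^ 9 := by rw [← pow_add]
    refine ⟨pattern_length.le, ?_, ?_⟩
    · have := pattern_maxCoord_le hU1
      simp only [container_length]
      omega
    · have := container_maxCoord_le hs
      simp only [container_length]
      omega
  · intro a ha
    rw [f1 a (by
      intro hmem
      have : ∀ b ∈ fourSumFill.writes, b < 16 := by decide
      exact absurd (this a hmem) (by omega))]
    simpa (disch := omega) only [Store.write_of_ne] using hlz a (by omega)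
  · intro v
    simp (disch := omega) only [Store.write_of_ne] at hfill
    have hmem : ∀ (a : ℕ) (j : Fin 4), (a = 1 ∧ j = 0 ∨ a = 2 ∧ j = 1 ∨ a = 3 ∧ j = 2 ∨
        a = 4 ∧ j = 3) → ∀ y, y ∈ A j ↔ ∃ x : ℤ, 0 ≤ x ∧ x < n ∧ σ a x = y := by
      intro a j haj y
      rw [mem_iff_getD, (hA j).1]
      refine exists_congr fun x => and_congr_right fun hx => ?_
      rw [hlA a j haj, if_pos hx]
    have m1 := hmem 1 0 (by simp)
    have m2 := hmem 2 1 (by simp)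
    have m3 := hmem 3 2 (by simp)
    have m4 := hmem 4 3 (by simp)
    unfold IsSlot
    constructor
    · rintro ⟨x, hx, hxm, rfl⟩
      push_cast at hxm
      by_cases c1 : x < n
      · exact Or.inl ⟨_, (m1 _).2 ⟨x, hx, c1, rfl⟩, (hfill x hx c1).1⟩
      by_cases c2 : x < 2 * n
      · refine Or.inr (Or.inl ⟨_, (m2 _).2 ⟨x - n, by omega, by omega, rfl⟩, ?_⟩)
        have := (hfill (x - n) (by omega) (by omega)).2.1
        rwa [show (n : ℤ) + (x - n) = x by ring] at this
      by_cases c3 : x < 3 * n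
      · refine Or.inr (Or.inr (Or.inl ⟨_, (m3 _).2 ⟨x - 2 * n, by omega, by omega, rfl⟩, ?_⟩))
        have := (hfill (x - 2 * n) (by omega) (by omega)).2.2.1
        rwa [show 2 * (n : ℤ) + (x - 2 * n) = x by ring] at this
      · refine Or.inr (Or.inr (Or.inr ⟨_, (m4 _).2 ⟨x - 3 * n, by omega, by omega, rfl⟩, ?_⟩))
        have := (hfill (x - 3 * n) (by omega) (by omega)).2.2.2
        rwa [show 3 * (n : ℤ) + (x - 3 * n) = x by ring] at this
    · rintro (⟨a, ha, rfl⟩ | ⟨a, ha, rfl⟩ | ⟨a, ha, rfl⟩ | ⟨a, ha, rfl⟩)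
      · obtain ⟨x, hx, hxn, rfl⟩ := (m1 _).1 ha
        exact ⟨x, hx, by push_cast; omega, (hfill x hx hxn).1⟩
      · obtain ⟨x, hx, hxn, rfl⟩ := (m2 _).1 ha
        exact ⟨n + x, by omega, by push_cast; omega, (hfill x hx hxn).2.1⟩
      · obtain ⟨x, hx, hxn, rfl⟩ := (m3 _).1 ha
        exact ⟨2 * n + x, by omega, by push_cast; omega, (hfill x hx hxn).2.2.1⟩
      · obtain ⟨x, hx, hxn, rfl⟩ := (m4 _).1 ha
        exact ⟨3 * n + x, by omega, by push_cast; omega, (hfill x hx hxn).2.2.2⟩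

theorem largestCopy_hard_of_fourSum (h : FourSumHypothesis) {ε : ℝ} (hε : 0 < ε) :
    ¬ LargestCopyInTime (fun I => I.P.length ≤ 20 ∧ I.P.maxCoord ≤ I.Q.length ^ 9 ∧
      I.Q.maxCoord ≤ I.Q.length ^ 9) (2 - ε) := by
  intro hlc
  obtain ⟨lc, cw, K, hlc⟩ := largestCopy_weaken hlc
  have hδ : 0 < min ε (1 / 2) := lt_min hε (by norm_num)
  have hδ' : min ε (1 / 2) ≤ 1 / 2 := min_le_right _ _
  refine h _ hδ ⟨fourSumProg lc, 15 * (cw + 1), 1280000 + 40000 * K + 170, fun I hI => ?_⟩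
  obtain ⟨t, σ, h1, h2, h3⟩ := fourSumProg_runs (by linarith) hlc hI
  refine ⟨t, σ, h1, h3, ?_⟩
  have hn : (1 : ℝ) ≤ I.n := by exact_mod_cast hI.1
  have hT := reduce_time_le (m := 4 * I.n) (K := K) (x := I.n) (e := 2 - min ε (1 / 2))
    (by have := hI.1; omega) (by push_cast; linarith) (by linarith) (by linarith)
  have h4 : (t : ℝ) ≤ ((_ : ℕ) : ℝ) := Nat.cast_le.2 h2
  rw [Nat.cast_add] at h4
  refine h4.trans ((add_le_add_left hT _).trans ?_)
  have h5 : (I.n : ℝ) ≤ (I.n : ℝ) ^ (2 - min ε (1 / 2)) := by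
    conv_lhs => rw [← Real.rpow_one (I.n : ℝ)]
    exact Real.rpow_le_rpow_of_exponent_le hn (by linarith)
  push_cast
  nlinarith

/-! ## Reduction from Subset Sum -/

/-- Sum of the squares. -/
def sqSum (l : List ℤ) : ℤ := (l.map fun x => x * x).sum

theorem sqSum_nonneg (l : List ℤ) : 0 ≤ sqSum l := by
  refine List.sum_nonneg fun y hy => ?_
  obtain ⟨x, -, rfl⟩ := List.mem_map.1 hy
  exact mul_self_nonneg x

theorem sqSum_append (l l' : List ℤ) : sqSum (l ++ l') = sqSum l + sqSum l' := by
  simp [sqSum]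

theorem abs_le_mul_self (x : ℤ) : |x| ≤ x * x := by
  rw [← abs_mul_abs_self x]
  rcases (abs_nonneg x).eq_or_lt with h | h
  · rw [← h]; simp
  · nlinarith

/-- Integers satisfy `|x| ≤ x * x`, so the sum of squares bounds all subset sums. It is computed
without absolute values and is polynomial in the size parameter. -/
theorem abs_sum_le_sqSum {s l : List ℤ} (h : s.Sublist l) : |s.sum| ≤ sqSum l := by
  induction h with
  | slnil => simp [sqSum]
  | @cons s l a _ ih =>
    have : sqSum (a :: l) = a * a + sqSum l := by simp [sqSum]
    have := mul_self_nonneg a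
    linarith
  | @cons_cons s l a _ ih =>
    have : sqSum (a :: l) = a * a + sqSum l := by simp [sqSum]
    have := abs_le_mul_self a
    have := abs_add_le a s.sum
    rw [List.sum_cons]
    linarith

theorem sqSum_le {l : List ℤ} {M : ℕ} (h : ∀ x ∈ l, x.natAbs ≤ M) :
    sqSum l ≤ l.length * (M * M) := by
  have := List.sum_le_card_nsmul (l.map fun x : ℤ => x * x) ((M : ℤ) * M) fun y hy => by
    obtain ⟨x, hx, rfl⟩ := List.mem_map.1 hy
    have := h x hx
    rw [← Int.natAbs_mul_self]
    exact_mod_cast Nat.mul_le_mul this this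
  simpa [sqSum] using this

/-- `7` becomes one plus the sum of the squares of the items and the target. -/
def sqSumProg : Prog :=
  .seq (.assign 7 (.const 0) (.add (.const 1) (.mul (.cell 0 (.const 1)) (.cell 0 (.const 1)))))
    (.for 13 (var 0)
      (.assign 7 (.const 0) (.add (var 7) (.mul (.cell 1 (var 13)) (.cell 1 (var 13))))))

theorem sqSumProg_runs {W : ℕ} {σ : Store} {l : List ℤ} {t : ℤ} (h0 : σ 0 0 = l.length)
    (h1 : σ 0 1 = t) (hl : ∀ i < l.length, σ 1 i = l.getD i 0)
    (hW : 1 + t * t + sqSum l ≤ W) (hn : l.length + 1 ≤ W) :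
    Runs W sqSumProg σ (40 * l.length + 40) fun σ' => σ' 7 0 = 1 + t * t + sqSum l := by
  have ht := abs_le_mul_self t
  have ht0 := abs_nonneg t
  have ht1 := le_abs_self t
  have ht2 := neg_abs_le t
  have hl0 := sqSum_nonneg l
  refine Runs.assign_seq (by simp) ?_ (by simp) ?_
  · simp only [Ok, val, h1]
    refine ⟨?_, ⟨⟨?_, ?_⟩, ⟨?_, ?_⟩, ?_⟩, ?_⟩ <;> omega
  refine Runs.for (N := l.length) (Tb := 16) (fun k σ' => σ' 13 0 = k ∧ σ' 0 = σ 0 ∧ σ' 1 = σ 1 ∧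
    σ' 7 0 = 1 + t * t + sqSum (l.take k)) hn ?_ ?_ ?_ ?_ ?_
  · simp [h1, sqSum]
  · rintro k hk σ' ⟨h2, h3, -⟩
    refine ⟨h2, ?_, ?_⟩
    · simp [h3, h0]; omega
    · simp [h3, h0]
  · rintro k hk σ' ⟨h2, h3, h4, h5⟩
    have e1 : sqSum (l.take (k + 1)) = sqSum (l.take k) + l.getD k 0 * l.getD k 0 := by
      rw [List.take_succ_eq_append_getElem hk, sqSum_append, List.getD_eq_getElem _ _ hk]
      simp [sqSum]
    have e2 : sqSum (l.take (k + 1)) ≤ sqSum l := by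
      conv_rhs => rw [← List.take_append_drop (k + 1) l, sqSum_append]
      have := sqSum_nonneg (l.drop (k + 1))
      omega
    have e3 := sqSum_nonneg (l.take k)
    have e4 := hl k hk
    generalize l.getD k 0 = y at *
    have hy := abs_le_mul_self y
    have hy0 := abs_nonneg y
    have hy1 := le_abs_self y
    have hy2 := neg_abs_le y
    refine Runs.assign (by simp) ?_ (by simp) ?_
    · simp only [Ok, val, h2, h4, h5, e4]
      refine ⟨⟨?_, ?_⟩, ⟨⟨⟨?_, ?_⟩, ?_⟩, ⟨⟨?_, ?_⟩, ?_⟩, ?_⟩, ?_⟩ <;> omega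
    · simp [h2, h3, h4, h5, e4, e1]
      ring
  · rintro σ' ⟨-, -, -, h⟩
    rw [h, List.take_length]
  · simp; omega

/-! ### Enumerating the subset sums of a part -/

/-- Appends the values of the cells `[m, m + r)` of array `5`, shifted, with `8, 9` holding `m, r`
and `6` holding `m + r`. -/
def copyShift : Prog :=
  .for 13 (var 9) (.assign 5 (.add (var 6) (var 13))
    (.add (.cell 5 (.add (var 8) (var 13))) (.mul (var 15) (.cell 1 (.add (var 11) (var 14))))))

theorem copyShift_runs {W m r : ℕ} {c y z : ℤ} {σ : Store} (h6 : σ 6 0 = m + r) (h8 : σ 8 0 = m)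
    (h9 : σ 9 0 = r) (h15 : σ 15 0 = c) (hz : σ 11 0 + σ 14 0 = z) (hz' : z.natAbs ≤ W)
    (hz1 : (σ 11 0).natAbs ≤ W) (hz2 : (σ 14 0).natAbs ≤ W) (hy : σ 1 z = y)
    (hW : m + 2 * r + 1 ≤ W) (hc : c.natAbs ≤ W) (hyW : y.natAbs ≤ W) (hcy : (c * y).natAbs ≤ W)
    (hV : ∀ x : ℤ, m ≤ x → x < m + r → (σ 5 x).natAbs ≤ W ∧ (σ 5 x + c * y).natAbs ≤ W) :
    Runs W copyShift σ (34 * r + 9) fun σ' =>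
      (∀ a, a ≠ 5 → a ≠ 13 → σ' a = σ a) ∧
      ∀ x, σ' 5 x = if m + r ≤ x ∧ x < m + 2 * r then σ 5 (x - r) + c * y else σ 5 x := by
  refine Runs.for (N := r) (Tb := 22) (fun k σ' => σ' 13 0 = k ∧
    (∀ a, a ≠ 5 → a ≠ 13 → σ' a = σ a) ∧
      ∀ x, σ' 5 x = if m + r ≤ x ∧ x < m + r + k then σ 5 (x - r) + c * y else σ 5 x)
    (by omega) ?_ ?_ ?_ ?_ ?_
  · refine ⟨by simp, fun a ha ha' => by simp [ha'], fun x => ?_⟩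
    rw [if_neg (by push_cast; omega)]
    simp
  · rintro k hk σ' ⟨h1, h2, -⟩
    have := h2 9 (by decide) (by decide)
    refine ⟨h1, ?_, ?_⟩
    · simp [this, h9]; omega
    · simp [this, h9]
  · rintro k hk σ' ⟨h1, h2, h3⟩
    have r1 := h2 1 (by decide) (by decide)
    have r6 := h2 6 (by decide) (by decide)
    have r8 := h2 8 (by decide) (by decide)
    have r11 := h2 11 (by decide) (by decide)
    have r14 := h2 14 (by decide) (by decide)
    have r15 := h2 15 (by decide) (by decide)
    have hv := h3 (m + k)
    rw [if_neg (by omega)] at hv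
    have hb := hV (m + k) (by omega) (by omega)
    refine Runs.assign ?_ ?_ (by simp) ?_
    · simp only [Ok, val, r6, h6, h1]
      refine ⟨⟨?_, ?_⟩, ⟨?_, ?_⟩, ?_⟩ <;> omega
    · simp only [Ok, val, r1, r8, r11, r14, r15, h8, h15, h1, hz, hy, hv]
      refine ⟨⟨⟨⟨?_, ?_⟩, ⟨?_, ?_⟩, ?_⟩, hb.1⟩, ⟨⟨?_, hc⟩, ⟨⟨⟨?_, hz1⟩, ⟨?_, hz2⟩, hz'⟩, hyW⟩, hcy⟩,
        hb.2⟩ <;> omega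
    · simp only [val, r1, r6, r8, r11, r14, r15, h6, h8, h15, h1, hz, hy, hv]
      refine ⟨by simp [h1], by simp, fun a ha ha' => by simp [ha, ha', h2], fun x => ?_⟩
      rw [Store.write_of_ne _ (by decide), Store.write_self]
      simp only [h3]
      by_cases hx : x = m + r + k
      · subst hx
        rw [if_pos rfl, if_pos (by push_cast; omega)]
        congr 2
        ring
      · rw [if_neg hx]
        push_cast
        split_ifs <;> first | rfl | omega
  · rintro σ' ⟨-, h, h'⟩
    refine ⟨h, fun x => ?_⟩
    rw [h']
    congr 1
    rw [two_mul, add_assoc]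
  · simp; omega

/-- Appends to array `5` (of length `6`) the numbers `init + c * s`, `s` a sum of some of the items
`start, …, start + len - 1`; the numbers `init, start, len, c` are in `10, 11, 12, 15`. -/
def appendSums : Prog :=
  .seq (.assign 5 (var 6) (var 10))
  (.seq (.assign 8 (.const 0) (var 6))
  (.seq (.assign 6 (.const 0) (.add (var 6) (.const 1)))
  (.for 14 (var 12)
    (.seq (.assign 9 (.const 0) (.sub (var 6) (var 8)))
    (.seq copyShift
      (.assign 6 (.const 0) (.add (var 6) (var 9))))))))

theorem exists_sublist_concat {l : List ℤ} {y : ℤ} {P : ℤ → Prop} :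
    (∃ s : List ℤ, s.Sublist (l ++ [y]) ∧ P s.sum) ↔
      (∃ s : List ℤ, s.Sublist l ∧ P s.sum) ∨ ∃ s : List ℤ, s.Sublist l ∧ P (s.sum + y) := by
  constructor
  · rintro ⟨s, hs, hP⟩
    obtain ⟨s₁, s₂, rfl, h1, h2⟩ := List.sublist_append_iff.1 hs
    rcases List.sublist_singleton.1 h2 with rfl | rfl
    · exact Or.inl ⟨s₁, h1, by simpa using hP⟩
    · exact Or.inr ⟨s₁, h1, by simpa using hP⟩
  · rintro (⟨s, hs, hP⟩ | ⟨s, hs, hP⟩)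
    · exact ⟨s, hs.trans (List.sublist_append_left _ _), hP⟩
    · exact ⟨s ++ [y], hs.append (List.Sublist.refl _), by simpa using hP⟩

/-- Doubling: after `k` items the appended block has `2 ^ k` cells, and item `y` appends a copy of
it shifted by `c * y`. Charging every round for the final length costs a factor `l.length`, no more
than sorting does. -/
theorem appendSums_runs {W m start : ℕ} {init c : ℤ} {l : List ℤ} {σ : Store} (h6 : σ 6 0 = m)
    (h10 : σ 10 0 = init) (h11 : σ 11 0 = start) (h12 : σ 12 0 = l.length) (h15 : σ 15 0 = c)
    (hl : ∀ i < l.length, σ 1 (start + i) = l.getD i 0) (hW : m + 2 ^ l.length + 1 ≤ W)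
    (hs : start + l.length + 1 ≤ W) (hc : c.natAbs ≤ W)
    (hy : ∀ y ∈ l, y.natAbs ≤ W ∧ (c * y).natAbs ≤ W)
    (hV : ∀ s : List ℤ, s.Sublist l → (init + c * s.sum).natAbs ≤ W) :
    Runs W appendSums σ (l.length * (34 * 2 ^ l.length + 35) + 40) fun σ' =>
      σ' 6 0 = m + 2 ^ l.length ∧ (∀ x < (m : ℤ), σ' 5 x = σ 5 x) ∧
      ∀ v, (∃ x : ℤ, m ≤ x ∧ x < m + 2 ^ l.length ∧ σ' 5 x = v) ↔
        ∃ s : List ℤ, s.Sublist l ∧ init + c * s.sum = v := by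
  have hp : 1 ≤ 2 ^ l.length := Nat.one_le_two_pow
  have hinit : init.natAbs ≤ W := by simpa using hV [] (List.nil_sublist _)
  refine Runs.assign_seq ?_ ?_ (by simp) ?_
  · simp [h6]; omega
  · simp [h10]; omega
  simp only [val, h6, h10]
  refine Runs.assign_seq (by simp) ?_ (by simp) ?_
  · simp [h6]; omega
  simp only [val, ne_eq, Store.write_of_ne, Nat.reduceEqDiff, not_false_eq_true, h6]
  refine Runs.assign_seq (by simp) ?_ (by simp) ?_
  · simp [h6]; omega
  simp only [val, ne_eq, Store.write_of_ne, Nat.reduceEqDiff, not_false_eq_true, h6]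
  refine Runs.for (N := l.length) (Tb := 34 * 2 ^ l.length + 23) (fun k σ' => σ' 14 0 = k ∧
    σ' 6 0 = m + 2 ^ k ∧ σ' 8 0 = m ∧
    (∀ a, a ∉ [5, 6, 8, 9, 13, 14] → σ' a = σ a) ∧ (∀ x < (m : ℤ), σ' 5 x = σ 5 x) ∧
    ∀ v, (∃ x : ℤ, m ≤ x ∧ x < m + 2 ^ k ∧ σ' 5 x = v) ↔
        ∃ s : List ℤ, s.Sublist (l.take k) ∧ init + c * s.sum = v)
    (by omega) ?_ ?_ ?_ ?_ ?_
  · refine ⟨by simp, by simp, by simp, fun a ha => ?_, fun x hx => ?_, fun v => ?_⟩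
    · simp only [List.mem_cons, List.not_mem_nil, or_false, not_or] at ha
      simp [ha]
    · simp [hx.ne]
    · simp only [ne_eq, Store.write_of_ne, Nat.reduceEqDiff, not_false_eq_true, Store.write_self,
        List.take_zero, List.sublist_nil, exists_eq_left, List.sum_nil, pow_zero]
      constructor
      · rintro ⟨x, hx, hx', h⟩
        rw [if_pos (by omega)] at h
        simpa using h
      · intro h
        exact ⟨m, le_rfl, by omega, by simpa using h⟩
  · rintro k hk σ' ⟨h1, -, -, h2, -⟩
    have := h2 12 (by decide)
    refine ⟨h1, ?_, ?_⟩
    · simp [this, h12]; omega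
    · simp [this, h12]
  · rintro k hk σ' ⟨h1, h2, h3, h4, h5, hv⟩
    have hk2 : 2 ^ (k + 1) ≤ 2 ^ l.length := Nat.pow_le_pow_right (by norm_num) hk
    have hk3 : 2 ^ (k + 1) = 2 * 2 ^ k := by ring
    have hpk : ((2 ^ k : ℕ) : ℤ) = 2 ^ k := by push_cast; rfl
    have hpk' : (2 : ℤ) ^ (k + 1) = 2 * 2 ^ k := by ring
    have htake : l.take (k + 1) = l.take k ++ [l.getD k 0] := by
      rw [List.take_succ_eq_append_getElem hk, List.getD_eq_getElem _ _ hk]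
    have hyl : l.getD k 0 ∈ l := by
      rw [List.getD_eq_getElem _ _ hk]; exact List.getElem_mem _
    have hyk := hl k hk
    have hyb := hy _ hyl
    have hval : ∀ s : List ℤ, s.Sublist (l.take k) → (init + c * s.sum).natAbs ≤ W ∧
        (init + c * s.sum + c * l.getD k 0).natAbs ≤ W := by
      intro s hs
      refine ⟨hV s (hs.trans (List.take_sublist _ _)), ?_⟩
      have : (s ++ [l.getD k 0]).Sublist l := by
        refine List.Sublist.trans ?_ (List.take_sublist (k + 1) l)
        rw [htake]
        exact hs.append (List.Sublist.refl _)
      have := hV _ this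
      rwa [List.sum_append, List.sum_singleton, mul_add, ← add_assoc] at this
    generalize l.getD k 0 = y at *
    rw [← hpk] at h2 hv
    have r1 := h4 1 (by decide)
    have r11 := h4 11 (by decide)
    have r15 := h4 15 (by decide)
    refine Runs.assign_seq (by simp) ?_ (by simp) ?_
    · simp only [Ok, val, h2, h3]
      refine ⟨⟨?_, ?_⟩, ⟨?_, ?_⟩, ?_⟩ <;> omega
    simp only [val, h2, h3]
    refine Runs.seq (copyShift_runs (m := m) (r := 2 ^ k) (c := c) (y := y) (z := start + k)
      ?_ ?_ ?_ ?_ ?_ ?_ ?_ ?_ ?_ ?_ hc hyb.1 hyb.2 ?_) (T₂ := 8) ?_ ?_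
    · simp [h2]
    · simp [h3]
    · simp
    · simp [r15, h15]
    · simp [r11, h11, h1]
    · omega
    · simp [r11, h11]; omega
    · simp [h1]; omega
    · simp [r1, hyk]
    · omega
    · intro x hx hx'
      simp only [ne_eq, Store.write_of_ne, Nat.reduceEqDiff, not_false_eq_true]
      obtain ⟨s, hs, hsx⟩ := (hv (σ' 5 x)).1 ⟨x, hx, hx', rfl⟩
      rw [← hsx]
      exact hval s hs
    · rintro σ₁ ⟨f1, f2⟩
      have g6 := f1 6 (by decide) (by decide)
      have g9 := f1 9 (by decide) (by decide)
      have g14 := f1 14 (by decide) (by decide)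
      have g8 := f1 8 (by decide) (by decide)
      simp only [ne_eq, Store.write_of_ne, Nat.reduceEqDiff, not_false_eq_true] at g6 g14 g8 f2
      have g9' : σ₁ 9 0 = (2 ^ k : ℕ) := by simp [g9]
      refine Runs.assign (by simp) ?_ (by simp) ?_
      · simp only [Ok, val, g6, h2, g9']
        refine ⟨⟨?_, ?_⟩, ⟨?_, ?_⟩, ?_⟩ <;> omega
      · simp only [val, g6, h2, g9']
        refine ⟨by simp [g14, h1], by simp, ?_, by simp [g8, h3], fun a ha => ?_, fun x hx => ?_,
          fun v => ?_⟩
        · rw [Store.write_of_ne _ (by decide), Store.write_self, hpk', hpk]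
          simp
          ring
        · have := h4 a ha
          simp only [List.mem_cons, List.not_mem_nil, or_false, not_or] at ha
          simp [ha, f1, this]
        · simp only [ne_eq, Store.write_of_ne, Nat.reduceEqDiff, not_false_eq_true]
          rw [f2, if_neg (by omega), h5 x hx]
        · simp only [ne_eq, Store.write_of_ne, Nat.reduceEqDiff, not_false_eq_true, htake]
          -- A selection from the first `k + 1` items omits the last one (old block) or uses it
          -- (shifted copy).
          rw [exists_sublist_concat (P := fun z => init + c * z = v), ← hv v]
          have hv' := hv (v - c * y)
          have e1 : (∃ s : List ℤ, s.Sublist (l.take k) ∧ init + c * (s.sum + y) = v) ↔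
              ∃ s : List ℤ, s.Sublist (l.take k) ∧ init + c * s.sum = v - c * y :=
            exists_congr fun s => and_congr_right fun _ => by
              rw [mul_add]; constructor <;> intro h <;> linarith
          rw [e1, ← hv', hpk', ← hpk]
          constructor
          · rintro ⟨x, hx, hx', h⟩
            rw [f2] at h
            by_cases hxk : (m : ℤ) + (2 ^ k : ℕ) ≤ x
            · rw [if_pos ⟨hxk, by omega⟩] at h
              exact Or.inr ⟨x - (2 ^ k : ℕ), by omega, by omega, by linarith⟩
            · rw [if_neg (by omega)] at h
              exact Or.inl ⟨x, hx, by omega, h⟩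
          · rintro (⟨x, hx, hx', h⟩ | ⟨x, hx, hx', h⟩)
            · exact ⟨x, hx, by omega, by rw [f2, if_neg (by omega), h]⟩
            · refine ⟨x + (2 ^ k : ℕ), by omega, by omega, ?_⟩
              rw [f2, if_pos (by omega), add_sub_cancel_right, h]
              ring
    · simp only [cost]
      omega
  · rintro σ' ⟨-, h1, -, -, h2, h3⟩
    rw [List.take_length] at h3
    exact ⟨h1, h2, h3⟩
  · simp only [cost]
    have : l.length * (34 * 2 ^ l.length + 23 + (1 + 1) + 10) =
      l.length * (34 * 2 ^ l.length + 35) := by ring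
    omega

/-! ### Cutting the items into four parts -/

/-- The `j`-th of the four parts into which a list is cut. -/
def quarter (l : List ℤ) (j : ℕ) : List ℤ :=
  (l.take ((j + 1) * l.length / 4)).drop (j * l.length / 4)

theorem quarter_length {l : List ℤ} {j : ℕ} (hj : j < 4) :
    (quarter l j).length = (j + 1) * l.length / 4 - j * l.length / 4 := by
  rw [quarter, List.length_drop, List.length_take, min_eq_left]
  interval_cases j <;> omega

theorem quarter_getD {l : List ℤ} {j i : ℕ} (hi : i < (quarter l j).length) :
    (quarter l j).getD i 0 = l.getD (j * l.length / 4 + i) 0 := by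
  rw [List.getD_eq_getElem _ _ hi]
  have : j * l.length / 4 + i < l.length := by
    rw [quarter, List.length_drop, List.length_take] at hi
    omega
  rw [List.getD_eq_getElem _ _ this]
  simp [quarter]

theorem take_append_quarter (l : List ℤ) (j : ℕ) :
    l.take (j * l.length / 4) ++ quarter l j = l.take ((j + 1) * l.length / 4) := by
  conv_rhs => rw [← List.take_append_drop (j * l.length / 4) (l.take ((j + 1) * l.length / 4))]
  rw [List.take_take, min_eq_left, quarter]
  exact Nat.div_le_div_right (Nat.mul_le_mul_right _ (by omega))

theorem quarters_eq (l : List ℤ) :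
    quarter l 0 ++ (quarter l 1 ++ (quarter l 2 ++ quarter l 3)) = l := by
  have h0 := take_append_quarter l 0
  have h1 := take_append_quarter l 1
  have h2 := take_append_quarter l 2
  have h3 := take_append_quarter l 3
  simp only [zero_mul, Nat.zero_div, List.take_zero, List.nil_append, zero_add] at h0
  rw [← h0] at h1
  rw [← h1] at h2
  rw [← h2, show (3 + 1) * l.length / 4 = l.length by omega, List.take_length] at h3
  simpa using h3

theorem quarter_sublist (l : List ℤ) (j : ℕ) : (quarter l j).Sublist l :=
  (List.drop_sublist _ _).trans (List.take_sublist _ _)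

/-- The store of the Subset Sum front: array `5` lists in its first `6` cells the numbers
satisfying `P`. -/
def Listed (W n U m : ℕ) (t : ℤ) (l : List ℤ) (P : ℤ → Prop) (σ : Store) : Prop :=
  σ 0 0 = n ∧ σ 0 1 = t ∧ (∀ i < n, σ 1 i = l.getD i 0) ∧ σ 7 0 = U ∧ σ 6 0 = m ∧ Bounded W σ ∧
    (∀ a, 16 ≤ a → σ a = 0) ∧ ∀ v, (∃ x : ℤ, 0 ≤ x ∧ x < m ∧ σ 5 x = v) ↔ P v

/-- Appends the numbers `8 * (h * U + d * t) + c * s`, `s` a sum of items of the `j`-th part. -/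
def quarterProg (j : ℕ) (h d c : ℤ) : Prog :=
  .seq (.assign 10 (.const 0)
    (.mul (.const 8) (.add (.mul (.const h) (var 7)) (.mul (.const d) (.cell 0 (.const 1))))))
  (.seq (.assign 11 (.const 0) (.div (.mul (.const j) (var 0)) (.const 4)))
  (.seq (.assign 12 (.const 0)
    (.sub (.div (.mul (.const (j + 1)) (var 0)) (.const 4)) (var 11)))
  (.seq (.assign 15 (.const 0) (.const c)) appendSums)))

/-- With `h`, `d`, `c` as in `subsetSumProg` the appended numbers are slot positions; in the last
part `8 * (4022 * U + t) - 8 * s` is the slot of `s - t`, so the target is absorbed there. -/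
theorem quarterProg_runs {W U m L M j : ℕ} {h d c t : ℤ} {l : List ℤ} {P : ℤ → Prop} {σ : Store}
    (hσ : Listed W l.length U m t l P σ) (hj : j < 4) (hh : 0 ≤ h ∧ h ≤ 5000)
    (hd : d = 0 ∨ d = 1) (hc : c = 8 ∨ c = -8) (hU : 1 + t * t + sqSum l ≤ U)
    (hW : 100000 * U + 40 * M + 100 ≤ W) (hM : m + 2 ^ (quarter l j).length ≤ M)
    (hn : 4 * l.length ≤ W) (hL : (quarter l j).length ≤ L) :
    Runs W (quarterProg j h d c) σ (L * (34 * M + 35) + 80)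
      (Listed W l.length U (m + 2 ^ (quarter l j).length) t l
        fun v => P v ∨ ∃ s : List ℤ, s.Sublist (quarter l j) ∧
          8 * (h * U + d * t) + c * s.sum = v) := by
  obtain ⟨h0, h1, hl, h7, h6, hb, hz, hv⟩ := hσ
  have hq := quarter_length (l := l) hj
  have hL' : (quarter l j).length * (34 * 2 ^ (quarter l j).length + 35) ≤ L * (34 * M + 35) :=
    Nat.mul_le_mul hL (by omega)
  have ht := abs_le_mul_self t
  have ht0 := abs_nonneg t
  have ht1 := le_abs_self t
  have ht2 := neg_abs_le t
  have hl0 := sqSum_nonneg l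
  have hUh : 0 ≤ h * U ∧ h * U ≤ 5000 * U := by
    refine ⟨by nlinarith, by nlinarith⟩
  have hdt : -(U : ℤ) ≤ d * t ∧ d * t ≤ U := by
    rcases hd with rfl | rfl <;> omega
  have hjn : ((j * l.length / 4 : ℕ) : ℤ) = (j : ℤ) * l.length / 4 := by push_cast; rfl
  have hjn' : (((j + 1) * l.length / 4 : ℕ) : ℤ) = ((j : ℤ) + 1) * l.length / 4 := by
    push_cast; rfl
  have hj1 : j * l.length ≤ 4 * l.length := Nat.mul_le_mul_right _ (by omega)
  have hj2 : (j + 1) * l.length ≤ 4 * l.length := Nat.mul_le_mul_right _ (by omega)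
  have hj3 : j * l.length ≤ (j + 1) * l.length := Nat.mul_le_mul_right _ (by omega)
  have hj4 : (j : ℤ) * l.length = (j * l.length : ℕ) := by push_cast; rfl
  have hj5 : ((j : ℤ) + 1) * l.length = ((j + 1) * l.length : ℕ) := by push_cast; rfl
  refine Runs.assign_seq (by simp) ?_ (by simp) ?_
  · simp only [Ok, val, h1, h7]
    refine ⟨?_, ⟨⟨?_, ⟨?_, ?_⟩, ?_⟩, ⟨?_, ⟨?_, ?_⟩, ?_⟩, ?_⟩, ?_⟩ <;> omega
  simp only [val, h1, h7]
  refine Runs.assign_seq (by simp) ?_ (by simp) ?_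
  · simp only [Ok, val, ne_eq, Store.write_of_ne, OfNat.zero_ne_ofNat, not_false_eq_true, h0]
    refine ⟨⟨?_, ⟨?_, ?_⟩, ?_⟩, ?_, ?_⟩ <;> omega
  simp only [val, ne_eq, Store.write_of_ne, OfNat.zero_ne_ofNat, not_false_eq_true, h0]
  refine Runs.assign_seq (by simp) ?_ (by simp) ?_
  · simp only [Ok, val, ne_eq, Store.write_of_ne, OfNat.zero_ne_ofNat, not_false_eq_true, h0,
      Store.write_self, if_true]
    refine ⟨⟨⟨?_, ⟨?_, ?_⟩, ?_⟩, ?_, ?_⟩, ⟨?_, ?_⟩, ?_⟩ <;> omega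
  simp only [val, ne_eq, Store.write_of_ne, OfNat.zero_ne_ofNat, not_false_eq_true, h0,
      Store.write_self, if_true]
  refine Runs.assign_seq (by simp) ?_ (by simp) ?_
  · simp only [Ok]; omega
  simp only [val]
  -- Every sum of items is bounded by `U`, so no intermediate value overflows.
  have hs : ∀ s : List ℤ, s.Sublist (quarter l j) → -(U : ℤ) ≤ s.sum ∧ s.sum ≤ U := by
    intro s hs
    have := abs_le.1 (abs_sum_le_sqSum (hs.trans (quarter_sublist l j)))
    omega
  refine (Runs.frame (by omega) (appendSums_runs (m := m) (start := j * l.length / 4)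
    (init := 8 * (h * U + d * t)) (c := c) (l := quarter l j) ?_ ?_ ?_ ?_ ?_ ?_ ?_ ?_ ?_ ?_ ?_)
    ?_).mono ?_ |>.imp ?_
  · simp [h6]
  · simp
  · simp
  · simp only [ne_eq, Store.write_of_ne, Nat.reduceEqDiff, not_false_eq_true, Store.write_self,
      if_true, hq]
    omega
  · simp
  · intro i hi
    have := hl (j * l.length / 4 + i) (by omega)
    rw [quarter_getD hi, ← this]
    simp
  · omega
  · omega
  · omega
  · intro y hy
    have := hs [y] (List.singleton_sublist.2 hy)
    simp only [List.sum_singleton] at this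
    rcases hc with rfl | rfl <;> omega
  · intro s hs'
    have := hs s hs'
    rcases hc with rfl | rfl <;> omega
  · refine (((hb.write ?_).write ?_).write ?_).write ?_ <;> omega
  · simp only [cost]; omega
  · rintro σ' ⟨⟨g6, g5, gv⟩, hb', hf⟩
    have hf' : ∀ a, a ∉ appendSums.writes → a ∉ [10, 11, 12, 15] → σ' a = σ a := by
      intro a ha ha'
      simp only [List.mem_cons, List.not_mem_nil, or_false, not_or] at ha'
      simp [hf a ha, ha']
    have f0 := hf' 0 (by decide) (by decide)
    have f1 := hf' 1 (by decide) (by decide)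
    have f7 := hf' 7 (by decide) (by decide)
    simp only [ne_eq, Store.write_of_ne, Nat.reduceEqDiff, not_false_eq_true] at g5
    refine ⟨by rw [f0, h0], by rw [f0, h1], by rwa [f1], by rw [f7, h7], by rw [g6]; push_cast; rfl,
      hb', fun a ha => ?_, fun v => ?_⟩
    · rw [hf' a (fun hmem => ?_) (fun hmem => ?_), hz a ha]
      · have : ∀ b ∈ appendSums.writes, b < 16 := by decide
        exact absurd (this a hmem) (by omega)
      · have : ∀ b ∈ [10, 11, 12, 15], b < 16 := by decide
        exact absurd (this a hmem) (by omega)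
    · beta_reduce
      rw [← hv v, ← gv v]
      push_cast
      constructor
      · rintro ⟨x, hx, hx', hxv⟩
        by_cases hxm : x < m
        · exact Or.inl ⟨x, hx, hxm, by rw [← g5 x hxm, hxv]⟩
        · exact Or.inr ⟨x, by omega, hx', hxv⟩
      · rintro (⟨x, hx, hx', hxv⟩ | ⟨x, hx, hx', hxv⟩)
        · exact ⟨x, hx, by have : (0 : ℤ) ≤ 2 ^ (quarter l j).length := by positivity
                           omega, by rw [g5 x hx', hxv]⟩
        · exact ⟨x, by omega, hx', hxv⟩

/-- Number of sums of items of one of the four parts. -/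
def sumCount (l : List ℤ) : ℕ :=
  2 ^ (quarter l 0).length + 2 ^ (quarter l 1).length + 2 ^ (quarter l 2).length +
    2 ^ (quarter l 3).length

/-- Sums of items of the `j`-th part, the target being subtracted in the last one. -/
def partSums (I : SubsetSum) (j : Fin 4) : List ℤ :=
  (quarter I.items j).sublists.map fun s => s.sum - if j = 3 then I.target else 0

theorem mem_partSums {I : SubsetSum} {j : Fin 4} {a : ℤ} : a ∈ partSums I j ↔
    ∃ s : List ℤ, s.Sublist (quarter I.items j) ∧ s.sum - (if j = 3 then I.target else 0) = a := by
  simp [partSums]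

theorem subsetSum_yes_iff (I : SubsetSum) :
    I.Yes ↔ ∃ a : Fin 4 → ℤ, (∀ j, a j ∈ partSums I j) ∧ ∑ j, a j = 0 := by
  simp only [SubsetSum.Yes, mem_partSums]
  constructor
  · rintro ⟨s, hs, ht⟩
    rw [← quarters_eq I.items] at hs
    obtain ⟨s0, s', rfl, h0, hs⟩ := List.sublist_append_iff.1 hs
    obtain ⟨s1, s', rfl, h1, hs⟩ := List.sublist_append_iff.1 hs
    obtain ⟨s2, s3, rfl, h2, h3⟩ := List.sublist_append_iff.1 hs
    simp only [List.sum_append] at ht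
    refine ⟨![s0.sum, s1.sum, s2.sum, s3.sum - I.target], ?_, ?_⟩
    · simp only [Fin.forall_fin_succ]
      exact ⟨⟨s0, h0, by simp⟩, ⟨s1, h1, by simp⟩, ⟨s2, h2, by simp⟩, ⟨s3, h3, by simp⟩,
        fun i => i.elim0⟩
    · simp [Fin.sum_univ_four]
      linarith
  · rintro ⟨a, ha, hsum⟩
    obtain ⟨s0, h0, e0⟩ := ha 0
    obtain ⟨s1, h1, e1⟩ := ha 1
    obtain ⟨s2, h2, e2⟩ := ha 2
    obtain ⟨s3, h3, e3⟩ := ha 3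
    refine ⟨s0 ++ (s1 ++ (s2 ++ s3)), ?_, ?_⟩
    · rw [← quarters_eq I.items]
      exact h0.append (h1.append (h2.append h3))
    · rw [Fin.sum_univ_four] at hsum
      have n0 : ¬ (0 : Fin 4) = 3 := by decide
      have n1 : ¬ (1 : Fin 4) = 3 := by decide
      have n2 : ¬ (2 : Fin 4) = 3 := by decide
      simp only [n0, n1, n2, if_true, if_false] at e0 e1 e2 e3
      simp only [List.sum_append]
      linarith

def subsetSumProg (lc : Prog) : Prog :=
  .seq sqSumProg
  (.seq (quarterProg 0 1020 0 (-8))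
  (.seq (quarterProg 1 2022 0 8)
  (.seq (quarterProg 2 3020 0 8)
  (.seq (quarterProg 3 4022 1 (-8)) (reduceProg lc)))))

theorem SubsetSum.le_size (I : SubsetSum) :
    (∀ x ∈ I.items, x.natAbs ≤ I.size) ∧ I.target.natAbs ≤ I.size ∧
      I.items.length + 1 ≤ I.size := by
  have h : ∀ x ∈ I.target :: I.items, x.natAbs ≤ I.size := fun x hx =>
    (natAbs_le_maxAbs hx).trans (Nat.le_add_left _ _)
  refine ⟨fun x hx => h x (List.mem_cons_of_mem _ hx), h _ List.mem_cons_self, ?_⟩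
  have := Nat.lt_two_pow_self (n := I.items.length)
  simp only [SubsetSum.size]
  omega

theorem subsetSum_pow_bound {S U m c : ℕ} (hU : U ≤ 1 + S * S * S) (hm : m ≤ 4 * S) :
    100000 * U + 40 * m + 100 ≤ (S + 2) ^ (20 * (c + 1)) ∧
      (100000 * U + 40 * m + 100) ^ c ≤ (S + 2) ^ (20 * (c + 1)) := by
  have h3 : 100000 * U + 40 * m + 100 ≤ (S + 2) ^ 20 := by
    calc 100000 * U + 40 * m + 100 ≤ 2 ^ 17 * (S + 2) ^ 3 := by nlinarith [sq_nonneg S]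
      _ ≤ (S + 2) ^ 17 * (S + 2) ^ 3 := Nat.mul_le_mul_right _ (Nat.pow_le_pow_left (by omega) _)
      _ = (S + 2) ^ 20 := by rw [← pow_add]
  refine ⟨h3.trans (Nat.pow_le_pow_right (by omega) (by omega)), ?_⟩
  calc _ ≤ ((S + 2) ^ 20) ^ c := Nat.pow_le_pow_left h3 c
    _ = (S + 2) ^ (20 * c) := by rw [← pow_mul]
    _ ≤ _ := Nat.pow_le_pow_right (by omega) (by omega)

theorem le_clog_sumCount (l : List ℤ) :
    (∀ j < 4, (quarter l j).length ≤ Nat.clog 2 (sumCount l)) ∧ 4 ≤ sumCount l ∧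
      l.length ≤ 4 * Nat.clog 2 (sumCount l) := by
  have hp : ∀ j, 1 ≤ 2 ^ (quarter l j).length := fun j => Nat.one_le_two_pow
  have h : ∀ j < 4, (quarter l j).length ≤ Nat.clog 2 (sumCount l) := by
    intro j hj
    have : 2 ^ (quarter l j).length ≤ sumCount l := by
      have := hp 0
      have := hp 1
      have := hp 2
      have := hp 3
      unfold sumCount
      interval_cases j <;> omega
    have := Nat.clog_mono_right 2 this
    rwa [Nat.clog_pow 2 _ (by norm_num)] at this
  refine ⟨h, ?_, ?_⟩
  · have := hp 0
    have := hp 1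
    have := hp 2
    have := hp 3
    unfold sumCount
    omega
  · have := congrArg List.length (quarters_eq l)
    simp only [List.length_append] at this
    have := h 0 (by norm_num)
    have := h 1 (by norm_num)
    have := h 2 (by norm_num)
    have := h 3 (by norm_num)
    omega

theorem word_range_bound (S c : ℕ) : 4 * S + 8 ≤ (S + 2) ^ (20 * (c + 1)) := by
  have h : 4 * S + 8 ≤ (S + 2) ^ 3 := by nlinarith [sq_nonneg S]
  exact h.trans (Nat.pow_le_pow_right (by omega) (by omega))

theorem subsetSumProg_runs {lc : Prog} {cw K : ℕ} {e : ℝ} (he : 0 ≤ e)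
    (hlc : ∀ I : Instance, I.Valid → I.P.length ≤ 20 → ∃ (t : ℕ) (σ : Store),
      Exec ((I.size + 2) ^ cw) lc (load I.input) t σ ∧ I.Correct σ ∧
        (t : ℝ) ≤ K * (I.Q.length : ℝ) ^ e) (I : SubsetSum) :
    Runs ((I.size + 2) ^ (20 * (cw + 1))) (subsetSumProg lc) (load I.input)
      (2 * (Nat.clog 2 (sumCount I.items) * (300 * sumCount I.items + 50) +
        700 * sumCount I.items + 3100 + ⌊(K : ℝ) * (12 * (sumCount I.items : ℕ) : ℝ) ^ e⌋₊))
      (Decides I.Yes) := by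
  obtain ⟨hx, ht, hn⟩ := I.le_size
  obtain ⟨hL, hm4, hnL⟩ := le_clog_sumCount I.items
  have hs0 := sqSum_nonneg I.items
  have hsq := sqSum_le hx
  have htt := abs_le_mul_self I.target
  have ht0 := abs_nonneg I.target
  obtain ⟨U, hU⟩ : ∃ U : ℕ, (U : ℤ) = 1 + I.target * I.target + sqSum I.items :=
    ⟨(1 + I.target * I.target + sqSum I.items).toNat, Int.toNat_of_nonneg (by omega)⟩
  have hU1 : 1 ≤ U := by omega
  -- `U - 1` is a sum of `n + 1 ≤ size` squares, each at most `size ^ 2`.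
  have hUS : U ≤ 1 + I.size * I.size * I.size := by
    have h1 : I.target * I.target ≤ (I.size : ℤ) * I.size := by
      rw [← Int.natAbs_mul_self]
      exact_mod_cast Nat.mul_le_mul ht ht
    have h2 : ((I.items.length : ℤ) + 1) * (I.size * I.size) ≤ I.size * (I.size * I.size) :=
      mul_le_mul_of_nonneg_right (by exact_mod_cast hn) (by positivity)
    zify
    nlinarith
  have hmS : sumCount I.items ≤ 4 * I.size := by
    have h : ∀ j, 2 ^ (quarter I.items j).length ≤ I.size := fun j =>
      (Nat.pow_le_pow_right (by norm_num) (quarter_sublist _ j).length_le).trans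
        (Nat.le_add_right _ _)
    have := h 0
    have := h 1
    have := h 2
    have := h 3
    unfold sumCount
    omega
  obtain ⟨hW1, hW2⟩ := subsetSum_pow_bound (c := cw) hUS hmS
  have hSW := word_range_bound I.size cw
  set W := (I.size + 2) ^ (20 * (cw + 1))
  set m := sumCount I.items with hm
  set L := Nat.clog 2 m
  have hb : Bounded W (load I.input) := by
    refine load_bounded fun l hl x hxl => ?_
    simp only [SubsetSum.input, List.mem_cons, List.not_mem_nil, or_false] at hl
    rcases hl with rfl | rfl
    · simp only [List.mem_cons, List.not_mem_nil, or_false] at hxl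
      rcases hxl with rfl | rfl <;> omega
    · have := hx x hxl
      omega
  have hl : ∀ i < I.items.length, load I.input 1 i = I.items.getD i 0 := by
    intro i hi
    simp [load, SubsetSum.input]
  have hlz : ∀ a, 2 ≤ a → load I.input a = 0 := by
    intro a ha
    funext i
    have he' : I.input.getD a [] = [] :=
      List.getD_eq_default _ _ (by simp [SubsetSum.input]; omega)
    simp only [load, he']
    simp
  have hl0 : load I.input 0 0 = I.items.length := rfl
  have hl1 : load I.input 0 1 = I.target := rfl
  generalize load I.input = σ at *
  set R := Nat.clog 2 m * (300 * m + 50) + 700 * m + 3100 + ⌊(K : ℝ) * (12 * (m : ℕ) : ℝ) ^ e⌋₊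
  -- Enumerating the sums fits into the time budget `R` of the subsequent reduction, which explains
  -- the factor 2.
  have hR : 40 * I.items.length + 40 + 4 * (L * (34 * m + 35) + 80) ≤ R := by
    have h1 : L * (34 * m + 35) = 34 * (L * m) + 35 * L := by ring
    have h2 : Nat.clog 2 m * (300 * m + 50) = 300 * (L * m) + 50 * L := by ring
    have h3 : L * 4 ≤ L * m := Nat.mul_le_mul_left _ hm4
    omega
  refine Runs.seq (Runs.frame (by omega) (sqSumProg_runs hl0 hl1 hl (by omega) (by omega)) hb)
    (T₂ := 4 * (L * (34 * m + 35) + 80) + R) ?_ (by omega)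
  rintro σ₁ ⟨hs, b1, f1⟩
  have hw1 : ∀ b ∈ sqSumProg.writes, 2 ≤ b ∧ b < 16 := by decide
  have hlist : Listed W I.items.length U 0 I.target I.items (fun _ => False) σ₁ := by
    have f0 := f1 0 (fun h => absurd (hw1 _ h) (by omega))
    have f1' := f1 1 (fun h => absurd (hw1 _ h) (by omega))
    have f6 := f1 6 (by decide)
    refine ⟨by rw [f0, hl0], by rw [f0, hl1], by rwa [f1'], by rw [hs, hU], ?_, b1,
      fun a ha => ?_, fun v => ?_⟩
    · rw [f6, hlz 6 (by norm_num)]; rfl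
    · rw [f1 a (fun h => absurd (hw1 _ h) (by omega)), hlz a (by omega)]
    · simp only [iff_false, not_exists]
      rintro x ⟨hx, hx', -⟩
      push_cast at hx'
      omega
  unfold sumCount at hm
  have hp : ∀ j, 0 < 2 ^ (quarter I.items j).length := fun j => by positivity
  have hp1 := hp 1
  have hp2 := hp 2
  have hp3 := hp 3
  refine Runs.seq (quarterProg_runs (M := m) (L := L) hlist (by norm_num) (by norm_num)
    (Or.inl rfl) (Or.inr rfl) hU.ge hW1 (by omega) (by omega) (hL 0 (by norm_num)))
    (T₂ := 3 * (L * (34 * m + 35) + 80) + R) ?_ (by omega)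
  intro σ₂ hlist
  refine Runs.seq (quarterProg_runs (M := m) (L := L) hlist (by norm_num) (by norm_num)
    (Or.inl rfl) (Or.inl rfl) hU.ge hW1 (by omega) (by omega) (hL 1 (by norm_num)))
    (T₂ := 2 * (L * (34 * m + 35) + 80) + R) ?_ (by omega)
  intro σ₃ hlist
  refine Runs.seq (quarterProg_runs (M := m) (L := L) hlist (by norm_num) (by norm_num)
    (Or.inl rfl) (Or.inl rfl) hU.ge hW1 (by omega) (by omega) (hL 2 (by norm_num)))
    (T₂ := (L * (34 * m + 35) + 80) + R) ?_ (by omega)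
  intro σ₄ hlist
  refine Runs.seq (quarterProg_runs (M := m) (L := L) hlist (by norm_num) (by norm_num)
    (Or.inr rfl) (Or.inr rfl) hU.ge hW1 (by omega) (by omega) (hL 3 (by norm_num)))
    (T₂ := R) ?_ (by omega)
  rintro σ₅ ⟨-, -, -, g7, g6, gb, gz, gv⟩
  rw [zero_add, ← hm] at g6 gv
  rw [subsetSum_yes_iff]
  -- Only the number of vertices of the pattern is restricted here: `U` need not be polynomial in
  -- the number of vertices of the container.
  refine reduceProg_runs_of_largestCopy (A := partSums I) he hlc (by omega)
    (fun c s _ => pattern_length.le) hU1 hW1 hW2 gb g6 g7 gz ?_ fun v => (gv v).trans ?_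
  · intro j a ha
    obtain ⟨s, hs, rfl⟩ := mem_partSums.1 ha
    have h1 := abs_le.1 (abs_sum_le_sqSum (hs.trans (quarter_sublist _ _)))
    have h2 := abs_le.1 htt
    split_ifs <;> omega
  · have n0 : ¬ (0 : Fin 4) = 3 := by decide
    have n1 : ¬ (1 : Fin 4) = 3 := by decide
    have n2 : ¬ (2 : Fin 4) = 3 := by decide
    simp only [IsSlot, mem_partSums, n0, n1, n2, if_true, if_false, false_or, or_assoc]
    refine or_congr ?_ (or_congr ?_ (or_congr ?_ ?_))
    all_goals
      constructor
      · rintro ⟨s, hs, rfl⟩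
        exact ⟨_, ⟨s, hs, rfl⟩, by ring⟩
      · rintro ⟨_, ⟨s, hs, rfl⟩, rfl⟩
        exact ⟨s, hs, by ring⟩

theorem sumCount_le (l : List ℤ) : (sumCount l : ℝ) ≤ 16 * (2 : ℝ) ^ ((l.length : ℝ) / 4) := by
  have h : ∀ j < 4, ((2 ^ (quarter l j).length : ℕ) : ℝ) ≤ 2 * (2 : ℝ) ^ ((l.length : ℝ) / 4) := by
    intro j hj
    have h1 : 4 * (quarter l j).length ≤ l.length + 4 := by
      rw [quarter_length hj]
      interval_cases j <;> omega
    have h2 : (4 : ℝ) * (quarter l j).length ≤ l.length + 4 := by exact_mod_cast h1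
    push_cast
    rw [← Real.rpow_natCast, mul_comm, ← Real.rpow_add_one (by norm_num)]
    exact Real.rpow_le_rpow_of_exponent_le (by norm_num) (by linarith)
  have h0 := h 0 (by norm_num)
  have h1 := h 1 (by norm_num)
  have h2 := h 2 (by norm_num)
  have h3 := h 3 (by norm_num)
  have : (0 : ℝ) ≤ (2 : ℝ) ^ ((l.length : ℝ) / 4) := by positivity
  unfold sumCount
  rw [Nat.cast_add, Nat.cast_add, Nat.cast_add]
  linarith

theorem largestCopy_hard_of_subsetSum (h : SubsetSumHypothesis) {ε : ℝ} (hε : 0 < ε) :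
    ¬ LargestCopyInTime (fun I => I.P.length ≤ 20) (2 - ε) := by
  intro hlc
  obtain ⟨lc, cw, K, hlc⟩ := largestCopy_weaken hlc
  have hδ : 0 < min ε (1 / 2) := lt_min hε (by norm_num)
  have hδ' : min ε (1 / 2) ≤ 1 / 2 := min_le_right _ _
  set e := 2 - min ε (1 / 2) with he
  have hlt : (2 : ℝ) ^ (e / 2) < 2 := by
    conv_rhs => rw [← Real.rpow_one 2]
    exact Real.rpow_lt_rpow_of_exponent_lt (by norm_num) (by linarith)
  have hpos : (0 : ℝ) < 2 ^ (e / 2) := by positivity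
  -- The base is chosen such that `(2 ^ (n / 4)) ^ e = (2 ^ (e / 2)) ^ (n / 2)`; it is below 2
  -- because `e < 2`.
  refine h (2 - 2 ^ (e / 2)) (by linarith) (by linarith)
    ⟨subsetSumProg lc, 20 * (cw + 1), 2 * (1280000 + 40000 * K), fun I _ => ?_⟩
  obtain ⟨t, σ, h1, h2, h3⟩ := subsetSumProg_runs (by linarith) hlc I
  refine ⟨t, σ, h1, h3, ?_⟩
  have hT := reduce_time_le (m := sumCount I.items) (K := K)
    (by have := (le_clog_sumCount I.items).2.1; omega) (sumCount_le I.items)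
    (e := e) (by linarith) (by linarith)
  have h4 : (t : ℝ) ≤ ((_ : ℕ) : ℝ) := Nat.cast_le.2 h2
  rw [Nat.cast_mul] at h4
  have hx : (2 - (2 - (2 : ℝ) ^ (e / 2))) ^ ((I.items.length : ℝ) / 2) =
      ((2 : ℝ) ^ ((I.items.length : ℝ) / 4)) ^ e := by
    rw [sub_sub_cancel, ← Real.rpow_mul (by norm_num), ← Real.rpow_mul (by norm_num)]
    congr 1
    ring
  beta_reduce
  rw [hx]
  refine h4.trans ((mul_le_mul_of_nonneg_left hT (by positivity)).trans (le_of_eq ?_))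
  push_cast
  ring

end Placement

theorem theorem3 :
    (Placement.FourSumHypothesis →
      ∃ p₀ C : ℕ, ∀ ε : ℝ, 0 < ε →
        ¬ Placement.LargestCopyInTime
          (fun I => I.P.length ≤ p₀ ∧ I.P.maxCoord ≤ I.Q.length ^ C ∧
            I.Q.maxCoord ≤ I.Q.length ^ C) (2 - ε)) ∧
    (Placement.SubsetSumHypothesis →
      ∃ p₀ : ℕ, ∀ ε : ℝ, 0 < ε →
        ¬ Placement.LargestCopyInTime (fun I => I.P.length ≤ p₀) (2 - ε)) := by
  exact ⟨fun h => ⟨20, 9, fun _ hε => Placement.largestCopy_hard_of_fourSum h hε⟩,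
    fun h => ⟨20, fun _ hε => Placement.largestCopy_hard_of_subsetSum h hε⟩⟩
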